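/- **Setting.** Let $n\ge 1$, let $\mathcal H_n=\{z\in M_n(\mathbb C): i(z^*-z)>0\}$, let $K\subset\mathbb C$ be an imaginary quadratic field and let $L\subset K^n\times K^n$ be a $\mathbb Z$-lattice (a finitely generated subgroup that spans over $\mathbb Q$). For $z\in\mathcal H_n$ put $p_z(x_1,x_2)=(z\bar x_1+\bar x_2,\ {}^tz x_1+x_2)$ on $\mathbb C^n\times\mathbb C^n$, and let $A_z=\mathbb C^{2n}/p_z(L)$; an element $a\in K$ with $aL\subset L$ acts on $A_z$ by $\iota(a)=\mathrm{diag}(\bar a,a)$. Write $(u^-,u^+)$ for the coordinates on $\mathbb C^{2n}=\mathbb C^n\times\mathbb C^n$. All modules are over $C^\infty=C^\infty(\mathcal H_n,\mathbb C)$. Let $H^1_{DR}$ be the relative $C^\infty$ de Rham cohomology (closed modulo exact relative one-forms) of the family $(A_z)_{z}$ over $\mathcal H_n$, and let $H^{+}$ (resp. $H^-$) be the part on which $\iota(a)^*=a$ (resp. $\iota(a)^*=\bar a$) for all $a\in K$ with $aL\subset L$. Let $\underline\omega^\pm\subset H^\pm$ and $\mathrm{Split}^\pm\subset H^\pm$ be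 the classes of fibrewise holomorphic, resp. antiholomorphic, one-forms. Let $\Omega=\bigoplus_{i,j} C^\infty dz_{ij}$, and let $\nabla=\sum_{ij}\nabla_{ij}\otimes dz_{ij}$ be the Gauss–Manin connection: in the $C^\infty$ trivialization $p_z:(\mathbb C^n\times\mathbb C^n)/L\cong A_z$ it differentiates relative forms along $\partial/\partial z_{ij}$ with $x$ fixed. It preserves $H^\pm$. The Kodaira–Spencer morphism $KS:\underline\omega^-\otimes\underline\omega^+\to\Omega$ is $w\otimes w'\mapsto\sum_{ij}Q(\mathrm{pr}_{\mathrm{Split}}\nabla_{ij}w,w')\,dz_{ij}$, where $Q$ is the pairing on $H^1_{DR}$ dual to the Riemann form $E(x,y)=2\,\mathrm{Re}\sum_j(x_{2,j}\bar y_{1,j}-x_{1,j}\bar y_{2,j})$, i.e. $Q(E(a,\cdot),E(b,\cdot))=E(b,a)$ on translation-invariant forms. **Representations.** Let $(\rho,V)=(\rho_-\otimes\rho_+,V_-\otimes V_+)$ be a representation of $GL_n(\mathbb C)\times GL_n(\mathbb C)$, where $\rho_\pm$ is a quotient of a tensor power $\rho_{st}^{\otimes d_\pm}$ ($d_\pm\ge0$)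 of the standard representation on $\mathbb C^n$. By Schur–Weyl duality $V_\pm=(\mathbb C^n)^{\otimes d_\pm}/\sum_{a\in J_\pm}a\cdot(\mathbb C^n)^{\otimes d_\pm}$ for some $J_\pm\subset\mathbb C[S_{d_\pm}]$, and $M^{\rho_\pm}$ denotes the same quotient of $M^{\otimes d_\pm}$ for a module $M$. The connection $\nabla$ extends by the product rule to $X_d=(H^-)^{\rho_-}\otimes(H^+)^{\rho_+}\otimes(H^-\otimes H^+)^{\otimes d}$. **Geometric operator.** Let $D^\rho:X_d\to X_{d+1}$ be $\nabla$ followed by $\mathrm{id}\otimes KS^{-1}:X_d\otimes\Omega\cong X_d\otimes\underline\omega^-\otimes\underline\omega^+\to X_{d+1}$. Then $$\partial(\rho,C^\infty,d):(\underline\omega^-)^{\rho_-}\otimes(\underline\omega^+)^{\rho_+}\to(\underline\omega^-)^{\rho_-}\otimes(\underline\omega^+)^{\rho_+}\otimes\Omega^{\otimes d}$$ is the inclusion into $X_0$, followed by $(D^\rho)^d$, by the projection modulo $\mathrm{Split}$ in every factor, and by $KS^{\otimes d}$. **Shimura's operator.** Let $T=M_n(\mathbb C)$, and let $Ml_d(T,V)$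 be the space of $\mathbb C$-multilinear maps $T^d\to V$. For $a,b\in GL_n(\mathbb C)$ put $[(\rho\otimes\tau^d)(a,b)h](u_1,\dots,u_d)=\rho(a,b)h({}^ta u_1b,\dots,{}^ta u_db)$, and let $\Xi(z)=(\xi,\eta)=(i(\bar z-{}^tz),\,i(z^*-z))$. For smooth $f$ let $(Df)(u)=\sum_{ij}u_{ij}\,\partial f/\partial z_{ij}$ and $(Cf)(u)=(Df)({}^t\xi u\eta)$, where in iterates $u$ is the new variable. Shimura's operators are $D_\rho f=\rho(\Xi)^{-1}D[\rho(\Xi)f]$ and $D_\rho^df=(\rho\otimes\tau^d)(\Xi)^{-1}C^d[\rho(\Xi)f]$. **Frame.** Let $\lambda=(\lambda^-,\lambda^+)$ be the standard frame $\lambda^\pm:\mathbb C^n\to\underline\omega^\pm$, $e_i\mapsto du_i^\pm$. It induces a map $\lambda$ from smooth $V$-valued functions to $(\underline\omega^-)^{\rho_-}\otimes(\underline\omega^+)^{\rho_+}$ and, by $u_{ij}\mapsto KS(\lambda^-(e_i)\otimes\lambda^+(e_j))$, from smooth $Ml_d(T,V)$-valued functions to $(\underline\omega^-)^{\rho_-}\otimes(\underline\omega^+)^{\rho_+}\otimes\Omega^{\otimes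 d}$. **Statement.** Every class in $H^1_{DR}$ has a unique translation-invariant representative, $H^\pm=\underline\omega^\pm\oplus\mathrm{Split}^\pm$, and $KS:\underline\omega^-\otimes\underline\omega^+\to\Omega$ is an isomorphism (so the above is well defined). For every $\rho$ as above and every $C^\infty$ function $f:\mathcal H_n\to V=V_-\otimes V_+$: 1. $D_\rho f$ is smooth and $\partial(\rho,C^\infty,1)(\lambda(f))=\lambda(D_\rho f)$. 2. For every $d\ge 0$, $D_\rho^df$ is smooth and $\partial(\rho,C^\infty,d)(\lambda(f))=\lambda(D_\rho^df)$. 3. For every $d\ge 0$ and every subspace $N\subset Ml_d(T,V)$ stable under $\rho\otimes\tau^d$, let $\phi_Z$ denote the projections of $Ml_d(T,V)$ onto $Ml_d(T,V)/N$ and of $(\underline\omega^-)^{\rho_-}\otimes(\underline\omega^+)^{\rho_+}\otimes\Omega^{\otimes d}$ onto the corresponding quotient $Z$ (by the $C^\infty$-span of $\lambda(N)$), and put $D_\rho^Z=\phi_Z D_\rho^d$, $\partial(\rho,C^\infty,d)^Z=\phi_Z\circ\partial(\rho,C^\infty,d)$. Then $D_\rho^Zf$ is smooth and $\partial(\rho,C^\infty,d)^Z(\lambda(f))=\lambda(D_\rho^Zf)$.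 -/

import Mathlib

open scoped TensorProduct ComplexConjugate ContDiff Matrix ComplexOrder

noncomputable section

namespace UnitaryDiffOp

set_option linter.unusedSectionVars false

section Connections

variable {R : Type} [CommRing R] [Algebra ℂ R] {ι : Type}

/-- A connection on `M`, given by its components along the derivations `del k` of `R`. -/
structure Conn (del : ι → Derivation ℂ R R) (M : Type) [AddCommGroup M] [Module R M] where
  toFun : ι → M →+ M
  leibniz : ∀ (k : ι) (r : R) (m : M), toFun k (r • m) = del k r • m + r • toFun k m

variable {del : ι → Derivation ℂ R R} {M N : Type} [AddCommGroup M] [Module R M]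
  [AddCommGroup N] [Module R N]

/-- The product rule on `M ⊗ N`. -/
def Conn.tensor (nM : Conn del M) (nN : Conn del N) : Conn del (M ⊗[R] N) where
  toFun k := TensorProduct.liftAddHom
    (AddMonoidHom.mk' (fun m => AddMonoidHom.mk'
        (fun n => nM.toFun k m ⊗ₜ[R] n + m ⊗ₜ[R] nN.toFun k n)
        (fun a b => by simp only [map_add, TensorProduct.tmul_add]; abel))
      (fun a b => by
        ext n
        simp only [map_add, TensorProduct.add_tmul, AddMonoidHom.mk'_apply,
          AddMonoidHom.add_apply]
        abel))
    (fun r m n => by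
      simp only [AddMonoidHom.mk'_apply, nM.leibniz, nN.leibniz, TensorProduct.add_tmul,
        TensorProduct.tmul_add, TensorProduct.smul_tmul]
      abel)
  leibniz k r t := by
    induction t with
    | zero => simp
    | tmul m n =>
      simp only [TensorProduct.smul_tmul', TensorProduct.liftAddHom_tmul, AddMonoidHom.mk'_apply,
        nM.leibniz, TensorProduct.add_tmul, smul_add, add_assoc]
    | add x y hx hy =>
      simp only [smul_add, map_add, hx, hy]
      abel

def Conn.piAux (nM : Conn del M) (k : ι) (d : ℕ) (m : Fin d → M) : ⨂[R]^d M :=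
  ∑ i, PiTensorProduct.tprod R (Function.update m i (nM.toFun k (m i)))

theorem Conn.piAux_add (nM : Conn del M) (k : ι) (d : ℕ) (m : Fin d → M) (i : Fin d) (x y : M) :
    nM.piAux k d (Function.update m i (x + y)) =
      nM.piAux k d (Function.update m i x) + nM.piAux k d (Function.update m i y) := by
  unfold Conn.piAux
  rw [← Finset.sum_add_distrib]
  refine Finset.sum_congr rfl fun j _ => ?_
  by_cases h : j = i
  · subst h; simp [MultilinearMap.map_update_add]
  · simp only [Function.update_of_ne h, Function.update_comm (Ne.symm h),
      MultilinearMap.map_update_add]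

theorem Conn.piAux_smul (nM : Conn del M) (k : ι) (d : ℕ) (m : Fin d → M) (i : Fin d) (r : R) :
    nM.piAux k d (Function.update m i (r • m i)) =
      del k r • PiTensorProduct.tprod R m + r • nM.piAux k d m := by
  classical
  unfold Conn.piAux
  rw [Finset.smul_sum, ← Finset.add_sum_erase _ _ (Finset.mem_univ i),
    ← Finset.add_sum_erase (a := i) (f := fun j => r • PiTensorProduct.tprod R
      (Function.update m j (nM.toFun k (m j)))) _ (Finset.mem_univ i), ← add_assoc]
  congr 1
  · simp [nM.leibniz, MultilinearMap.map_update_add, MultilinearMap.map_update_smul]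
  · refine Finset.sum_congr rfl fun j hj => ?_
    have h : j ≠ i := (Finset.mem_erase.1 hj).1
    rw [Function.update_of_ne h, Function.update_comm (Ne.symm h),
      MultilinearMap.map_update_smul]
    congr 2
    funext x
    by_cases hx : x = i
    · subst hx; simp [Function.update_of_ne (Ne.symm h)]
    · simp [Function.update_of_ne hx]

def Conn.piHom (nM : Conn del M) (d : ℕ) (k : ι) : (⨂[R]^d M) →+ ⨂[R]^d M :=
  PiTensorProduct.liftAddHom
    (fun p => del k p.1 • PiTensorProduct.tprod R p.2 + p.1 • nM.piAux k d p.2)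
    (fun r f i hf => by
      have h := nM.piAux_smul k d f i 0
      have h2 : Function.update f i ((0 : R) • f i) = f := by
        rw [zero_smul, ← hf, Function.update_eq_self]
      have h3 : PiTensorProduct.tprod R f = 0 := MultilinearMap.map_coord_zero _ i hf
      rw [h2, h3, zero_smul, smul_zero, zero_add] at h
      change del k r • PiTensorProduct.tprod R f + r • nM.piAux k d f = 0
      rw [h, h3, smul_zero, smul_zero, zero_add])
    (fun f => by simp)
    (fun {inst} r f i x y => by
      have e : inst = instDecidableEqFin d := Subsingleton.elim _ _
      subst e
      simp only [MultilinearMap.map_update_add, nM.piAux_add, smul_add]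
      abel)
    (fun r r' f => by simp only [map_add, add_smul]; abel)
    (fun {inst} r f i r' => by
      have e : inst = instDecidableEqFin d := Subsingleton.elim _ _
      subst e
      simp only [nM.piAux_smul, MultilinearMap.map_update_smul, Function.update_eq_self,
        Derivation.leibniz, smul_add, add_smul, smul_smul, smul_eq_mul]
      rw [mul_comm (del k r) r', mul_comm r r']
      abel)

theorem Conn.piHom_smul_tprod (nM : Conn del M) (d : ℕ) (k : ι) (r : R) (m : Fin d → M) :
    nM.piHom d k (r • PiTensorProduct.tprod R m) =
      del k r • PiTensorProduct.tprod R m + r • nM.piAux k d m := by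
  rw [← PiTensorProduct.tprodCoeff_eq_smul_tprod]
  exact FreeAddMonoid.lift_eval_of _ _

theorem Conn.piHom_tprod (nM : Conn del M) (d : ℕ) (k : ι) (m : Fin d → M) :
    nM.piHom d k (PiTensorProduct.tprod R m) = nM.piAux k d m := by
  have h := nM.piHom_smul_tprod d k 1 m
  rwa [one_smul, one_smul, Derivation.map_one_eq_zero, zero_smul, zero_add] at h

/-- The connection on the tensor power given by the product rule. -/
def Conn.pi (nM : Conn del M) (d : ℕ) : Conn del (⨂[R]^d M) where
  toFun := nM.piHom d
  leibniz k r t := by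
    induction t using PiTensorProduct.induction_on with
    | smul_tprod s f =>
      simp only [smul_smul, nM.piHom_smul_tprod, Derivation.leibniz, smul_add, add_smul,
        smul_eq_mul]
      rw [mul_comm (del k r) s]
      abel
    | add x y hx hy =>
      simp only [smul_add, map_add, hx, hy]
      abel

/-- The permutation of the tensor factors. -/
def permAct (R M : Type) [CommRing R] [AddCommGroup M] [Module R M] {d : ℕ}
    (s : Equiv.Perm (Fin d)) : (⨂[R]^d M) →ₗ[R] ⨂[R]^d M :=
  (PiTensorProduct.reindex R (fun _ => M) s).toLinearMap

/-- The action of an element `∑ a_s s` of the group algebra `ℂ[S_d]` on `M^{⊗ d}`. -/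
def symmetrizer (R M : Type) [CommRing R] [Algebra ℂ R] [AddCommGroup M] [Module R M] {d : ℕ}
    (a : Equiv.Perm (Fin d) → ℂ) : (⨂[R]^d M) →ₗ[R] ⨂[R]^d M :=
  ∑ s, algebraMap ℂ R (a s) • permAct R M s

/-- The submodule of `M^{⊗ d}` generated by the images of the elements `a ∈ J` of `ℂ[S_d]`. -/
def relations (R M : Type) [CommRing R] [Algebra ℂ R] [AddCommGroup M] [Module R M] {d : ℕ}
    (J : Set (Equiv.Perm (Fin d) → ℂ)) : Submodule R (⨂[R]^d M) :=
  ⨆ a ∈ J, LinearMap.range (symmetrizer R M a)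

/-- The functor `M ↦ M^ρ = M^{⊗ d} / ∑ a(M^{⊗ d})`, `a ∈ J ⊆ ℂ[S_d]`. For `R = ℂ` and `M = ℂⁿ` it
gives a quotient representation `ρ` of the `d`-th tensor power `ρ_st^{⊗ d}` of the standard
representation of `GL_n(ℂ)`; by Schur-Weyl duality every quotient representation of
`ρ_st^{⊗ d}` is obtained in this way, from some `J`. -/
abbrev Schur (R M : Type) [CommRing R] [Algebra ℂ R] [AddCommGroup M] [Module R M] {d : ℕ}
    (J : Set (Equiv.Perm (Fin d) → ℂ)) : Type :=
  (⨂[R]^d M) ⧸ relations R M J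

theorem permAct_tprod {d : ℕ} (s : Equiv.Perm (Fin d)) (m : Fin d → M) :
    permAct R M s (PiTensorProduct.tprod R m) =
      PiTensorProduct.tprod R (fun i => m (s.symm i)) :=
  PiTensorProduct.reindex_tprod s m

theorem map_permAct {d : ℕ} (f : M →ₗ[R] N) (s : Equiv.Perm (Fin d)) (t : ⨂[R]^d M) :
    PiTensorProduct.map (fun _ => f) (permAct R M s t) =
      permAct R N s (PiTensorProduct.map (fun _ => f) t) := by
  induction t using PiTensorProduct.induction_on with
  | smul_tprod r m =>
    simp only [map_smul, permAct_tprod, PiTensorProduct.map_tprod]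
  | add x y hx hy => simp only [map_add, hx, hy]

theorem map_symmetrizer {d : ℕ} (f : M →ₗ[R] N) (a : Equiv.Perm (Fin d) → ℂ) (t : ⨂[R]^d M) :
    PiTensorProduct.map (fun _ => f) (symmetrizer R M a t) =
      symmetrizer R N a (PiTensorProduct.map (fun _ => f) t) := by
  simp only [symmetrizer, LinearMap.sum_apply, LinearMap.smul_apply, map_sum, map_smul,
    map_permAct]

theorem map_relations {d : ℕ} (f : M →ₗ[R] N) (J : Set (Equiv.Perm (Fin d) → ℂ)) :
    relations R M J ≤ (relations R N J).comap (PiTensorProduct.map (fun _ => f)) := by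
  refine iSup₂_le fun a ha => ?_
  rintro _ ⟨t, rfl⟩
  rw [Submodule.mem_comap, map_symmetrizer]
  exact Submodule.mem_iSup_of_mem a (Submodule.mem_iSup_of_mem ha ⟨_, rfl⟩)

/-- The functoriality of `M ↦ M^ρ`. -/
def Schur.map {d : ℕ} (J : Set (Equiv.Perm (Fin d) → ℂ)) (f : M →ₗ[R] N) :
    Schur R M J →ₗ[R] Schur R N J :=
  Submodule.mapQ _ _ (PiTensorProduct.map (fun _ => f)) (map_relations f J)

theorem Conn.piHom_permAct (nM : Conn del M) {d : ℕ} (k : ι) (s : Equiv.Perm (Fin d))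
    (t : ⨂[R]^d M) : nM.piHom d k (permAct R M s t) = permAct R M s (nM.piHom d k t) := by
  induction t using PiTensorProduct.induction_on with
  | smul_tprod r m =>
    simp only [map_smul, permAct_tprod, nM.piHom_smul_tprod, map_add]
    congr 2
    unfold Conn.piAux
    rw [map_sum, ← Equiv.sum_comp s]
    refine Finset.sum_congr rfl fun i _ => ?_
    rw [permAct_tprod]
    congr 1
    funext j
    by_cases h : j = s i
    · subst h
      simp only [Function.update_self]
      rw [Equiv.symm_apply_apply, Function.update_self]
    · have h' : s.symm j ≠ i := fun e => h (by rw [← e, Equiv.apply_symm_apply])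
      simp [Function.update_of_ne h, Function.update_of_ne h']
  | add x y hx hy => simp only [map_add, hx, hy]

theorem Conn.leibniz_const (nM : Conn del M) (k : ι) (c : ℂ) (m : M) :
    nM.toFun k (algebraMap ℂ R c • m) = algebraMap ℂ R c • nM.toFun k m := by
  rw [nM.leibniz, Derivation.map_algebraMap, zero_smul, zero_add]

theorem Conn.piHom_relations (nM : Conn del M) {d : ℕ} (J : Set (Equiv.Perm (Fin d) → ℂ)) (k : ι) :
    (relations R M J).toAddSubgroup ≤ (relations R M J).toAddSubgroup.comap (nM.piHom d k) := by
  intro x hx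
  rw [Submodule.mem_toAddSubgroup] at hx
  rw [AddSubgroup.mem_comap, Submodule.mem_toAddSubgroup]
  rw [relations, iSup_subtype'] at hx
  induction hx using Submodule.iSup_induction' with
  | zero => rw [map_zero]; exact zero_mem _
  | add x y _ _ hx hy => rw [map_add]; exact add_mem hx hy
  | mem a x hx =>
    obtain ⟨t, rfl⟩ := hx
    have h : nM.piHom d k (symmetrizer R M a.1 t) = symmetrizer R M a.1 (nM.piHom d k t) := by
      simp only [symmetrizer, LinearMap.sum_apply, LinearMap.smul_apply, map_sum]
      refine Finset.sum_congr rfl fun s _ => ?_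
      rw [← nM.piHom_permAct]
      exact (nM.pi d).leibniz_const k _ _
    rw [h]
    exact Submodule.mem_iSup_of_mem a.1 (Submodule.mem_iSup_of_mem a.2 ⟨_, rfl⟩)

/-- The connection on `M^ρ` induced by the product rule. -/
def Conn.schur (nM : Conn del M) {d : ℕ} (J : Set (Equiv.Perm (Fin d) → ℂ)) :
    Conn del (Schur R M J) where
  toFun k := QuotientAddGroup.map (relations R M J).toAddSubgroup (relations R M J).toAddSubgroup
    (nM.piHom d k) (nM.piHom_relations J k)
  leibniz k r m := by
    obtain ⟨t, rfl⟩ := Submodule.Quotient.mk_surjective _ m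
    exact congrArg (Submodule.Quotient.mk (p := relations R M J)) ((nM.pi d).leibniz k r t)

/-- The restriction of a connection to a horizontal submodule. -/
def Conn.restrict (nM : Conn del M) (P : Submodule R M)
    (h : ∀ k, ∀ m ∈ P, nM.toFun k m ∈ P) : Conn del P where
  toFun k := AddMonoidHom.mk' (fun m => ⟨nM.toFun k m, h k m m.2⟩)
    (fun a b => by ext; simp)
  leibniz k r m := by
    ext
    exact nM.leibniz k r m

/-- `(b_1 ⊗ ⋯ ⊗ b_d) ⊗ b ↦ b_1 ⊗ ⋯ ⊗ b_d ⊗ b` -/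
def snoc (R B : Type) [CommRing R] [AddCommGroup B] [Module R B] (d : ℕ) :
    (⨂[R]^d B) ⊗[R] B →ₗ[R] ⨂[R]^(d + 1) B :=
  (TensorPower.mulEquiv (n := d) (m := 1)).toLinearMap ∘ₗ
    TensorProduct.map LinearMap.id
      (PiTensorProduct.subsingletonEquiv (R := R) (s := fun _ : Fin 1 => B) 0).symm.toLinearMap

/-- `(a ⊗ b_1 ⊗ ⋯ ⊗ b_d, b) ↦ a ⊗ b_1 ⊗ ⋯ ⊗ b_d ⊗ b` -/
def appendR {R A B : Type} [CommRing R] [AddCommGroup A] [Module R A] [AddCommGroup B] [Module R B]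
    {d : ℕ} (x : A ⊗[R] ⨂[R]^d B) (b : B) : A ⊗[R] ⨂[R]^(d + 1) B :=
  TensorProduct.map LinearMap.id (snoc R B d)
    (TensorProduct.assoc R A (⨂[R]^d B) B (x ⊗ₜ[R] b))

end Connections

/-- The space of complex `n × n` matrices, as a function space. -/
abbrev T (n : ℕ) : Type := Fin n → Fin n → ℂ

/-- `i (z* - z)` -/
def imForm {n : ℕ} (z : T n) : Matrix (Fin n) (Fin n) ℂ :=
  Complex.I • ((Matrix.of z)ᴴ - Matrix.of z)

/-- `𝓗_n = {z | i (z* - z) > 0}` -/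
def halfSpace (n : ℕ) : Set (T n) :=
  {z | (imForm z).PosDef}

/-- `𝓗_n` as a type. -/
abbrev Hn (n : ℕ) : Type := ↥(halfSpace n)

theorem imForm_isHermitian {n : ℕ} (z : T n) : (imForm z).IsHermitian := by
  rw [Matrix.IsHermitian, imForm, Matrix.conjTranspose_smul, Matrix.conjTranspose_sub,
    Matrix.conjTranspose_conjTranspose, Complex.star_def, Complex.conj_I, neg_smul, ← smul_neg,
    neg_sub]

theorem isOpen_halfSpace (n : ℕ) : IsOpen (halfSpace n) := by
  rw [isOpen_iff_eventually]
  intro z₀ hz₀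
  let q : T n × (Fin n → ℂ) → ℝ := fun p => (star p.2 ⬝ᵥ (imForm p.1 *ᵥ p.2)).re
  have hof : Continuous fun p : T n × (Fin n → ℂ) => Matrix.of p.1 :=
    continuous_fst
  have him : Continuous fun p : T n × (Fin n → ℂ) => imForm p.1 :=
    (hof.matrix_conjTranspose.sub hof).const_smul Complex.I
  have hq : Continuous q := by
    refine Complex.continuous_re.comp (Continuous.dotProduct (by fun_prop) ?_)
    exact Continuous.matrix_mulVec him continuous_snd
  have key : ∀ᶠ z in nhds z₀, ∀ x ∈ Metric.sphere (0 : Fin n → ℂ) 1, 0 < q (z, x) := by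
    refine (isCompact_sphere _ _).eventually_forall_of_forall_eventually fun x hx => ?_
    have h0 : 0 < q (z₀, x) := by
      have hx0 : x ≠ 0 := by
        rintro rfl; simp at hx
      exact (Complex.pos_iff.1 (Matrix.PosDef.dotProduct_mulVec_pos hz₀ hx0)).1
    exact (isOpen_lt continuous_const hq).mem_nhds h0
  filter_upwards [key] with z hz
  refine Matrix.PosDef.of_dotProduct_mulVec_pos (imForm_isHermitian z) fun x hx => ?_
  have him := (imForm_isHermitian z).im_star_dotProduct_mulVec_self x
  have hn : ‖x‖ ≠ 0 := norm_ne_zero_iff.2 hx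
  have h1 := hz ((‖x‖⁻¹ : ℂ) • x) (by simp [norm_smul, hn])
  have h2 : q (z, (‖x‖⁻¹ : ℂ) • x) = ‖x‖⁻¹ ^ 2 * q (z, x) := by
    simp only [q, Matrix.mulVec_smul, star_smul, smul_dotProduct, dotProduct_smul, smul_eq_mul]
    rw [← mul_assoc]
    have : (‖x‖ : ℂ)⁻¹ * star ((‖x‖ : ℂ)⁻¹) = ((‖x‖⁻¹ ^ 2 : ℝ) : ℂ) := by
      simp [sq]
    rw [this, Complex.re_ofReal_mul]
  rw [h2] at h1
  have h3 : 0 < q (z, x) := (mul_pos_iff_of_pos_left (by positivity)).1 h1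
  rw [Complex.pos_iff]
  refine ⟨h3, ?_⟩
  simpa using him.symm

open Classical in
/-- Extension by zero of a function on `𝓗_n`. -/
def ext {n : ℕ} {W : Type} [Zero W] (f : Hn n → W) : T n → W :=
  fun z => if h : z ∈ halfSpace n then f ⟨z, h⟩ else 0

theorem ext_apply {n : ℕ} {W : Type} [Zero W] (f : Hn n → W) (z : Hn n) : ext f z = f z := by
  simp [ext]

/-- `C^∞` functions on the open subset `𝓗_n` of the real vector space `T`. -/
def IsSmooth {n : ℕ} {W : Type} [NormedAddCommGroup W] [NormedSpace ℝ W] (f : Hn n → W) : Prop :=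
  ContDiffOn ℝ ∞ (ext f) (halfSpace n)

/-- The algebra of `C^∞` functions on `𝓗_n`. -/
def smoothAlg (n : ℕ) : Subalgebra ℂ (Hn n → ℂ) where
  carrier := {f | IsSmooth f}
  mul_mem' {f g} hf hg := by
    refine (ContDiffOn.mul hf hg).congr fun z hz => ?_
    simp [ext, hz]
  add_mem' {f g} hf hg := by
    refine (ContDiffOn.add hf hg).congr fun z hz => ?_
    simp [ext, hz]
  algebraMap_mem' c := by
    refine (contDiffOn_const (c := c)).congr fun z hz => ?_
    simp [ext, hz]

/-- The ring `C^∞(𝓗_n)` of smooth complex-valued functions. -/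
def Cinf (n : ℕ) : Type := ↥(smoothAlg n)

instance (n : ℕ) : CommRing (Cinf n) := inferInstanceAs (CommRing ↥(smoothAlg n))

instance (n : ℕ) : Algebra ℂ (Cinf n) := inferInstanceAs (Algebra ℂ ↥(smoothAlg n))

/-- directional derivative along a real tangent vector -/
def realDel {n : ℕ} {W : Type} [NormedAddCommGroup W] [NormedSpace ℝ W]
    (v : T n) (f : Hn n → W) : Hn n → W :=
  fun z => fderiv ℝ (ext f) z v

/-- `c` times the matrix unit `E_ij`, for `k = (i, j)` -/
def unitDir {n : ℕ} (k : Fin n × Fin n) (c : ℂ) : T n := Pi.single k.1 (Pi.single k.2 c)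

/-- `∂f/∂z_ij` for `k = (i, j)` -/
def wirt {n : ℕ} {W : Type} [NormedAddCommGroup W] [NormedSpace ℂ W]
    (k : Fin n × Fin n) (f : Hn n → W) : Hn n → W :=
  (2⁻¹ : ℂ) • (realDel (unitDir k 1) f
    - Complex.I • realDel (unitDir k Complex.I) f)

theorem IsSmooth.contDiffAt {n : ℕ} {W : Type} [NormedAddCommGroup W] [NormedSpace ℝ W]
    {f : Hn n → W} (hf : IsSmooth f) (z : Hn n) : ContDiffAt ℝ ∞ (ext f) z :=
  ContDiffOn.contDiffAt hf ((isOpen_halfSpace n).mem_nhds z.2)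

theorem IsSmooth.differentiableAt {n : ℕ} {W : Type} [NormedAddCommGroup W] [NormedSpace ℝ W]
    {f : Hn n → W} (hf : IsSmooth f) (z : Hn n) : DifferentiableAt ℝ (ext f) z :=
  (hf.contDiffAt z).differentiableAt (by simp)

theorem ext_eventuallyEq {n : ℕ} {W : Type} [Zero W] (f : Hn n → W)
    (F : T n → W) (h : ∀ z : Hn n, f z = F z) (z : Hn n) :
    ext f =ᶠ[nhds (z : T n)] F := by
  filter_upwards [(isOpen_halfSpace n).mem_nhds z.2] with w hw
  simpa [ext, hw] using h ⟨w, hw⟩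

theorem IsSmooth.realDel {n : ℕ} {W : Type} [NormedAddCommGroup W] [NormedSpace ℝ W]
    {f : Hn n → W} (hf : IsSmooth f) (v : T n) :
    IsSmooth (realDel v f) := by
  have h : ContDiffOn ℝ ∞ (fun z => fderiv ℝ (ext f) z v) (halfSpace n) :=
    (ContDiffOn.fderiv_of_isOpen hf (isOpen_halfSpace n) (m := ∞) (by simp)).clm_apply
      contDiffOn_const
  refine h.congr fun z hz => ?_
  simp [ext, hz, UnitaryDiffOp.realDel]

theorem realDel_add {n : ℕ} {W : Type} [NormedAddCommGroup W] [NormedSpace ℝ W]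
    {f g : Hn n → W} (hf : IsSmooth f) (hg : IsSmooth g) (v : T n) :
    realDel v (f + g) = realDel v f + realDel v g := by
  funext z
  have h := ext_eventuallyEq (f + g) (fun w => ext f w + ext g w) (fun w => by simp [ext_apply]) z
  simp only [realDel, Pi.add_apply]
  rw [h.fderiv_eq, fderiv_fun_add (hf.differentiableAt z) (hg.differentiableAt z)]
  rfl

theorem realDel_smul {n : ℕ} {W : Type} [NormedAddCommGroup W] [NormedSpace ℂ W]
    {f : Hn n → ℂ} {g : Hn n → W} (hf : IsSmooth f) (hg : IsSmooth g)
    (v : T n) (z : Hn n) :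
    realDel v (fun z => f z • g z) z = realDel v f z • g z + f z • realDel v g z := by
  have h := ext_eventuallyEq (fun z => f z • g z) (fun w => ext f w • ext g w)
    (fun w => by simp [ext_apply]) z
  simp only [realDel]
  rw [h.fderiv_eq, fderiv_fun_smul (hf.differentiableAt z) (hg.differentiableAt z)]
  simp [ext_apply, add_comm]

theorem IsSmooth.smul {n : ℕ} {W : Type} [NormedAddCommGroup W] [NormedSpace ℂ W]
    {f : Hn n → ℂ} {g : Hn n → W} (hf : IsSmooth f) (hg : IsSmooth g) :
    IsSmooth (fun z => f z • g z) := by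
  refine (ContDiffOn.smul hf hg).congr fun z hz => ?_
  simp [ext, hz]

theorem IsSmooth.add {n : ℕ} {W : Type} [NormedAddCommGroup W] [NormedSpace ℝ W]
    {f g : Hn n → W} (hf : IsSmooth f) (hg : IsSmooth g) : IsSmooth (f + g) := by
  refine (ContDiffOn.add hf hg).congr fun z hz => ?_
  simp [ext, hz]

theorem isSmooth_const {n : ℕ} {W : Type} [NormedAddCommGroup W] [NormedSpace ℝ W] (c : W) :
    IsSmooth (fun _ : Hn n => c) := by
  refine (contDiffOn_const (c := c)).congr fun z hz => ?_
  simp [ext, hz]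

theorem realDel_const {n : ℕ} {W : Type} [NormedAddCommGroup W] [NormedSpace ℝ W]
    (v : T n) (c : W) : realDel v (fun _ : Hn n => c) = 0 := by
  funext z
  have h := ext_eventuallyEq (fun _ : Hn n => c) (fun _ => c) (fun _ => rfl) z
  simp [realDel, h.fderiv_eq]

theorem IsSmooth.wirt {n : ℕ} {W : Type} [NormedAddCommGroup W] [NormedSpace ℂ W]
    {f : Hn n → W} (hf : IsSmooth f) (k : Fin n × Fin n) : IsSmooth (wirt k f) := by
  have h1 := (isSmooth_const (n := n) (-Complex.I)).smul
    (hf.realDel (unitDir k Complex.I))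
  have h2 := (isSmooth_const (n := n) (2⁻¹ : ℂ)).smul
    ((hf.realDel (unitDir k 1)).add h1)
  convert h2 using 1
  funext z
  simp [UnitaryDiffOp.wirt, sub_eq_add_neg]

theorem wirt_add {n : ℕ} {W : Type} [NormedAddCommGroup W] [NormedSpace ℂ W]
    {f g : Hn n → W} (hf : IsSmooth f) (hg : IsSmooth g) (k : Fin n × Fin n) :
    wirt k (f + g) = wirt k f + wirt k g := by
  simp only [wirt, realDel_add hf hg, smul_add]
  rw [add_sub_add_comm, smul_add]

theorem wirt_smul {n : ℕ} {W : Type} [NormedAddCommGroup W] [NormedSpace ℂ W]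
    {f : Hn n → ℂ} {g : Hn n → W} (hf : IsSmooth f) (hg : IsSmooth g)
    (k : Fin n × Fin n) (z : Hn n) :
    wirt k (fun z => f z • g z) z = wirt k f z • g z + f z • wirt k g z := by
  simp only [wirt, Pi.smul_apply, Pi.sub_apply, realDel_smul hf hg]
  module

theorem wirt_const {n : ℕ} {W : Type} [NormedAddCommGroup W] [NormedSpace ℂ W]
    (k : Fin n × Fin n) (c : W) : wirt k (fun _ : Hn n => c) = 0 := by
  simp [wirt, realDel_const]

/-- The derivation `∂/∂z_ij` of the ring of smooth functions. -/
def del (n : ℕ) (k : Fin n × Fin n) : Derivation ℂ (Cinf n) (Cinf n) :=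
  Derivation.mk'
    { toFun := fun f => ⟨wirt k f.1, IsSmooth.wirt f.2 k⟩
      map_add' := fun f g => Subtype.ext (wirt_add f.2 g.2 k)
      map_smul' := fun c f => by
        refine Subtype.ext (funext fun z => ?_)
        have h := wirt_smul (isSmooth_const c) f.2 k z
        rw [wirt_const, Pi.zero_apply, zero_smul, zero_add] at h
        exact h }
    (fun f g => by
      refine Subtype.ext (funext fun z => ?_)
      have h := wirt_smul f.2 g.2 k z
      rw [add_comm, smul_eq_mul, smul_eq_mul, mul_comm (wirt k f.1 z)] at h
      exact h)

section Relative

/-- `ℂⁿ × ℂⁿ`, the real vector space `L ⊗ ℝ` in which the lattice lives. -/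
abbrev E (n : ℕ) : Type := (Fin n → ℂ) × (Fin n → ℂ)

/-- A function on the total space `𝓗_n × E`, smooth in both variables. -/
def RelSmooth {n : ℕ} {W : Type} [NormedAddCommGroup W] [NormedSpace ℝ W]
    (F : Hn n → E n → W) : Prop :=
  ContDiffOn ℝ ∞ (fun p : T n × E n => ext F p.1 p.2) (halfSpace n ×ˢ Set.univ)

/-- Derivative in the direction `v` of the base, for fixed `x`. -/
def horR {n : ℕ} {W : Type} [NormedAddCommGroup W] [NormedSpace ℝ W] (v : T n)
    (F : Hn n → E n → W) : Hn n → E n → W :=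
  fun z x => realDel v (fun z' => F z' x) z

/-- The relative (fibrewise) differential. -/
def vert {n : ℕ} {W : Type} [NormedAddCommGroup W] [NormedSpace ℝ W]
    (F : Hn n → E n → W) : Hn n → E n → (E n →L[ℝ] W) :=
  fun z x => fderiv ℝ (F z) x

variable {n : ℕ} {W : Type} [NormedAddCommGroup W] [NormedSpace ℝ W]

theorem isOpen_total : IsOpen (halfSpace n ×ˢ (Set.univ : Set (E n))) :=
  (isOpen_halfSpace n).prod isOpen_univ

theorem ext_eval {W : Type} [Zero W] (F : Hn n → E n → W) (x : E n) :
    ext (fun z' => F z' x) = fun w => ext F w x := by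
  funext w
  by_cases h : w ∈ halfSpace n <;> simp [ext, h]

theorem total_mem_nhds (z : Hn n) (x : E n) :
    halfSpace n ×ˢ (Set.univ : Set (E n)) ∈ nhds ((z : T n), x) :=
  isOpen_total.mem_nhds ⟨z.2, trivial⟩

theorem RelSmooth.contDiffAt {F : Hn n → E n → W} (hF : RelSmooth F) (z : Hn n) (x : E n) :
    ContDiffAt ℝ ∞ (fun p : T n × E n => ext F p.1 p.2) ((z : T n), x) :=
  ContDiffOn.contDiffAt hF (total_mem_nhds z x)

theorem RelSmooth.base {F : Hn n → E n → W} (hF : RelSmooth F) (x : E n) :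
    IsSmooth (fun z => F z x) := by
  unfold IsSmooth
  rw [ext_eval]
  exact ContDiffOn.comp (g := fun p : T n × E n => ext F p.1 p.2) (f := fun w : T n => (w, x))
    hF (contDiff_id.prodMk contDiff_const).contDiffOn fun w hw => ⟨hw, trivial⟩

theorem RelSmooth.fibre {F : Hn n → E n → W} (hF : RelSmooth F) (z : Hn n) :
    ContDiff ℝ ∞ (F z) := by
  rw [contDiff_iff_contDiffAt]
  intro x
  have h : ContDiffAt ℝ ∞ (fun x => ext F z x) x :=
    (hF.contDiffAt z x).comp x (contDiff_const.prodMk contDiff_id).contDiffAt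
  simpa [ext_apply] using h

theorem horR_eq {F : Hn n → E n → W} (hF : RelSmooth F) (v : T n) (z : Hn n) (x : E n) :
    horR v F z x = fderiv ℝ (fun p : T n × E n => ext F p.1 p.2) ((z : T n), x) (v, 0) := by
  have h := ((hF.contDiffAt z x).differentiableAt (by simp)).hasFDerivAt
  have h2 : HasFDerivAt (fun w : T n => (w, x)) (ContinuousLinearMap.inl ℝ (T n) (E n)) (z : T n) :=
    hasFDerivAt_prodMk_left _ _
  have h3 := h.comp (z : T n) h2
  unfold horR realDel
  rw [ext_eval]
  exact congrArg (fun A : T n →L[ℝ] W => A v) h3.fderiv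

theorem vert_eq {F : Hn n → E n → W} (hF : RelSmooth F) (z : Hn n) (x : E n) :
    vert F z x = (fderiv ℝ (fun p : T n × E n => ext F p.1 p.2) ((z : T n), x)).comp
      (ContinuousLinearMap.inr ℝ (T n) (E n)) := by
  have h := ((hF.contDiffAt z x).differentiableAt (by simp)).hasFDerivAt
  have h2 : HasFDerivAt (fun y : E n => ((z : T n), y)) (ContinuousLinearMap.inr ℝ (T n) (E n)) x :=
    hasFDerivAt_prodMk_right _ _
  have h3 := (h.comp x h2).fderiv
  have h4 : F z = (fun p : T n × E n => ext F p.1 p.2) ∘ fun y : E n => ((z : T n), y) := by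
    funext y; simp [ext_apply]
  unfold vert
  rw [h4, h3]

theorem RelSmooth.fderiv_total {F : Hn n → E n → W} (hF : RelSmooth F) :
    ContDiffOn ℝ ∞ (fderiv ℝ (fun p : T n × E n => ext F p.1 p.2)) (halfSpace n ×ˢ Set.univ) :=
  ContDiffOn.fderiv_of_isOpen hF isOpen_total (m := ∞) (by simp)

theorem RelSmooth.horR {F : Hn n → E n → W} (hF : RelSmooth F) (v : T n) :
    RelSmooth (horR v F) := by
  refine (hF.fderiv_total.clm_apply contDiffOn_const (g := fun _ => (v, 0))).congr ?_
  rintro ⟨z, x⟩ ⟨hz, _⟩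
  rw [← horR_eq hF v ⟨z, hz⟩ x]
  simp [ext, show z ∈ halfSpace n from hz]

theorem RelSmooth.vert {F : Hn n → E n → W} (hF : RelSmooth F) : RelSmooth (vert F) := by
  refine (hF.fderiv_total.clm_comp contDiffOn_const
    (f := fun _ => ContinuousLinearMap.inr ℝ (T n) (E n))).congr ?_
  rintro ⟨z, x⟩ ⟨hz, _⟩
  rw [← vert_eq hF ⟨z, hz⟩ x]
  simp [ext, show z ∈ halfSpace n from hz]

theorem vert_horR {F : Hn n → E n → W} (hF : RelSmooth F) (v : T n) :
    vert (horR v F) = horR v (vert F) := by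
  funext z x
  have hd : DifferentiableAt ℝ (fderiv ℝ (fun p : T n × E n => ext F p.1 p.2)) ((z : T n), x) :=
    (hF.fderiv_total.contDiffAt (total_mem_nhds z x)).differentiableAt (by simp)
  have h1 : (fun p : T n × E n => ext (horR v F) p.1 p.2) =ᶠ[nhds ((z : T n), x)]
      fun p => fderiv ℝ (fun p : T n × E n => ext F p.1 p.2) p (v, 0) := by
    filter_upwards [total_mem_nhds z x]
    rintro ⟨w, y⟩ ⟨hw, _⟩
    rw [← horR_eq hF v ⟨w, hw⟩ y]
    simp [ext, show w ∈ halfSpace n from hw]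
  have h2 : (fun p : T n × E n => ext (vert F) p.1 p.2) =ᶠ[nhds ((z : T n), x)]
      fun p => (fderiv ℝ (fun p : T n × E n => ext F p.1 p.2) p).comp
        (ContinuousLinearMap.inr ℝ (T n) (E n)) := by
    filter_upwards [total_mem_nhds z x]
    rintro ⟨w, y⟩ ⟨hw, _⟩
    rw [← vert_eq hF ⟨w, hw⟩ y]
    simp [ext, show w ∈ halfSpace n from hw]
  have hs : IsSymmSndFDerivAt ℝ (fun p : T n × E n => ext F p.1 p.2) ((z : T n), x) :=
    (hF.contDiffAt z x).isSymmSndFDerivAt (by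
      rw [minSmoothness_of_isRCLikeNormedField]; exact WithTop.coe_le_coe.2 le_top)
  refine ContinuousLinearMap.ext fun w => ?_
  rw [vert_eq (hF.horR v), horR_eq hF.vert, h1.fderiv_eq, h2.fderiv_eq]
  have e1 : fderiv ℝ (fun p => fderiv ℝ (fun p : T n × E n => ext F p.1 p.2) p (v, 0))
      ((z : T n), x) = (fderiv ℝ (fderiv ℝ (fun p : T n × E n => ext F p.1 p.2))
        ((z : T n), x)).flip (v, 0) := by
    have := (hd.hasFDerivAt.clm_apply (hasFDerivAt_const ((v, 0) : T n × E n) _)).fderiv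
    rw [this]; simp
  have e2 : fderiv ℝ (fun p => (fderiv ℝ (fun p : T n × E n => ext F p.1 p.2) p).comp
      (ContinuousLinearMap.inr ℝ (T n) (E n))) ((z : T n), x) (v, 0) =
      (fderiv ℝ (fderiv ℝ (fun p : T n × E n => ext F p.1 p.2)) ((z : T n), x) (v, 0)).comp
        (ContinuousLinearMap.inr ℝ (T n) (E n)) := by
    have := (hd.hasFDerivAt.clm_comp
      (hasFDerivAt_const (ContinuousLinearMap.inr ℝ (T n) (E n)) _)).fderiv
    rw [this]; exact ContinuousLinearMap.ext fun w => by simp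
  rw [e1, e2]
  exact hs (0, w) (v, 0)

end Relative

section Cohomology

variable {n : ℕ}

theorem realDel_comp {W W' : Type} [NormedAddCommGroup W] [NormedSpace ℝ W]
    [NormedAddCommGroup W'] [NormedSpace ℝ W'] {f : Hn n → W} (hf : IsSmooth f) (v : T n)
    (A : W →L[ℝ] W') (z : Hn n) : realDel v (fun z => A (f z)) z = A (realDel v f z) := by
  have h := ext_eventuallyEq (fun z => A (f z)) (fun w => A (ext f w))
    (fun w => by simp [ext_apply]) z
  have h2 := (A.hasFDerivAt.comp (z : T n) (hf.differentiableAt z).hasFDerivAt).fderiv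
  unfold realDel
  rw [h.fderiv_eq]
  exact congrArg (fun B : T n →L[ℝ] W' => B v) h2

theorem RelSmooth.add {W : Type} [NormedAddCommGroup W] [NormedSpace ℝ W]
    {F G : Hn n → E n → W} (hF : RelSmooth F) (hG : RelSmooth G) : RelSmooth (F + G) := by
  refine (ContDiffOn.add hF hG).congr ?_
  rintro ⟨z, x⟩ ⟨hz, _⟩
  simp [ext, show z ∈ halfSpace n from hz]

theorem relSmooth_zero {W : Type} [NormedAddCommGroup W] [NormedSpace ℝ W] :
    RelSmooth (0 : Hn n → E n → W) := by
  refine (contDiffOn_const (c := (0 : W))).congr ?_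
  rintro ⟨z, x⟩ ⟨hz, _⟩
  simp [ext]

theorem RelSmooth.smul {W : Type} [NormedAddCommGroup W] [NormedSpace ℂ W]
    {F : Hn n → E n → W} (hF : RelSmooth F) (f : Cinf n) : RelSmooth (fun z x => f.1 z • F z x) := by
  have h : ContDiffOn ℝ ∞ (fun p : T n × E n => ext f.1 p.1) (halfSpace n ×ˢ Set.univ) :=
    ContDiffOn.comp (g := ext f.1) (f := Prod.fst) f.2 contDiff_fst.contDiffOn fun p hp => hp.1
  refine (ContDiffOn.smul h hF).congr ?_
  rintro ⟨z, x⟩ ⟨hz, _⟩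
  simp [ext, show z ∈ halfSpace n from hz]

theorem vert_add {W : Type} [NormedAddCommGroup W] [NormedSpace ℝ W]
    {F G : Hn n → E n → W} (hF : RelSmooth F) (hG : RelSmooth G) :
    vert (F + G) = vert F + vert G := by
  funext z x
  exact fderiv_add ((hF.fibre z).differentiable (by simp) x)
    ((hG.fibre z).differentiable (by simp) x)

theorem vert_smul {W : Type} [NormedAddCommGroup W] [NormedSpace ℂ W]
    {F : Hn n → E n → W} (hF : RelSmooth F) (f : Cinf n) (z : Hn n) (x : E n) :
    vert (fun z x => f.1 z • F z x) z x = f.1 z • vert F z x :=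
  fderiv_const_smul ((hF.fibre z).differentiable (by simp) x) (f.1 z)

theorem horR_add {W : Type} [NormedAddCommGroup W] [NormedSpace ℝ W]
    {F G : Hn n → E n → W} (hF : RelSmooth F) (hG : RelSmooth G) (v : T n) :
    horR v (F + G) = horR v F + horR v G := by
  funext z x
  exact congrFun (realDel_add (hF.base x) (hG.base x) v) z

/-- A real directional derivative on smooth functions. -/
def rdel (v : T n) (f : Cinf n) : Cinf n := ⟨realDel v f.1, IsSmooth.realDel f.2 v⟩

theorem horR_smul {W : Type} [NormedAddCommGroup W] [NormedSpace ℂ W]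
    {F : Hn n → E n → W} (hF : RelSmooth F) (v : T n) (f : Cinf n) :
    horR v (fun z x => f.1 z • F z x) =
      fun z x => (rdel v f).1 z • F z x + f.1 z • horR v F z x := by
  funext z x
  exact realDel_smul f.2 (hF.base x) v z

/-- Smooth families of differential one-forms on the fibres `E`. -/
def Form (n : ℕ) : Type := Hn n → E n → (E n →L[ℝ] ℂ)

instance : AddCommGroup (Form n) := inferInstanceAs (AddCommGroup (Hn n → E n → (E n →L[ℝ] ℂ)))

instance : Module ℂ (Form n) := inferInstanceAs (Module ℂ (Hn n → E n → (E n →L[ℝ] ℂ)))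

instance : Module (Cinf n) (Form n) where
  smul f η := fun z x => f.1 z • η z x
  one_smul η := by funext z x; exact one_smul ℂ (η z x)
  mul_smul f g η := by funext z x; exact mul_smul (f.1 z) (g.1 z) (η z x)
  smul_zero f := by funext z x; exact smul_zero (A := E n →L[ℝ] ℂ) (f.1 z)
  smul_add f η θ := by funext z x; exact smul_add (f.1 z) (η z x) (θ z x)
  add_smul f g η := by funext z x; exact add_smul (f.1 z) (g.1 z) (η z x)
  zero_smul η := by funext z x; exact zero_smul ℂ (η z x)

instance : IsScalarTower ℂ (Cinf n) (Form n) :=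
  ⟨fun c f η => by funext z x; exact mul_smul c (f.1 z) (η z x)⟩

/-- `L`-periodicity: functions (or forms) that descend to the fibres `E / L`. -/
def Periodic {W : Type} (L : AddSubgroup (E n)) (F : Hn n → E n → W) : Prop :=
  ∀ l ∈ L, ∀ z x, F z (x + l) = F z x

/-- Relative closed smooth one-forms on the family `𝓗_n × (E / L)` over `𝓗_n`. -/
def closedForms (L : AddSubgroup (E n)) : Submodule (Cinf n) (Form n) where
  carrier := {η | RelSmooth η ∧ Periodic L η ∧
    ∀ z x v w, fderiv ℝ (η z) x v w = fderiv ℝ (η z) x w v}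
  zero_mem' := ⟨relSmooth_zero, fun _ _ _ _ => rfl, fun z x v w => by
    have h : fderiv ℝ ((0 : Form n) z) x = 0 := fderiv_const_apply _
    rw [h]; rfl⟩
  add_mem' := fun {a b} ha hb => ⟨ha.1.add hb.1, fun l hl z x =>
      congrArg₂ (· + ·) (ha.2.1 l hl z x) (hb.2.1 l hl z x), fun z x v w => by
      have h : fderiv ℝ ((a + b) z) x = fderiv ℝ (a z) x + fderiv ℝ (b z) x :=
        congrFun (congrFun (vert_add ha.1 hb.1) z) x
      rw [h]
      exact congrArg₂ (· + ·) (ha.2.2 z x v w) (hb.2.2 z x v w)⟩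
  smul_mem' := fun f a ha => ⟨ha.1.smul f, fun l hl z x =>
      congrArg (fun t => f.1 z • t) (ha.2.1 l hl z x), fun z x v w => by
      have h : fderiv ℝ ((f • a) z) x = f.1 z • fderiv ℝ (a z) x := vert_smul ha.1 f z x
      rw [h]
      exact congrArg (fun t => f.1 z • t) (ha.2.2 z x v w)⟩

/-- Relative exact smooth one-forms: the fibrewise differentials of smooth functions. -/
def exactForms (L : AddSubgroup (E n)) : Submodule (Cinf n) (Form n) where
  carrier := {η | ∃ g : Hn n → E n → ℂ, RelSmooth g ∧ Periodic L g ∧ η = vert g}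
  zero_mem' := ⟨0, relSmooth_zero, fun _ _ _ _ => rfl, by
    funext z x; exact (fderiv_const_apply (0 : ℂ)).symm⟩
  add_mem' := by
    rintro _ _ ⟨g, hg, hp, rfl⟩ ⟨h, hh, hq, rfl⟩
    exact ⟨g + h, hg.add hh, fun l hl z x => by simp [hp l hl z x, hq l hl z x],
      (vert_add hg hh).symm⟩
  smul_mem' := by
    rintro f _ ⟨g, hg, hp, rfl⟩
    exact ⟨fun z x => f.1 z • g z x, hg.smul f, fun l hl z x => congrArg (fun t => f.1 z • t) (hp l hl z x), by
      funext z x; exact (vert_smul hg f z x).symm⟩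

/-- Relative de Rham cohomology `H¹_DR(C^∞)` of the family `A_z = ℂ²ⁿ / p_z(L)`, in the flat
coordinates `x ∈ E`. -/
def H (L : AddSubgroup (E n)) : Type :=
  ↥(closedForms L) ⧸ (exactForms L).submoduleOf (closedForms L)

instance (L : AddSubgroup (E n)) : AddCommGroup (H L) :=
  inferInstanceAs (AddCommGroup (↥(closedForms L) ⧸ (exactForms L).submoduleOf (closedForms L)))

instance (L : AddSubgroup (E n)) : Module (Cinf n) (H L) :=
  inferInstanceAs (Module (Cinf n) (↥(closedForms L) ⧸ (exactForms L).submoduleOf (closedForms L)))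

instance (L : AddSubgroup (E n)) : Module ℂ (H L) :=
  inferInstanceAs (Module ℂ (↥(closedForms L) ⧸ (exactForms L).submoduleOf (closedForms L)))

instance (L : AddSubgroup (E n)) : IsScalarTower ℂ (Cinf n) (H L) :=
  inferInstanceAs (IsScalarTower ℂ (Cinf n)
    (↥(closedForms L) ⧸ (exactForms L).submoduleOf (closedForms L)))

/-- The cohomology class of a closed form. -/
def cls (L : AddSubgroup (E n)) : ↥(closedForms L) →ₗ[Cinf n] H L :=
  ((exactForms L).submoduleOf (closedForms L)).mkQ

theorem cls_surjective (L : AddSubgroup (E n)) : Function.Surjective (cls L) :=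
  Submodule.mkQ_surjective _

theorem horR_mem_closed {L : AddSubgroup (E n)} {η : Form n} (h : η ∈ closedForms L) (v : T n) :
    horR v η ∈ closedForms L := by
  obtain ⟨h1, h2, h3⟩ := h
  refine ⟨h1.horR v, fun l hl z x => ?_, fun z x a b => ?_⟩
  · have : (fun z' => η z' (x + l)) = fun z' => η z' x := funext fun z' => h2 l hl z' x
    simp only [horR, this]
  · have key : ∀ a b : E n, fderiv ℝ (horR v η z) x a b =
        realDel v (fun z' => fderiv ℝ (η z') x a b) z := by
      intro a b
      have e : fderiv ℝ (horR v η z) x = realDel v (fun z' => fderiv ℝ (η z') x) z :=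
        congrFun (congrFun (vert_horR h1 v) z) x
      rw [e]
      exact (realDel_comp (h1.vert.base x) v ((ContinuousLinearMap.apply ℝ ℂ b).comp
        (ContinuousLinearMap.apply ℝ (E n →L[ℝ] ℂ) a)) z).symm
    rw [key, key]
    congr 1
    funext z'
    exact h3 z' x a b

theorem horR_mem_exact {L : AddSubgroup (E n)} {η : Form n} (h : η ∈ exactForms L) (v : T n) :
    horR v η ∈ exactForms L := by
  obtain ⟨g, h1, h2, rfl⟩ := h
  refine ⟨horR v g, h1.horR v, fun l hl z x => ?_, (vert_horR h1 v).symm⟩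
  have : (fun z' => g z' (x + l)) = fun z' => g z' x := funext fun z' => h2 l hl z' x
  simp only [horR, this]

/-- Differentiation of closed relative forms along the base, at fixed `x`. -/
def closedDel (L : AddSubgroup (E n)) (v : T n) : ↥(closedForms L) →+ ↥(closedForms L) :=
  AddMonoidHom.mk' (fun η => ⟨horR v η.1, horR_mem_closed η.2 v⟩)
    (fun a b => Subtype.ext (horR_add a.2.1 b.2.1 v))

/-- The Gauss-Manin derivative along a real tangent vector. -/
def gmReal (L : AddSubgroup (E n)) (v : T n) : H L →+ H L :=
  QuotientAddGroup.map ((exactForms L).submoduleOf (closedForms L)).toAddSubgroup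
    ((exactForms L).submoduleOf (closedForms L)).toAddSubgroup (closedDel L v)
    (fun η hη => horR_mem_exact (η := η.1) hη v)

theorem gmReal_smul (L : AddSubgroup (E n)) (v : T n) (f : Cinf n) (h : H L) :
    gmReal L v (f • h) = rdel v f • h + f • gmReal L v h := by
  obtain ⟨η, rfl⟩ := cls_surjective L h
  exact congrArg (cls L)
    (Subtype.ext (horR_smul η.2.1 v f) :
      closedDel L v (f • η) = rdel v f • η + f • closedDel L v η)

theorem del_eq (k : Fin n × Fin n) (f : Cinf n) : del n k f =
    (2⁻¹ : ℂ) • (rdel (unitDir k 1) f - Complex.I • rdel (unitDir k Complex.I) f) := rfl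

/-- The Gauss-Manin connection. A section `h` of `H¹_DR` is differentiated in the holomorphic
directions `∂/∂z_ij`, i.e. `∇ h = ∑ ∇_ij h ⊗ dz_ij`, and `Ω(C^∞)` is free on the `dz_ij`. -/
def gaussManin (L : AddSubgroup (E n)) : Conn (del n) (H L) where
  toFun k := AddMonoidHom.mk' (fun h => (2⁻¹ : ℂ) •
      (gmReal L (unitDir k 1) h - Complex.I • gmReal L (unitDir k Complex.I) h))
    (fun a b => by simp only [map_add]; module)
  leibniz k f h := by
    simp only [AddMonoidHom.mk'_apply, gmReal_smul, del_eq]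
    simp only [← algebraMap_smul (Cinf n) (2⁻¹ : ℂ), ← algebraMap_smul (Cinf n) Complex.I]
    module

end Cohomology

section Family

variable {n : ℕ}

/-- The function `x ↦ (x₁)_j` on `E`. -/
def x1 (j : Fin n) : E n →L[ℝ] ℂ :=
  (ContinuousLinearMap.proj j).comp (ContinuousLinearMap.fst ℝ (Fin n → ℂ) (Fin n → ℂ))

/-- The function `x ↦ (x₂)_j` on `E`. -/
def x2 (j : Fin n) : E n →L[ℝ] ℂ :=
  (ContinuousLinearMap.proj j).comp (ContinuousLinearMap.snd ℝ (Fin n → ℂ) (Fin n → ℂ))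

/-- Complex conjugation. -/
def conjL : ℂ →L[ℝ] ℂ := Complex.conjCLE.toContinuousLinearMap

/-- `u_i^-`: the `i`-th coordinate of `z x̄₁ + x̄₂` -/
def uMinus (z : T n) (i : Fin n) : E n →L[ℝ] ℂ :=
  (∑ j, z i j • conjL.comp (x1 j)) + conjL.comp (x2 i)

/-- `u_i^+`: the `i`-th coordinate of `ᵗz x₁ + x₂` -/
def uPlus (z : T n) (i : Fin n) : E n →L[ℝ] ℂ :=
  (∑ j, z j i • x1 j) + x2 i

/-- `p_z(x) = ([z 1] x^*, [ᵗz 1] ᵗx)`; the abelian variety is `A_z = ℂ²ⁿ / p_z(L)`. -/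
def pz (z : T n) : E n →L[ℝ] E n :=
  (ContinuousLinearMap.pi (uMinus z)).prod (ContinuousLinearMap.pi (uPlus z))

theorem pz_apply (z : T n) (x : E n) : pz z x =
    (Matrix.of z *ᵥ star x.1 + star x.2, (Matrix.of z)ᵀ *ᵥ x.1 + x.2) := by
  refine Prod.ext (funext fun i => ?_) (funext fun i => ?_)
  · simp [pz, uMinus, x1, x2, conjL, Matrix.mulVec, dotProduct]
  · simp [pz, uPlus, x1, x2, Matrix.mulVec, dotProduct]

/-- Multiplication by `a` on `E` is `ι(a) = diag(ā, a)` on `ℂ²ⁿ`. -/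
theorem pz_smul (z : T n) (a : ℂ) (x : E n) :
    pz z (a • x) = (conj a • (pz z x).1, a • (pz z x).2) := by
  rw [pz_apply, pz_apply]
  simp [star_smul, Matrix.mulVec_smul, smul_add]

/-- A `ℤ`-lattice in `Kⁿ × Kⁿ`. -/
structure IsLattice (K : Subfield ℂ) (L : AddSubgroup (E n)) : Prop where
  coord_mem : ∀ l ∈ L, (∀ i, l.1 i ∈ K) ∧ ∀ i, l.2 i ∈ K
  fg : L.FG
  full : ∀ x : E n, (∀ i, x.1 i ∈ K) → (∀ i, x.2 i ∈ K) → ∃ m : ℕ, m ≠ 0 ∧ m • x ∈ L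

/-- An imaginary quadratic subfield of `ℂ`. -/
structure IsImagQuadratic (K : Subfield ℂ) : Prop where
  finrank_eq : Module.finrank ℚ K = 2
  not_real : ∃ a ∈ K, a.im ≠ 0

/-- Multiplication by `a` on `E`. -/
def mulE (a : ℂ) : E n →L[ℝ] E n := a • ContinuousLinearMap.id ℝ (E n)

/-- Pull-back of forms under multiplication by `a` on the fibres. -/
def pullForm (a : ℂ) (η : Form n) : Form n := fun z x => (η z (mulE a x)).comp (mulE a)

theorem pullForm_smooth (a : ℂ) {η : Form n} (h : RelSmooth η) : RelSmooth (pullForm a η) := by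
  have h1 : ContDiffOn ℝ ∞ (fun p : T n × E n => ext η p.1 (mulE a p.2))
      (halfSpace n ×ˢ Set.univ) :=
    ContDiffOn.comp (g := fun p : T n × E n => ext η p.1 p.2)
      (f := fun p : T n × E n => (p.1, mulE a p.2)) h
      (contDiff_fst.prodMk ((mulE a).contDiff.comp contDiff_snd)).contDiffOn
      fun p hp => ⟨hp.1, trivial⟩
  refine (h1.clm_comp (contDiffOn_const (c := mulE a))).congr ?_
  rintro ⟨z, x⟩ ⟨hz, _⟩
  simp [ext, show z ∈ halfSpace n from hz, pullForm]

theorem fderiv_pullForm (a : ℂ) {η : Form n} (h : RelSmooth η) (z : Hn n) (x v w : E n) :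
    fderiv ℝ (pullForm a η z) x v w = fderiv ℝ (η z) (mulE a x) (mulE a v) (mulE a w) := by
  have h1 : HasFDerivAt (η z) (fderiv ℝ (η z) (mulE a x)) (mulE a x) :=
    ((h.fibre z).differentiable (by simp) _).hasFDerivAt
  have h2 := (h1.comp x (mulE a).hasFDerivAt)
  have h3 := (((ContinuousLinearMap.compL ℝ (E n) (E n) ℂ).flip (mulE a)).hasFDerivAt.comp x
    h2).fderiv
  have h4 := congrArg (fun B : E n →L[ℝ] (E n →L[ℝ] ℂ) => B v w) h3
  exact h4

theorem pullForm_closed {L : AddSubgroup (E n)} {a : ℂ} (ha : ∀ l ∈ L, a • l ∈ L) {η : Form n}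
    (h : η ∈ closedForms L) : pullForm a η ∈ closedForms L := by
  refine ⟨pullForm_smooth a h.1, fun l hl z x => ?_, fun z x v w => ?_⟩
  · have : η z (mulE a (x + l)) = η z (mulE a x) := by
      rw [map_add]; exact h.2.1 _ (ha l hl) z _
    simp only [pullForm, this]
  · rw [fderiv_pullForm a h.1, fderiv_pullForm a h.1]
    exact h.2.2 _ _ _ _

theorem pullForm_exact {L : AddSubgroup (E n)} {a : ℂ} (ha : ∀ l ∈ L, a • l ∈ L) {η : Form n}
    (h : η ∈ exactForms L) : pullForm a η ∈ exactForms L := by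
  obtain ⟨g, h1, h2, rfl⟩ := h
  refine ⟨fun z x => g z (mulE a x), ?_, fun l hl z x => ?_, ?_⟩
  · refine (ContDiffOn.comp (g := fun p : T n × E n => ext g p.1 p.2)
      (f := fun p : T n × E n => (p.1, mulE a p.2)) h1
      (contDiff_fst.prodMk ((mulE a).contDiff.comp contDiff_snd)).contDiffOn
      fun p hp => ⟨hp.1, trivial⟩).congr ?_
    rintro ⟨z, x⟩ ⟨hz, _⟩
    simp [ext, show z ∈ halfSpace n from hz]
  · change g z (mulE a (x + l)) = g z (mulE a x)
    rw [map_add]; exact h2 _ (ha l hl) z _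
  · funext z x
    have h3 : HasFDerivAt (g z) (fderiv ℝ (g z) (mulE a x)) (mulE a x) :=
      ((h1.fibre z).differentiable (by simp) _).hasFDerivAt
    exact (h3.comp x (mulE a).hasFDerivAt).fderiv.symm

/-- Pull-back of closed forms under multiplication by `a`. -/
def pullClosed (L : AddSubgroup (E n)) (a : ℂ) (ha : ∀ l ∈ L, a • l ∈ L) :
    ↥(closedForms L) →ₗ[Cinf n] ↥(closedForms L) where
  toFun η := ⟨pullForm a η.1, pullForm_closed ha η.2⟩
  map_add' _ _ := rfl
  map_smul' _ _ := rfl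

/-- `ι(a)^*` on relative de Rham cohomology. -/
def pull (L : AddSubgroup (E n)) (a : ℂ) (ha : ∀ l ∈ L, a • l ∈ L) : H L →ₗ[Cinf n] H L :=
  Submodule.mapQ ((exactForms L).submoduleOf (closedForms L))
    ((exactForms L).submoduleOf (closedForms L)) (pullClosed L a ha)
    (fun η hη => pullForm_exact (η := η.1) ha hη)

theorem pull_gmReal (L : AddSubgroup (E n)) (a : ℂ) (ha : ∀ l ∈ L, a • l ∈ L) (v : T n) (h : H L) :
    pull L a ha (gmReal L v h) = gmReal L v (pull L a ha h) := by
  obtain ⟨η, rfl⟩ := cls_surjective L h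
  refine congrArg (cls L) (Subtype.ext ?_ :
    pullClosed L a ha (closedDel L v η) = closedDel L v (pullClosed L a ha η))
  funext z x
  exact (realDel_comp (η.2.1.base (mulE a x)) v
    ((ContinuousLinearMap.compL ℝ (E n) (E n) ℂ).flip (mulE a)) z).symm

theorem pull_gaussManin (L : AddSubgroup (E n)) (a : ℂ) (ha : ∀ l ∈ L, a • l ∈ L)
    (k : Fin n × Fin n) (h : H L) :
    pull L a ha ((gaussManin L).toFun k h) = (gaussManin L).toFun k (pull L a ha h) := by
  simp only [gaussManin, AddMonoidHom.mk'_apply, LinearMap.map_smul_of_tower, map_sub,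
    pull_gmReal]

/-- The part `H^χ` of `H¹_DR` on which the endomorphisms `ι(a)`, `a ∈ K`, `a L ⊆ L`, act through
`ι(a)^* = χ(a)`. -/
def Hchi (K : Subfield ℂ) (L : AddSubgroup (E n)) (χ : ℂ →+* ℂ) : Submodule (Cinf n) (H L) where
  carrier := {h | ∀ a ∈ K, ∀ ha : ∀ l ∈ L, a • l ∈ L, pull L a ha h = χ a • h}
  zero_mem' := fun a _ ha => by rw [map_zero, smul_zero]
  add_mem' := fun {x y} hx hy a hK ha => by rw [map_add, hx a hK ha, hy a hK ha, smul_add]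
  smul_mem' := fun f x hx a hK ha => by rw [map_smul, hx a hK ha, smul_comm]

/-- The Gauss-Manin connection on `H^χ`. -/
def gm (K : Subfield ℂ) (L : AddSubgroup (E n)) (χ : ℂ →+* ℂ) : Conn (del n) ↥(Hchi K L χ) :=
  (gaussManin L).restrict (Hchi K L χ) fun k h hh a hK ha => by
    rw [pull_gaussManin, hh a hK ha, ← algebraMap_smul (Cinf n) (χ a) h, Conn.leibniz_const,
      algebraMap_smul]

/-- Real-linear functionals of type `(1,0)` for the complex structure transported by `p_z`. -/
def IsType10 (z : T n) (φ : E n →L[ℝ] ℂ) : Prop :=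
  ∃ l : E n →ₗ[ℂ] ℂ, ∀ x, φ x = l (pz z x)

/-- Real-linear functionals of type `(0,1)`. -/
def IsType01 (z : T n) (φ : E n →L[ℝ] ℂ) : Prop :=
  ∃ l : E n →ₗ[ℂ] ℂ, ∀ x, φ x = conj (l (pz z x))

/-- `ω^χ`: the classes in `H^χ` of forms that are holomorphic on the fibres. -/
def omega (K : Subfield ℂ) (L : AddSubgroup (E n)) (χ : ℂ →+* ℂ) :
    Submodule (Cinf n) ↥(Hchi K L χ) where
  carrier := {h | ∃ η : ↥(closedForms L), cls L η = h.1 ∧ ∀ (z : Hn n) (x : E n), IsType10 z (η.1 z x)}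
  zero_mem' := ⟨0, map_zero _, fun _ _ => ⟨0, fun _ => rfl⟩⟩
  add_mem' := by
    rintro x y ⟨η, h1, h2⟩ ⟨θ, h3, h4⟩
    refine ⟨η + θ, by rw [map_add, h1, h3]; rfl, fun z x => ?_⟩
    obtain ⟨l, hl⟩ := h2 z x
    obtain ⟨m, hm⟩ := h4 z x
    exact ⟨l + m, fun v => congrArg₂ (· + ·) (hl v) (hm v)⟩
  smul_mem' := by
    rintro f x ⟨η, h1, h2⟩
    refine ⟨f • η, by rw [map_smul, h1]; rfl, fun z x => ?_⟩
    obtain ⟨l, hl⟩ := h2 z x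
    exact ⟨f.1 z • l, fun v => congrArg (f.1 z * ·) (hl v)⟩

/-- `Split(C^∞)^χ`: the classes in `H^χ` of forms that are antiholomorphic on the fibres. -/
def split (K : Subfield ℂ) (L : AddSubgroup (E n)) (χ : ℂ →+* ℂ) :
    Submodule (Cinf n) ↥(Hchi K L χ) where
  carrier := {h | ∃ η : ↥(closedForms L), cls L η = h.1 ∧ ∀ (z : Hn n) (x : E n), IsType01 z (η.1 z x)}
  zero_mem' := ⟨0, map_zero _, fun _ _ => ⟨0, fun _ => (map_zero (starRingEnd ℂ)).symm⟩⟩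
  add_mem' := by
    rintro x y ⟨η, h1, h2⟩ ⟨θ, h3, h4⟩
    refine ⟨η + θ, by rw [map_add, h1, h3]; rfl, fun z x => ?_⟩
    obtain ⟨l, hl⟩ := h2 z x
    obtain ⟨m, hm⟩ := h4 z x
    refine ⟨l + m, fun v => ?_⟩
    rw [LinearMap.add_apply, map_add]
    exact congrArg₂ (· + ·) (hl v) (hm v)
  smul_mem' := by
    rintro f x ⟨η, h1, h2⟩
    refine ⟨f • η, by rw [map_smul, h1]; rfl, fun z x => ?_⟩
    obtain ⟨l, hl⟩ := h2 z x
    refine ⟨conj (f.1 z) • l, fun v => ?_⟩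
    rw [LinearMap.smul_apply, smul_eq_mul, map_mul, Complex.conj_conj]
    exact congrArg (f.1 z * ·) (hl v)

/-- The translation-invariant relative forms. -/
def invForms (L : AddSubgroup (E n)) : Submodule (Cinf n) ↥(closedForms L) where
  carrier := {η | ∀ z x y, η.1 z x = η.1 z y}
  zero_mem' := fun _ _ _ => rfl
  add_mem' := fun ha hb z x y => congrArg₂ (· + ·) (ha z x y) (hb z x y)
  smul_mem' := fun f _ ha z x y => congrArg (f.1 z • ·) (ha z x y)

/-- The class of an invariant form. -/
def invCls (L : AddSubgroup (E n)) : ↥(invForms L) →ₗ[Cinf n] H L :=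
  (cls L).comp (invForms L).subtype

/-- The value at `v` of (the restriction to the zero section of) a form. -/
def coef (L : AddSubgroup (E n)) (v : E n) : ↥(closedForms L) →ₗ[Cinf n] Cinf n where
  toFun η := ⟨fun z => η.1 z 0 v, by
    refine ((η.2.1.base 0).clm_apply (contDiffOn_const (c := v))).congr fun z hz => ?_
    simp [ext, hz]⟩
  map_add' _ _ := rfl
  map_smul' _ _ := rfl

/-- `(η, θ) ↦ η(u) θ(v) - η(v) θ(u)` -/
def wedge (L : AddSubgroup (E n)) (u v : E n) :
    ↥(closedForms L) →ₗ[Cinf n] ↥(closedForms L) →ₗ[Cinf n] Cinf n :=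
  (LinearMap.mul (Cinf n) (Cinf n)).compl₁₂ (coef L u) (coef L v) -
    (LinearMap.mul (Cinf n) (Cinf n)).compl₁₂ (coef L v) (coef L u)

/-- `(c e_j, 0)` -/
def e1 (j : Fin n) (c : ℂ) : E n := (Pi.single j c, 0)

/-- `(0, c e_j)` -/
def e2 (j : Fin n) (c : ℂ) : E n := (0, Pi.single j c)

/-- The Riemann form of the polarization: `Tr_{K/ℚ}` of the skew-hermitian form
`∑ (x₂ ȳ₁ - x₁ ȳ₂)`. -/
def riemann (x y : E n) : ℝ := 2 * (∑ j, (x.2 j * conj (y.1 j) - x.1 j * conj (y.2 j))).re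

/-- The pairing on one-forms induced by the Riemann form. -/
def Q (L : AddSubgroup (E n)) :
    ↥(closedForms L) →ₗ[Cinf n] ↥(closedForms L) →ₗ[Cinf n] Cinf n :=
  (2⁻¹ : ℂ) • ∑ j, (wedge L (e1 j 1) (e2 j 1) + wedge L (e1 j Complex.I) (e2 j Complex.I))

/-- The pairing `Q` is the one that the Riemann form induces on its dual. -/
theorem Q_riemann (L : AddSubgroup (E n)) (η θ : ↥(closedForms L)) (z : Hn n) (a b : E n)
    (hη : ∀ y, η.1 z 0 y = riemann a y) (hθ : ∀ y, θ.1 z 0 y = riemann b y) :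
    (Q L η θ).1 z = riemann b a := by
  have hQ : (Q L η θ).1 z = 2⁻¹ * ∑ j, ((η.1 z 0 (e1 j 1) * θ.1 z 0 (e2 j 1) -
      η.1 z 0 (e2 j 1) * θ.1 z 0 (e1 j 1)) + (η.1 z 0 (e1 j Complex.I) * θ.1 z 0 (e2 j Complex.I) -
      η.1 z 0 (e2 j Complex.I) * θ.1 z 0 (e1 j Complex.I))) := by
    let ev : Cinf n →+ ℂ := ⟨⟨fun f => f.1 z, rfl⟩, fun _ _ => rfl⟩
    simp only [Q, LinearMap.smul_apply, LinearMap.sum_apply]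
    change (2⁻¹ : ℂ) * ev _ = _
    rw [map_sum]
    rfl
  have h1 : ∀ (c : E n) (j : Fin n) (t : ℂ), riemann c (e1 j t) = 2 * (c.2 j * conj t).re := by
    intro c j t
    simp [riemann, e1, Pi.single_apply, apply_ite]
  have h2 : ∀ (c : E n) (j : Fin n) (t : ℂ), riemann c (e2 j t) = -2 * (c.1 j * conj t).re := by
    intro c j t
    simp [riemann, e2, Pi.single_apply, apply_ite]
    ring
  rw [hQ]
  simp only [hη, hθ, h1, h2]
  simp only [riemann, Complex.re_sum, Finset.mul_sum, Complex.ofReal_sum]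
  refine Finset.sum_congr rfl fun j _ => ?_
  simp
  ring

end Family

section Geometric

variable {n : ℕ} {K : Subfield ℂ} {L : AddSubgroup (E n)}

/-- `ι(a)^*` acts on `H^-` through `ā`. -/
abbrev chiMinus : ℂ →+* ℂ := starRingEnd ℂ

/-- `ι(a)^*` acts on `H^+` through `a`. -/
abbrev chiPlus : ℂ →+* ℂ := RingHom.id ℂ

/-- The comparison with invariant forms and the `C^∞` Hodge decompositions
`H^± = ω^± ⊕ Split(C^∞)^±`. -/
structure HodgeDeRham (K : Subfield ℂ) (L : AddSubgroup (E n)) : Prop where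
  deRham : Function.Bijective (invCls L)
  minus : IsCompl (omega K L chiMinus) (split K L chiMinus)
  plus : IsCompl (omega K L chiPlus) (split K L chiPlus)

/-- The invariant representative of a de Rham class. -/
def HodgeDeRham.rep (h : HodgeDeRham K L) : H L →ₗ[Cinf n] ↥(closedForms L) :=
  (invForms L).subtype.comp (LinearEquiv.ofBijective (invCls L) h.deRham).symm.toLinearMap

/-- The pairing on `H¹_DR` induced by the polarization. -/
def HodgeDeRham.pairing (h : HodgeDeRham K L) : H L →ₗ[Cinf n] H L →ₗ[Cinf n] Cinf n :=
  (Q L).compl₁₂ h.rep h.rep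

/-- Projection `H^- → ω^-` modulo `Split(C^∞)`. -/
def HodgeDeRham.modMinus (h : HodgeDeRham K L) :
    ↥(Hchi K L chiMinus) →ₗ[Cinf n] ↥(omega K L chiMinus) :=
  Submodule.projectionOnto _ _ h.minus

/-- Projection `H^+ → ω^+` modulo `Split(C^∞)`. -/
def HodgeDeRham.modPlus (h : HodgeDeRham K L) :
    ↥(Hchi K L chiPlus) →ₗ[Cinf n] ↥(omega K L chiPlus) :=
  Submodule.projectionOnto _ _ h.plus

/-- `Ω(C^∞)`: a one-form `∑ f_ij dz_ij` on `𝓗_n` is given by its coefficients. -/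
abbrev Om (n : ℕ) : Type := Fin n × Fin n → Cinf n

/-- `dz_ij` for `k = (i, j)`. -/
def dz (k : Fin n × Fin n) : Om n := Pi.single k 1

/-- The `dz_ij`-coefficient of `∇ : ω^- → H^- / ω^- ⊗ Ω = Split(C^∞)^- ⊗ Ω`. -/
def HodgeDeRham.ksAux (h : HodgeDeRham K L) (k : Fin n × Fin n) :
    ↥(omega K L chiMinus) →ₗ[Cinf n] ↥(split K L chiMinus) where
  toFun w := Submodule.projectionOnto _ _ h.minus.symm ((gm K L chiMinus).toFun k w)
  map_add' a b := by simp
  map_smul' f w := by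
    have h0 : Submodule.projectionOnto _ _ h.minus.symm (w : ↥(Hchi K L chiMinus)) = 0 :=
      Submodule.projectionOnto_apply_right _ w
    rw [Submodule.coe_smul, Conn.leibniz, map_add, map_smul, map_smul, h0, smul_zero, zero_add,
      RingHom.id_apply]

/-- The Kodaira-Spencer morphism `ω^- ⊗ ω^+ → Ω`: the composite of
`ω → H¹_DR ⊗ Ω → (H¹_DR / ω) ⊗ Ω` with the duality given by the polarization. -/
def HodgeDeRham.KS (h : HodgeDeRham K L) :
    ↥(omega K L chiMinus) ⊗[Cinf n] ↥(omega K L chiPlus) →ₗ[Cinf n] Om n :=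
  LinearMap.pi fun k => TensorProduct.lift
    (h.pairing.compl₁₂
      ((Hchi K L chiMinus).subtype.comp ((split K L chiMinus).subtype.comp (h.ksAux k)))
      ((Hchi K L chiPlus).subtype.comp (omega K L chiPlus).subtype))

variable {dm dp : ℕ}

/-- `(ω^-)^{ρ_-} ⊗ (ω^+)^{ρ_+}` -/
def OmegaRho (K : Subfield ℂ) (L : AddSubgroup (E n)) (Jm : Set (Equiv.Perm (Fin dm) → ℂ))
    (Jp : Set (Equiv.Perm (Fin dp) → ℂ)) : Type :=
  Schur (Cinf n) ↥(omega K L chiMinus) Jm ⊗[Cinf n]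
    Schur (Cinf n) ↥(omega K L chiPlus) Jp

section

variable (K : Subfield ℂ) (L : AddSubgroup (E n)) (Jm : Set (Equiv.Perm (Fin dm) → ℂ))
    (Jp : Set (Equiv.Perm (Fin dp) → ℂ))

instance : AddCommGroup (OmegaRho K L Jm Jp) :=
  inferInstanceAs (AddCommGroup (Schur (Cinf n) ↥(omega K L chiMinus) Jm ⊗[Cinf n]
    Schur (Cinf n) ↥(omega K L chiPlus) Jp))

instance : Module (Cinf n) (OmegaRho K L Jm Jp) :=
  inferInstanceAs (Module (Cinf n) (Schur (Cinf n) ↥(omega K L chiMinus) Jm ⊗[Cinf n]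
    Schur (Cinf n) ↥(omega K L chiPlus) Jp))

instance : Module ℂ (OmegaRho K L Jm Jp) :=
  inferInstanceAs (Module ℂ (Schur (Cinf n) ↥(omega K L chiMinus) Jm ⊗[Cinf n]
    Schur (Cinf n) ↥(omega K L chiPlus) Jp))

instance : IsScalarTower ℂ (Cinf n) (OmegaRho K L Jm Jp) :=
  inferInstanceAs (IsScalarTower ℂ (Cinf n) (Schur (Cinf n) ↥(omega K L chiMinus) Jm ⊗[Cinf n]
    Schur (Cinf n) ↥(omega K L chiPlus) Jp))

end

/-- `(ω^-)^{ρ_-} ⊗ (ω^+)^{ρ_+} ⊗ Ω^{⊗ d}` -/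
abbrev OmegaRhoD (K : Subfield ℂ) (L : AddSubgroup (E n)) (Jm : Set (Equiv.Perm (Fin dm) → ℂ))
    (Jp : Set (Equiv.Perm (Fin dp) → ℂ)) (d : ℕ) : Type :=
  OmegaRho K L Jm Jp ⊗[Cinf n] ⨂[Cinf n]^d (Om n)

/-- `(H^-)^{ρ_-} ⊗ (H^+)^{ρ_+}` -/
abbrev HRho (K : Subfield ℂ) (L : AddSubgroup (E n)) (Jm : Set (Equiv.Perm (Fin dm) → ℂ))
    (Jp : Set (Equiv.Perm (Fin dp) → ℂ)) : Type :=
  Schur (Cinf n) ↥(Hchi K L chiMinus) Jm ⊗[Cinf n] Schur (Cinf n) ↥(Hchi K L chiPlus) Jp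

/-- `H^- ⊗ H^+` -/
abbrev HH (K : Subfield ℂ) (L : AddSubgroup (E n)) : Type :=
  ↥(Hchi K L chiMinus) ⊗[Cinf n] ↥(Hchi K L chiPlus)

/-- `(H^-)^{ρ_-} ⊗ (H^+)^{ρ_+} ⊗ (H^- ⊗ H^+)^{⊗ d}` -/
abbrev HRhoD (K : Subfield ℂ) (L : AddSubgroup (E n)) (Jm : Set (Equiv.Perm (Fin dm) → ℂ))
    (Jp : Set (Equiv.Perm (Fin dp) → ℂ)) (d : ℕ) : Type :=
  HRho K L Jm Jp ⊗[Cinf n] ⨂[Cinf n]^d (HH K L)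

/-- The Gauss-Manin connection on `(H^-)^{ρ_-} ⊗ (H^+)^{ρ_+} ⊗ (H^- ⊗ H^+)^{⊗ d}`, by the product
rule. -/
def nablaRho (K : Subfield ℂ) (L : AddSubgroup (E n)) (Jm : Set (Equiv.Perm (Fin dm) → ℂ))
    (Jp : Set (Equiv.Perm (Fin dp) → ℂ)) (d : ℕ) : Conn (del n) (HRhoD K L Jm Jp d) :=
  (((gm K L chiMinus).schur Jm).tensor ((gm K L chiPlus).schur Jp)).tensor
    (((gm K L chiMinus).tensor (gm K L chiPlus)).pi d)

variable (h : HodgeDeRham K L) (hKS : Function.Bijective h.KS)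
  (Jm : Set (Equiv.Perm (Fin dm) → ℂ)) (Jp : Set (Equiv.Perm (Fin dp) → ℂ))

/-- `Ω ≅ ω^- ⊗ ω^+ → H^- ⊗ H^+` -/
def ksInv : Om n →ₗ[Cinf n] HH K L :=
  (TensorProduct.map (omega K L chiMinus).subtype (omega K L chiPlus).subtype).comp
    (LinearEquiv.ofBijective h.KS hKS).symm.toLinearMap

/-- The operator `D^ρ`: the composite of
`∇ : X → X ⊗ Ω` with `X ⊗ Ω ≅ X ⊗ ω^- ⊗ ω^+ → X ⊗ (H^- ⊗ H^+)`. -/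
def Drho (d : ℕ) (x : HRhoD K L Jm Jp d) : HRhoD K L Jm Jp (d + 1) :=
  ∑ k, appendR ((nablaRho K L Jm Jp d).toFun k x) (ksInv h hKS (dz k))

/-- `(D^ρ)^d` -/
def DrhoIter : (d : ℕ) → HRhoD K L Jm Jp 0 → HRhoD K L Jm Jp d
  | 0, x => x
  | d + 1, x => Drho h hKS Jm Jp d (DrhoIter d x)

/-- The inclusion of `ω^ρ` into `H^ρ`. -/
def inclRho (K : Subfield ℂ) (L : AddSubgroup (E n)) (Jm : Set (Equiv.Perm (Fin dm) → ℂ))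
    (Jp : Set (Equiv.Perm (Fin dp) → ℂ)) : OmegaRho K L Jm Jp →ₗ[Cinf n] HRhoD K L Jm Jp 0 :=
  (TensorProduct.mk (Cinf n) (HRho K L Jm Jp) (⨂[Cinf n]^0 (HH K L))).flip
      (PiTensorProduct.tprod (Cinf n) fun i => i.elim0) ∘ₗ
    TensorProduct.map (Schur.map Jm (omega K L chiMinus).subtype)
      (Schur.map Jp (omega K L chiPlus).subtype)

/-- Reduction modulo `Split(C^∞)`, followed by the Kodaira-Spencer isomorphism on the factors
`ω^- ⊗ ω^+`. -/
def modSplit (d : ℕ) : HRhoD K L Jm Jp d →ₗ[Cinf n] OmegaRhoD K L Jm Jp d :=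
  TensorProduct.map (TensorProduct.map (Schur.map Jm h.modMinus) (Schur.map Jp h.modPlus))
    (PiTensorProduct.map fun _ => h.KS.comp (TensorProduct.map h.modMinus h.modPlus))

/-- The geometric operator `∂(ρ, C^∞, d)`. -/
def geomDiff (d : ℕ) (x : OmegaRho K L Jm Jp) : OmegaRhoD K L Jm Jp d :=
  modSplit h Jm Jp d (DrhoIter h hKS Jm Jp d (inclRho K L Jm Jp x))

end Geometric

section Frames

variable {n : ℕ}

theorem relSmooth_const {φ : T n → (E n →L[ℝ] ℂ)} (h : ContDiff ℝ ∞ φ) :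
    RelSmooth (fun (z : Hn n) (_ : E n) => φ z) := by
  refine (h.comp contDiff_fst).contDiffOn.congr ?_
  rintro ⟨z, x⟩ ⟨hz, _⟩
  simp [ext, show z ∈ halfSpace n from hz]

theorem const_mem_closed (L : AddSubgroup (E n)) {φ : T n → (E n →L[ℝ] ℂ)}
    (h : ContDiff ℝ ∞ φ) : (fun (z : Hn n) (_ : E n) => φ z : Form n) ∈ closedForms L :=
  ⟨relSmooth_const h, fun _ _ _ _ => rfl, fun z x v w => by
    have : fderiv ℝ (fun _ : E n => φ z) x = 0 := fderiv_const_apply _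
    exact (congrArg (fun B : E n →L[ℝ] (E n →L[ℝ] ℂ) => B v w) this).trans
      (congrArg (fun B : E n →L[ℝ] (E n →L[ℝ] ℂ) => B w v) this).symm⟩

theorem contDiff_uMinus (i : Fin n) : ContDiff ℝ ∞ (fun z : T n => uMinus z i) := by
  unfold uMinus
  fun_prop

theorem contDiff_uPlus (i : Fin n) : ContDiff ℝ ∞ (fun z : T n => uPlus z i) := by
  unfold uPlus
  fun_prop

/-- The form `du_i^-`. -/
def duMinusForm (L : AddSubgroup (E n)) (i : Fin n) : ↥(closedForms L) :=
  ⟨fun z _ => uMinus z i, const_mem_closed L (contDiff_uMinus i)⟩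

/-- The form `du_i^+`. -/
def duPlusForm (L : AddSubgroup (E n)) (i : Fin n) : ↥(closedForms L) :=
  ⟨fun z _ => uPlus z i, const_mem_closed L (contDiff_uPlus i)⟩

theorem duMinus_mem_H (K : Subfield ℂ) (L : AddSubgroup (E n)) (i : Fin n) :
    cls L (duMinusForm L i) ∈ Hchi K L chiMinus := by
  intro a _ ha
  refine congrArg (cls L) (Subtype.ext ?_ : pullClosed L a ha (duMinusForm L i) =
    (conj a) • duMinusForm L i)
  funext z x
  refine ContinuousLinearMap.ext fun y => ?_
  exact congrFun (congrArg Prod.fst (pz_smul (z : T n) a y)) i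

theorem duPlus_mem_H (K : Subfield ℂ) (L : AddSubgroup (E n)) (i : Fin n) :
    cls L (duPlusForm L i) ∈ Hchi K L chiPlus := by
  intro a _ ha
  refine congrArg (cls L) (Subtype.ext ?_ : pullClosed L a ha (duPlusForm L i) =
    a • duPlusForm L i)
  funext z x
  refine ContinuousLinearMap.ext fun y => ?_
  exact congrFun (congrArg Prod.snd (pz_smul (z : T n) a y)) i

/-- `du_i^-` as an element of `ω^-`. -/
def duMinus (K : Subfield ℂ) (L : AddSubgroup (E n)) (i : Fin n) : ↥(omega K L chiMinus) :=
  ⟨⟨cls L (duMinusForm L i), duMinus_mem_H K L i⟩, duMinusForm L i, rfl, fun _ _ =>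
    ⟨(LinearMap.proj i).comp (LinearMap.fst ℂ (Fin n → ℂ) (Fin n → ℂ)), fun _ => rfl⟩⟩

/-- `du_i^+` as an element of `ω^+`. -/
def duPlus (K : Subfield ℂ) (L : AddSubgroup (E n)) (i : Fin n) : ↥(omega K L chiPlus) :=
  ⟨⟨cls L (duPlusForm L i), duPlus_mem_H K L i⟩, duPlusForm L i, rfl, fun _ _ =>
    ⟨(LinearMap.proj i).comp (LinearMap.snd ℂ (Fin n → ℂ) (Fin n → ℂ)), fun _ => rfl⟩⟩

/-- The frame `λ^- : ℂⁿ → ω^-`, `e_i ↦ du_i^-`. -/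
def lamMinus (K : Subfield ℂ) (L : AddSubgroup (E n)) :
    (Fin n → ℂ) →ₗ[ℂ] ↥(omega K L chiMinus) :=
  Fintype.linearCombination ℂ (duMinus K L)

/-- The frame `λ^+ : ℂⁿ → ω^+`, `e_i ↦ du_i^+`. -/
def lamPlus (K : Subfield ℂ) (L : AddSubgroup (E n)) :
    (Fin n → ℂ) →ₗ[ℂ] ↥(omega K L chiPlus) :=
  Fintype.linearCombination ℂ (duPlus K L)

end Frames

section BaseChange

variable {R : Type} [CommRing R] [Algebra ℂ R] {V W M N : Type}
  [AddCommGroup V] [Module ℂ V] [AddCommGroup W] [Module ℂ W]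
  [AddCommGroup M] [Module R M] [Module ℂ M] [IsScalarTower ℂ R M]
  [AddCommGroup N] [Module R N] [Module ℂ N] [IsScalarTower ℂ R N]

/-- The map `V^{⊗ d} → M^{⊗ d}` induced by a `ℂ`-linear map from `V` to an `R`-module `M`. -/
def powBase (φ : V →ₗ[ℂ] M) (d : ℕ) : (⨂[ℂ]^d V) →ₗ[ℂ] ⨂[R]^d M :=
  PiTensorProduct.lift
    (((PiTensorProduct.tprod R (s := fun _ : Fin d => M)).restrictScalars ℂ).compLinearMap
      fun _ => φ)

theorem powBase_permAct (φ : V →ₗ[ℂ] M) {d : ℕ} (s : Equiv.Perm (Fin d)) (t : ⨂[ℂ]^d V) :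
    powBase (R := R) φ d (permAct ℂ V s t) = permAct R M s (powBase φ d t) := by
  induction t using PiTensorProduct.induction_on with
  | smul_tprod r m =>
    simp only [map_smul, permAct_tprod, LinearMap.map_smul_of_tower]
    simp [powBase, permAct_tprod]
  | add x y hx hy => simp only [map_add, hx, hy]

theorem powBase_relations (φ : V →ₗ[ℂ] M) {d : ℕ} (J : Set (Equiv.Perm (Fin d) → ℂ)) :
    relations ℂ V J ≤ LinearMap.ker
      (((relations R M J).mkQ.restrictScalars ℂ).comp (powBase (R := R) φ d)) := by
  refine iSup₂_le fun a ha => ?_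
  rintro _ ⟨t, rfl⟩
  rw [LinearMap.mem_ker, LinearMap.comp_apply, LinearMap.restrictScalars_apply,
    Submodule.mkQ_apply, Submodule.Quotient.mk_eq_zero]
  have h : powBase (R := R) φ d (symmetrizer ℂ V a t) = symmetrizer R M a (powBase φ d t) := by
    simp only [symmetrizer, LinearMap.sum_apply, LinearMap.smul_apply, map_sum, map_smul,
      powBase_permAct, algebraMap_smul]
  rw [h]
  exact Submodule.mem_iSup_of_mem a (Submodule.mem_iSup_of_mem ha ⟨_, rfl⟩)

/-- The map `V^ρ → M^ρ` induced by a `ℂ`-linear map from `V` to an `R`-module `M`. -/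
def Schur.base (φ : V →ₗ[ℂ] M) {d : ℕ} (J : Set (Equiv.Perm (Fin d) → ℂ)) :
    Schur ℂ V J →ₗ[ℂ] Schur R M J :=
  Submodule.liftQ _ (((relations R M J).mkQ.restrictScalars ℂ).comp (powBase φ d))
    (powBase_relations φ J)

/-- The map `V ⊗ W → M ⊗ N` induced by `ℂ`-linear maps into `R`-modules. -/
def tensorBase (φ : V →ₗ[ℂ] M) (ψ : W →ₗ[ℂ] N) : V ⊗[ℂ] W →ₗ[ℂ] M ⊗[R] N :=
  TensorProduct.lift (LinearMap.mk₂ ℂ (fun v w => φ v ⊗ₜ[R] ψ w)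
    (fun a b c => by rw [map_add, TensorProduct.add_tmul])
    (fun a b c => by rw [map_smul, TensorProduct.smul_tmul'])
    (fun a b c => by rw [map_add, TensorProduct.tmul_add])
    (fun a b c => by
      rw [map_smul, ← algebraMap_smul R a (ψ c), ← algebraMap_smul R a (_ ⊗ₜ[R] _),
        TensorProduct.tmul_smul]))

end BaseChange

section VectorValued

variable {n : ℕ} {W : Type} [AddCommGroup W] [Module ℂ W]

/-- Smoothness of functions with values in a finite-dimensional vector space. -/
def IsSmoothMap (f : Hn n → W) : Prop := ∀ φ : Module.Dual ℂ W, IsSmooth fun z => φ (f z)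

/-- `∂f/∂z_ij` for functions with values in a finite-dimensional vector space. -/
def wirtV [Module.Finite ℂ W] (k : Fin n × Fin n) (f : Hn n → W) : Hn n → W := fun z =>
  ∑ i, wirt k (fun z => (Module.finBasis ℂ W).coord i (f z)) z • Module.finBasis ℂ W i

/-- A smooth function `f = ∑ f_i b_i : 𝓗_n → W` and a `ℂ`-linear map `Λ` from `W` to sections
of a `C^∞`-module give the section `Λ(f) = ∑ f_i Λ(b_i)`. -/
def frame [Module.Finite ℂ W] {M : Type} [AddCommGroup M] [Module (Cinf n) M] [Module ℂ M]
    (Λ : W →ₗ[ℂ] M) (f : Hn n → W) (hf : IsSmoothMap f) : M :=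
  ∑ i, (show Cinf n from ⟨fun z => (Module.finBasis ℂ W).coord i (f z), hf _⟩) •
    Λ (Module.finBasis ℂ W i)

/-- `Ml_d(T, W)`: multilinear maps `T × ⋯ × T → W`. -/
abbrev Ml (n d : ℕ) (W : Type) [AddCommGroup W] [Module ℂ W] : Type :=
  MultilinearMap ℂ (fun _ : Fin d => T n) W

/-- `u ↦ ᵗa u b` -/
def tau (a b : Matrix (Fin n) (Fin n) ℂ) : T n →ₗ[ℂ] T n where
  toFun u := Matrix.of.symm (aᵀ * Matrix.of u * b)
  map_add' u v := by
    change aᵀ * (Matrix.of u + Matrix.of v) * b = aᵀ * Matrix.of u * b + aᵀ * Matrix.of v * b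
    rw [Matrix.mul_add, Matrix.add_mul]
  map_smul' c u := by
    change aᵀ * (c • Matrix.of u) * b = c • (aᵀ * Matrix.of u * b)
    rw [Matrix.mul_smul, Matrix.smul_mul]

/-- The coordinate `u ↦ u_ij` on `T`, for `k = (i, j)`. -/
def coordT (k : Fin n × Fin n) : T n →ₗ[ℂ] ℂ where
  toFun u := u k.1 k.2
  map_add' _ _ := rfl
  map_smul' _ _ := rfl

/-- `(u_1, …, u_{d+1}) ↦ g(u_{d+1}) h(u_1, …, u_d)` -/
def mlSnoc {d : ℕ} (g : T n →ₗ[ℂ] ℂ) (h : Ml n d W) : Ml n (d + 1) W :=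
  MultilinearMap.uncurryRight ((LinearMap.smulRightₗ g).compMultilinearMap h)

/-- `(D F)(u) = ∑ u_ij ∂F/∂z_ij` -/
def Dop [Module.Finite ℂ W] {d : ℕ} (F : Hn n → Ml n d W) : Hn n → Ml n (d + 1) W :=
  fun z => ∑ k, mlSnoc (coordT k) (wirtV k F z)

/-- `Ξ(z) = (ξ, η) = (i (z̄ - ᵗz), i (z* - z))` -/
def Xi (z : T n) : Matrix (Fin n) (Fin n) ℂ × Matrix (Fin n) (Fin n) ℂ :=
  (Complex.I • ((Matrix.of z).map conj - (Matrix.of z)ᵀ),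
    Complex.I • ((Matrix.of z)ᴴ - Matrix.of z))

/-- `(C F)(u) = (D F)(ᵗξ u η)`, where `u` is the new variable. -/
def Cop [Module.Finite ℂ W] {d : ℕ} (F : Hn n → Ml n d W) : Hn n → Ml n (d + 1) W :=
  fun z => ∑ k, mlSnoc ((coordT k).comp (tau (Xi (z : T n)).1 (Xi (z : T n)).2)) (wirtV k F z)

/-- `C^d` -/
def CopIter [Module.Finite ℂ W] (g : Hn n → W) : (d : ℕ) → Hn n → Ml n d W
  | 0 => fun z => MultilinearMap.constOfIsEmpty ℂ _ (g z)
  | d + 1 => Cop (CopIter g d)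

end VectorValued

section Shimura

variable {n dm dp : ℕ} (Jm : Set (Equiv.Perm (Fin dm) → ℂ)) (Jp : Set (Equiv.Perm (Fin dp) → ℂ))

/-- The representation space `V = V_- ⊗ V_+` of `ρ = ρ_- ⊗ ρ_+`. -/
def V (n : ℕ) (Jm : Set (Equiv.Perm (Fin dm) → ℂ)) (Jp : Set (Equiv.Perm (Fin dp) → ℂ)) :
    Type :=
  Schur ℂ (Fin n → ℂ) Jm ⊗[ℂ] Schur ℂ (Fin n → ℂ) Jp

instance : AddCommGroup (V n Jm Jp) :=
  inferInstanceAs (AddCommGroup (Schur ℂ (Fin n → ℂ) Jm ⊗[ℂ] Schur ℂ (Fin n → ℂ) Jp))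

instance : Module ℂ (V n Jm Jp) :=
  inferInstanceAs (Module ℂ (Schur ℂ (Fin n → ℂ) Jm ⊗[ℂ] Schur ℂ (Fin n → ℂ) Jp))

instance : Module.Finite ℂ (V n Jm Jp) :=
  inferInstanceAs (Module.Finite ℂ (Schur ℂ (Fin n → ℂ) Jm ⊗[ℂ] Schur ℂ (Fin n → ℂ) Jp))

/-- `ρ(a, b) = ρ_-(a) ⊗ ρ_+(b)` -/
def rho (a b : Matrix (Fin n) (Fin n) ℂ) : V n Jm Jp →ₗ[ℂ] V n Jm Jp :=
  TensorProduct.map (Schur.map Jm (Matrix.toLin' a)) (Schur.map Jp (Matrix.toLin' b))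

/-- `(ρ ⊗ τ^d)(a, b) h = ρ(a, b) h(ᵗa u_1 b, …, ᵗa u_d b)` -/
def rhoTau {d : ℕ} (a b : Matrix (Fin n) (Fin n) ℂ) (h : Ml n d (V n Jm Jp)) :
    Ml n d (V n Jm Jp) :=
  (rho Jm Jp a b).compMultilinearMap (h.compLinearMap fun _ => tau a b)

/-- `ρ(Ξ) f` -/
def rhoXi (f : Hn n → V n Jm Jp) : Hn n → V n Jm Jp :=
  fun z => rho Jm Jp (Xi (z : T n)).1 (Xi (z : T n)).2 (f z)

/-- Shimura's operator `D_ρ f = ρ(Ξ)⁻¹ D [ρ(Ξ) f]`, with values in `S_1(T, V) = Ml_1(T, V)`. -/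
def shimura (f : Hn n → V n Jm Jp) : Hn n → Ml n 1 (V n Jm Jp) := fun z =>
  (rho Jm Jp (Xi (z : T n)).1⁻¹ (Xi (z : T n)).2⁻¹).compMultilinearMap
    (Dop (fun w => MultilinearMap.constOfIsEmpty ℂ (fun _ : Fin 0 => T n) (rhoXi Jm Jp f w)) z)

/-- Shimura's operator `D_ρ^d f = (ρ ⊗ τ^d)(Ξ)⁻¹ C^d [ρ(Ξ) f]`. -/
def shimuraIter (d : ℕ) (f : Hn n → V n Jm Jp) : Hn n → Ml n d (V n Jm Jp) := fun z =>
  rhoTau Jm Jp (Xi (z : T n)).1⁻¹ (Xi (z : T n)).2⁻¹ (CopIter (rhoXi Jm Jp f) d z)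

/-- Stability of a subspace of `Ml_d(T, V)` under `ρ ⊗ τ^d`. -/
def IsStable {d : ℕ} (N : Submodule ℂ (Ml n d (V n Jm Jp))) : Prop :=
  ∀ a b : GL (Fin n) ℂ, ∀ h ∈ N, rhoTau Jm Jp a.1 b.1 h ∈ N

/-- Shimura's operator `D_ρ^Z = φ_Z D_ρ^d`, for the quotient `Z` of `Ml_d(T, V)` by `N`. -/
def shimuraZ {d : ℕ} (N : Submodule ℂ (Ml n d (V n Jm Jp))) (f : Hn n → V n Jm Jp) :
    Hn n → Ml n d (V n Jm Jp) ⧸ N :=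
  fun z => N.mkQ (shimuraIter Jm Jp d f z)

variable {K : Subfield ℂ} {L : AddSubgroup (E n)}

/-- The map `V → (ω^-)^{ρ_-} ⊗ (ω^+)^{ρ_+}` induced by the frame `λ = (λ^-, λ^+)`. -/
def lam (K : Subfield ℂ) (L : AddSubgroup (E n)) : V n Jm Jp →ₗ[ℂ] OmegaRho K L Jm Jp :=
  tensorBase (Schur.base (lamMinus K L) Jm) (Schur.base (lamPlus K L) Jp)

variable (h : HodgeDeRham K L)

/-- The map `Ml_d(T, V) → (ω^-)^{ρ_-} ⊗ (ω^+)^{ρ_+} ⊗ Ω^{⊗ d}` induced by the frame: the coordinate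
`u ↦ u_ij` on `T`, i.e. `e_i ⊗ e_j` under `τ ≅ ρ_st ⊗ ρ_st`, goes to `KS(λ^-(e_i) ⊗ λ^+(e_j))`. -/
def lamD (d : ℕ) : Ml n d (V n Jm Jp) →ₗ[ℂ] OmegaRhoD K L Jm Jp d :=
  ∑ I : Fin d → Fin n × Fin n,
    (((TensorProduct.mk (Cinf n) (OmegaRho K L Jm Jp) (⨂[Cinf n]^d (Om n))).flip
        (PiTensorProduct.tprod (Cinf n) fun i =>
          h.KS (lamMinus K L (Pi.single (I i).1 1) ⊗ₜ lamPlus K L (Pi.single (I i).2 1)))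
      ).restrictScalars ℂ ∘ₗ lam Jm Jp K L) ∘ₗ
    { toFun := fun g => g fun i => unitDir (I i) 1
      map_add' := fun _ _ => rfl
      map_smul' := fun _ _ => rfl }

/-- The submodule of `ω^ρ ⊗ Ω^{⊗ d}` that corresponds to a stable `N ⊆ Ml_d(T, V)`. -/
def geomN {d : ℕ} (N : Submodule ℂ (Ml n d (V n Jm Jp))) :
    Submodule (Cinf n) (OmegaRhoD K L Jm Jp d) :=
  Submodule.span (Cinf n) (lamD Jm Jp h d '' N)

/-- The geometric operator `∂(ρ, C^∞, d)^Z = φ_Z ∘ ∂(ρ, C^∞, d)`. -/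
def geomDiffZ (hKS : Function.Bijective h.KS) {d : ℕ} (N : Submodule ℂ (Ml n d (V n Jm Jp)))
    (x : OmegaRho K L Jm Jp) : OmegaRhoD K L Jm Jp d ⧸ geomN Jm Jp h N :=
  (geomN Jm Jp h N).mkQ (geomDiff h hKS Jm Jp d x)

/-- The map `Ml_d(T, V) / N → Z` induced by the frame. -/
def lamZ {d : ℕ} (N : Submodule ℂ (Ml n d (V n Jm Jp))) :
    (Ml n d (V n Jm Jp) ⧸ N) →ₗ[ℂ] OmegaRhoD K L Jm Jp d ⧸ geomN Jm Jp h N :=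
  N.liftQ (((geomN Jm Jp h N).mkQ.restrictScalars ℂ).comp (lamD Jm Jp h d)) fun g hg => by
    rw [LinearMap.mem_ker, LinearMap.comp_apply, LinearMap.restrictScalars_apply,
      Submodule.mkQ_apply, Submodule.Quotient.mk_eq_zero]
    exact Submodule.subset_span ⟨g, hg, rfl⟩

end Shimura

end UnitaryDiffOp

end

open UnitaryDiffOp

/-! In the coordinates `x` the classes of `x̄₁`, `x̄₂` in `H^-` and of `x₁`, `x₂` in `H^+` do not
depend on `z`, so Gauss–Manin differentiates coefficients with respect to them. Here `du^- = z x̄₁ +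
x̄₂`, and `Split^-` is generated by the conjugate of `du^+`, which is `z^* x̄₁ + x̄₂`; on the `+`
side the matrices are transposed. The entries of `z^*` are antiholomorphic, so every `∂/∂z_ij` kills
them and `Split` is horizontal (`gm_mem_split`). Hence the connection descends to `H / Split ≅ ω`,
and the images of `i x̄₁` and `i x₁` form a flat frame `ν` of `ω`. Modulo `Split`, `du^-` equals `(z
- z^*) x̄₁ = i η x̄₁`, so `η` and `ᵗη` express the frame `λ` through `ν`. Since `ξ = ᵗη`, this says
that `λ(f) = ν(ρ(Ξ) f)`.

Because reduction modulo `Split` is horizontal and undoes the insertion of `KS⁻¹`, the powers of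
`D^ρ` can be computed on `ω` itself (`modSplit_Drho`). There the connection is componentwise
differentiation in the flat frame, and `dz_ij = KS(du_i^- ⊗ du_j^+)` expands in the flat frame `σ`
of `Ω` with the coefficients of `τ(Ξ)`. Each application of `D^ρ` therefore becomes Shimura's `C`
(`represents_modSplit_DrhoIter`), and the return to the frame `λ` contributes `(ρ ⊗ τ^d)(Ξ)⁻¹`
(`represents_geomDiff`).

The preliminary claims are proved as follows. A closed form has a fibrewise primitive whose periods
along a real basis contained in `L` are matched by a linear functional; subtracting it leaves a
periodic function (`exists_invForm`). Liouville's theorem makes closed periodic forms of pure type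
invariant, which separates `ω` from `Split`; invertibility of `z - z^*` shows that together they
span (`isCompl_of_frames`). For the pairing, `ω^-` is orthogonal to `ω^+`, so the projection to
`Split` drops out of `KS`, and `KS` takes the generators to the `dz_ij` (`KS_bijective`).

The bookkeeping rests on the relation `Represents Λ F m`, "the section `m` is `Λ(F)`", which is
compatible with linear maps, tensor constructions, changes of frame and connections with a flat
frame. -/

noncomputable section

namespace UnitaryDiffOp

/-! ### Smooth dependence of integrals over `[0, 1]` on parameters -/

section ParametricIntegral

open MeasureTheory

variable {X : Type} [NormedAddCommGroup X] [NormedSpace ℝ X] [ProperSpace X]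

/-- Differentiation under the integral sign. A small closed ball around `x` times `[0, 1]` is
compact, so the continuous partial derivative is bounded there, and this constant is the dominating
function. -/
theorem hasFDerivAt_intervalIntegral_of_contDiffOn {W : Type} [NormedAddCommGroup W]
    [NormedSpace ℝ W] {U : Set X} (hU : IsOpen U) {f : X → ℝ → W}
    (hf : ContDiffOn ℝ 1 (fun p : X × ℝ => f p.1 p.2) (U ×ˢ Set.univ)) {x : X} (hx : x ∈ U) :
    HasFDerivAt (fun x => ∫ t in (0 : ℝ)..1, f x t)
      (∫ t in (0 : ℝ)..1, (fderiv ℝ (fun p : X × ℝ => f p.1 p.2) (x, t)).comp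
        (ContinuousLinearMap.inl ℝ X ℝ)) x := by
  have hopen : IsOpen (U ×ˢ (Set.univ : Set ℝ)) := hU.prod isOpen_univ
  obtain ⟨ε, hε, hball⟩ := Metric.isOpen_iff.1 hU x hx
  have hsub : Metric.closedBall x (ε / 2) ⊆ U :=
    (Metric.closedBall_subset_ball (by linarith)).trans hball
  have hd : ContinuousOn (fun p : X × ℝ => (fderiv ℝ (fun p : X × ℝ => f p.1 p.2) p).comp
      (ContinuousLinearMap.inl ℝ X ℝ)) (U ×ˢ Set.univ) :=
    (hf.continuousOn_fderiv_of_isOpen hopen le_rfl).clm_comp continuousOn_const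
  have hcompact : IsCompact (Metric.closedBall x (ε / 2) ×ˢ Set.Icc (0 : ℝ) 1) :=
    (isCompact_closedBall x _).prod isCompact_Icc
  obtain ⟨C, hC⟩ := hcompact.exists_bound_of_continuousOn
    (hd.mono (Set.prod_mono hsub (Set.subset_univ _)))
  have hslice : ∀ y ∈ U, Continuous (f y) := fun y hy => by
    rw [← continuousOn_univ]
    exact hf.continuousOn.comp (continuous_const.prodMk continuous_id).continuousOn
      fun t _ => ⟨hy, trivial⟩
  have hslice' : Continuous fun t => (fderiv ℝ (fun p : X × ℝ => f p.1 p.2) (x, t)).comp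
      (ContinuousLinearMap.inl ℝ X ℝ) := by
    rw [← continuousOn_univ]
    exact hd.comp (continuous_const.prodMk continuous_id).continuousOn fun t _ => ⟨hx, trivial⟩
  refine intervalIntegral.hasFDerivAt_integral_of_dominated_of_fderiv_le
    (F' := fun y t => (fderiv ℝ (fun p : X × ℝ => f p.1 p.2) (y, t)).comp
      (ContinuousLinearMap.inl ℝ X ℝ)) (bound := fun _ => C)
    (Metric.closedBall_mem_nhds x (half_pos hε)) ?_ ?_ ?_ ?_ ?_ ?_
  · filter_upwards [hU.mem_nhds hx] with y hy
    exact (hslice y hy).aestronglyMeasurable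
  · exact (hslice x hx).intervalIntegrable _ _
  · exact hslice'.aestronglyMeasurable
  · refine Filter.Eventually.of_forall fun t ht y hy => hC (y, t) ⟨hy, ?_⟩
    rw [Set.uIoc_of_le zero_le_one] at ht
    exact Set.Ioc_subset_Icc_self ht
  · exact intervalIntegrable_const
  · refine Filter.Eventually.of_forall fun t _ y hy => ?_
    have h1 := ((hf.contDiffAt (hopen.mem_nhds ⟨hsub hy, trivial⟩ :
      U ×ˢ Set.univ ∈ nhds (y, t))).differentiableAt (by simp)).hasFDerivAt
    exact HasFDerivAt.comp (f := fun y' : X => (y', t)) y h1 (hasFDerivAt_prodMk_left y t)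

/-- Induction on `m`: the derivative of the integral is again such an integral, of a smooth family
with values in `X →L[ℝ] W`. For this reason `W` and `f` vary inside the induction. -/
theorem contDiffOn_nat_intervalIntegral (m : ℕ) : ∀ {W : Type} [NormedAddCommGroup W]
    [NormedSpace ℝ W] {U : Set X}, IsOpen U → ∀ {f : X → ℝ → W},
    ContDiffOn ℝ ∞ (fun p : X × ℝ => f p.1 p.2) (U ×ˢ Set.univ) →
    ContDiffOn ℝ m (fun x => ∫ t in (0 : ℝ)..1, f x t) U := by
  have hdiff : ∀ {W : Type} [NormedAddCommGroup W]
    [NormedSpace ℝ W] {U : Set X}, IsOpen U → ∀ {f : X → ℝ → W},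
    ContDiffOn ℝ ∞ (fun p : X × ℝ => f p.1 p.2) (U ×ˢ Set.univ) →
    DifferentiableOn ℝ (fun x => ∫ t in (0 : ℝ)..1, f x t) U := fun hU f hf x hx =>
    (hasFDerivAt_intervalIntegral_of_contDiffOn hU
      (hf.of_le (by exact_mod_cast le_top)) hx).differentiableAt.differentiableWithinAt
  induction m with
  | zero =>
    intro W _ _ U hU f hf
    exact contDiffOn_zero.2 (hdiff hU hf).continuousOn
  | succ m ih =>
    intro W _ _ U hU f hf
    push_cast
    refine (contDiffOn_succ_iff_fderiv_of_isOpen hU).2 ⟨hdiff hU hf, by simp, ?_⟩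
    have h1 : ContDiffOn ℝ ∞ (fun p : X × ℝ => (fderiv ℝ (fun p : X × ℝ => f p.1 p.2) p).comp
        (ContinuousLinearMap.inl ℝ X ℝ)) (U ×ˢ Set.univ) :=
      (hf.fderiv_of_isOpen (hU.prod isOpen_univ) (m := ∞) (by simp)).clm_comp contDiffOn_const
    refine (ih hU (f := fun x t => (fderiv ℝ (fun p : X × ℝ => f p.1 p.2) (x, t)).comp
        (ContinuousLinearMap.inl ℝ X ℝ)) h1).congr fun x hx => ?_
    exact (hasFDerivAt_intervalIntegral_of_contDiffOn hU
      (hf.of_le (by exact_mod_cast le_top)) hx).fderiv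

/-- The integral over `[0, 1]` of a family that is smooth in the parameter and in the variable of
integration depends smoothly on the parameter. -/
theorem contDiffOn_intervalIntegral {W : Type} [NormedAddCommGroup W]
    [NormedSpace ℝ W] {U : Set X} (hU : IsOpen U) {f : X → ℝ → W}
    (hf : ContDiffOn ℝ ∞ (fun p : X × ℝ => f p.1 p.2) (U ×ˢ Set.univ)) :
    ContDiffOn ℝ ∞ (fun x => ∫ t in (0 : ℝ)..1, f x t) U :=
  contDiffOn_infty.2 fun m => contDiffOn_nat_intervalIntegral m hU hf

end ParametricIntegral

/-! ### Fibrewise primitives of closed forms -/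

section Primitive

variable {n : ℕ}

/-- The primitive of a family of forms that vanishes on the zero section. -/
def primitive (η : Form n) : Hn n → E n → ℂ :=
  fun z x => ∫ t in (0 : ℝ)..1, η z (t • x) x

theorem relSmooth_primitive {η : Form n} (hη : RelSmooth η) : RelSmooth (primitive η) := by
  have h1 : ContDiffOn ℝ ∞ (fun p : (T n × E n) × ℝ => ext η p.1.1 (p.2 • p.1.2) p.1.2)
      ((halfSpace n ×ˢ Set.univ) ×ˢ Set.univ) := by
    have h2 : ContDiffOn ℝ ∞ (fun p : (T n × E n) × ℝ => ext η p.1.1 (p.2 • p.1.2))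
        ((halfSpace n ×ˢ Set.univ) ×ˢ Set.univ) :=
      ContDiffOn.comp (g := fun p : T n × E n => ext η p.1 p.2)
        (f := fun p : (T n × E n) × ℝ => (p.1.1, p.2 • p.1.2)) hη
        (ContDiff.contDiffOn (by fun_prop)) fun p hp => ⟨hp.1.1, trivial⟩
    exact h2.clm_apply (ContDiff.contDiffOn (by fun_prop))
  refine (contDiffOn_intervalIntegral isOpen_total
    (f := fun p t => ext η p.1 (t • p.2) p.2) h1).congr ?_
  rintro ⟨z, x⟩ ⟨hz, _⟩
  simp [ext, show z ∈ halfSpace n from hz, primitive]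

/-- The Poincaré lemma on the convex set `E n`: the integral is the curve integral along the segment
from `0` to `x`, and closedness is symmetry of the derivative. -/
theorem hasFDerivAt_primitive {η : Form n} (hη : RelSmooth η)
    (hc : ∀ z x v w, fderiv ℝ (η z) x v w = fderiv ℝ (η z) x w v) (z : Hn n) (x : E n) :
    HasFDerivAt (primitive η z) (η z x) x := by
  have h := Convex.hasFDerivWithinAt_curveIntegral_segment_of_hasFDerivWithinAt_symmetric (𝕜 := ℝ)
    (a := 0) (b := x) convex_univ
    (fun y _ => (((hη.fibre z).differentiable (by simp) y).hasFDerivAt :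
      HasFDerivAt (η z) (fderiv ℝ (η z) y) y).hasFDerivWithinAt)
    (fun a _ v _ w _ => hc z a v w) trivial trivial
  rw [hasFDerivWithinAt_univ] at h
  have e : (fun y => curveIntegral (η z) (Path.segment 0 y)) = primitive η z := by
    funext y
    rw [curveIntegral_segment]
    simp [primitive, AffineMap.lineMap_apply]
  rw [← e]
  exact h

end Primitive

/-! ### Real bases contained in the lattice -/

section Lattice

open Module

variable {n : ℕ} {K : Subfield ℂ} {L : AddSubgroup (E n)}

/-- For a nonreal `w ∈ K` the pair `1, w` is at once a `ℚ`-basis of `K` and an `ℝ`-basis of `ℂ`, so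
the real coordinates of elements of `K` are rational. -/
theorem IsImagQuadratic.exists_basis (hK : IsImagQuadratic K) :
    ∃ c : Basis (Fin 2) ℝ ℂ, (∀ i, c i ∈ K) ∧ ∀ a ∈ K, ∀ i, ∃ q : ℚ, c.repr a i = q := by
  obtain ⟨w, hwK, hw⟩ := hK.not_real
  have hli : LinearIndependent ℝ ![(1 : ℂ), w] := by
    rw [LinearIndependent.pair_iff]
    intro s t h
    have h1 := congrArg Complex.im h
    have h2 := congrArg Complex.re h
    simp [hw] at h1
    subst h1
    simpa using h2
  let c := basisOfLinearIndependentOfCardEqFinrank hli (by simp)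
  have hc : ∀ i, c i = ![(1 : ℂ), w] i := fun i => by simp [c]
  have hQ : LinearIndependent ℚ ![(1 : K), ⟨w, hwK⟩] := by
    rw [LinearIndependent.pair_iff]
    intro s t h
    have h0 : (s : ℂ) + t * w = 0 := by
      have := congrArg (Subtype.val : K → ℂ) h
      simpa [Rat.smul_def] using this
    have h1 := congrArg Complex.im h0
    simp [hw] at h1
    subst h1
    simpa using h0
  let cQ := basisOfLinearIndependentOfCardEqFinrank hQ (by simp [hK.finrank_eq])
  refine ⟨c, fun i => ?_, fun a ha i => ⟨cQ.repr ⟨a, ha⟩ i, ?_⟩⟩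
  · rw [hc]
    fin_cases i
    · exact K.one_mem
    · exact hwK
  · have h1 := cQ.sum_repr ⟨a, ha⟩
    have h2 : a = ∑ j, ((cQ.repr ⟨a, ha⟩ j : ℚ) : ℝ) • c j := by
      have := congrArg (Subtype.val : K → ℂ) h1
      refine this.symm.trans ?_
      simp only [Fin.sum_univ_two, hc]
      simp [cQ, Rat.smul_def]
    conv_lhs => rw [h2]
    rw [c.repr_sum_self]

/-- The standard `K`-rational basis is scaled into `L` by integers `m i`. Vectors of `L` have
rational coordinates in it, and clearing denominators puts a multiple of each of them in the
subgroup generated by the basis. -/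
theorem IsLattice.exists_basis (hK : IsImagQuadratic K) (hL : IsLattice K L) :
    ∃ (ι : Type) (_ : Fintype ι) (b : Basis ι ℝ (E n)), (∀ i, b i ∈ L) ∧
      ∀ l ∈ L, ∃ N : ℕ, N ≠ 0 ∧ N • l ∈ AddSubgroup.closure (Set.range b) := by
  classical
  obtain ⟨c, hc, hcQ⟩ := hK.exists_basis
  let b₀ : Basis ((Σ _ : Fin n, Fin 2) ⊕ (Σ _ : Fin n, Fin 2)) ℝ (E n) :=
    (Pi.basis fun _ : Fin n => c).prod (Pi.basis fun _ : Fin n => c)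
  have hs : ∀ (j : Fin n) (k : Fin 2) (i : Fin n), (Pi.single j (c k) : Fin n → ℂ) i ∈ K := by
    intro j k i
    by_cases h : i = j
    · subst h; simpa using hc k
    · simp [Pi.single_eq_of_ne h]
  have hb₀ : ∀ i, ∃ m : ℕ, m ≠ 0 ∧ m • b₀ i ∈ L := by
    intro i
    refine hL.full _ (fun j => ?_) (fun j => ?_)
    · rcases i with i | i
      · simpa [b₀] using hs i.1 i.2 j
      · simp [b₀]
    · rcases i with i | i
      · simp [b₀]
      · simpa [b₀] using hs i.1 i.2 j
  have hq₀ : ∀ l ∈ L, ∀ i, ∃ q : ℚ, b₀.repr l i = q := by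
    intro l hl i
    rcases i with i | i
    · simpa [b₀, Pi.basis_repr] using hcQ _ ((hL.coord_mem l hl).1 i.1) i.2
    · simpa [b₀, Pi.basis_repr] using hcQ _ ((hL.coord_mem l hl).2 i.1) i.2
  choose m hm hmL using hb₀
  have hu : ∀ i, IsUnit ((m i : ℝ)) := fun i => by simpa using hm i
  let b := b₀.isUnitSMul hu
  have hb : ∀ i, b i = m i • b₀ i := fun i => by
    rw [Basis.isUnitSMul_apply, Nat.cast_smul_eq_nsmul]
  refine ⟨_, inferInstance, b, fun i => by rw [hb]; exact hmL i, fun l hl => ?_⟩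
  choose q hq using hq₀ l hl
  -- The coordinates of `l` in the rescaled basis are `q i / m i`; the product of their denominators
  -- is a common denominator.
  refine ⟨∏ i, (q i / m i).den, Finset.prod_ne_zero_iff.2 fun i _ => (q i / m i).den_nz, ?_⟩
  have h1 : l = ∑ i, ((q i / m i : ℚ) : ℝ) • b i := by
    conv_lhs => rw [← b₀.sum_repr l]
    refine Finset.sum_congr rfl fun i _ => ?_
    rw [hb, hq, ← Nat.cast_smul_eq_nsmul ℝ, smul_smul]
    have : (m i : ℝ) ≠ 0 := by simpa using hm i
    push_cast
    rw [div_mul_cancel₀ _ this]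
  conv =>
    enter [2]
    rw [h1]
  rw [Finset.smul_sum]
  refine sum_mem fun i _ => ?_
  obtain ⟨k, hk⟩ := Finset.dvd_prod_of_mem (fun i => (q i / m i).den) (Finset.mem_univ i)
  have h2 : (∏ i, (q i / m i).den) • ((q i / m i : ℚ) : ℝ) • b i =
      ((q i / m i).num * (k : ℤ)) • b i := by
    rw [hk, ← Nat.cast_smul_eq_nsmul ℝ, ← Int.cast_smul_eq_zsmul ℝ, smul_smul]
    congr 1
    have h3 : (((q i / m i).den : ℚ) * (q i / m i)) = (q i / m i).num := Rat.den_mul_eq_num _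
    have h4 : (((q i / m i).den : ℝ) * ((q i / m i : ℚ) : ℝ)) = ((q i / m i).num : ℝ) := by
      exact_mod_cast h3
    push_cast at h4 ⊢
    linear_combination (k : ℝ) * h4
  rw [h2]
  exact zsmul_mem (AddSubgroup.subset_closure (Set.mem_range_self i)) _

/-- An additive function on `L` that vanishes on `b` vanishes, if `L` is contained in the
`ℚ`-span of `b`. -/
theorem addHom_eq_zero {ι : Type} {b : ι → E n} (hb : ∀ i, b i ∈ L)
    (hbL : ∀ l ∈ L, ∃ N : ℕ, N ≠ 0 ∧ N • l ∈ AddSubgroup.closure (Set.range b))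
    (G : L →+ ℂ) (hG : ∀ i, G ⟨b i, hb i⟩ = 0) : G = 0 := by
  ext ⟨l, hl⟩
  obtain ⟨N, hN, h⟩ := hbL l hl
  have hle : AddSubgroup.closure (Set.range b) ≤ G.ker.map L.subtype := by
    rw [AddSubgroup.closure_le]
    rintro _ ⟨i, rfl⟩
    exact ⟨⟨b i, hb i⟩, hG i, rfl⟩
  obtain ⟨y, hy, hyl⟩ := hle h
  have h1 : y = N • (⟨l, hl⟩ : L) := Subtype.ext hyl
  subst h1
  have h2 : G (N • (⟨l, hl⟩ : L)) = 0 := hy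
  rw [map_nsmul] at h2
  simpa [hN] using h2

/-- Every value is taken on the fundamental domain of the `ℤ`-span of `b`, a subgroup of `L`, and
the closure of this domain is compact. -/
theorem isBounded_range_of_periodic {W : Type} [NormedAddCommGroup W] {ι : Type} [Fintype ι]
    (b : Basis ι ℝ (E n)) (hb : ∀ i, b i ∈ L) {F : E n → W} (hF : Continuous F)
    (hp : ∀ l ∈ L, ∀ x, F (x + l) = F x) : Bornology.IsBounded (Set.range F) := by
  have h1 : IsCompact (closure (ZSpan.fundamentalDomain b)) :=
    (ZSpan.fundamentalDomain_isBounded b).isCompact_closure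
  refine (h1.image hF).isBounded.subset ?_
  rintro _ ⟨x, rfl⟩
  refine ⟨ZSpan.fract b x, subset_closure (ZSpan.fract_mem_fundamentalDomain b x), ?_⟩
  have h2 : (ZSpan.floor b x : E n) ∈ L := by
    have h3 : Submodule.span ℤ (Set.range b) ≤ AddSubgroup.toIntSubmodule L := by
      rw [Submodule.span_le]
      rintro _ ⟨i, rfl⟩
      exact hb i
    exact h3 (ZSpan.floor b x).2
  conv_rhs => rw [← sub_add_cancel x (ZSpan.floor b x : E n), ← ZSpan.fract_apply]
  exact (hp _ h2 _).symm

end Lattice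

/-! ### The complex structure on the fibres and Liouville's theorem -/

section Fibre

open Module

variable {n : ℕ} {L : AddSubgroup (E n)}

theorem star_transpose_mulVec (z : T n) (v : Fin n → ℂ) :
    star ((Matrix.of z)ᵀ *ᵥ v) = (Matrix.of z)ᴴ *ᵥ star v := by
  rw [Matrix.star_mulVec, Matrix.conjTranspose, Matrix.conjTranspose, Matrix.transpose_transpose,
    ← Matrix.vecMul_transpose]
  congr 1

/-- If both components vanish, then `z x̄₁ = -x̄₂` and, after conjugation of the second, `z^* x̄₁ =
-x̄₂`. The difference is `i (z^* - z) x̄₁ = 0` up to a scalar, and positivity gives `x₁ = 0`, hence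
`x₂ = 0`. -/
theorem pz_injective (z : Hn n) : Function.Injective (pz (z : T n)) := by
  rw [injective_iff_map_eq_zero]
  intro x hx
  rw [pz_apply] at hx
  have h1 := congrArg Prod.fst hx
  have h2 := congrArg star (congrArg Prod.snd hx)
  simp only [star_add, star_transpose_mulVec, Prod.fst_zero, Prod.snd_zero, star_zero] at h1 h2
  have h3 : imForm (z : T n) *ᵥ star x.1 = 0 := by
    rw [imForm, Matrix.smul_mulVec, Matrix.sub_mulVec, eq_neg_of_add_eq_zero_left h1,
      eq_neg_of_add_eq_zero_left h2, sub_self, smul_zero]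
  have hz : (imForm (z : T n)).PosDef := z.2
  have h4 : star x.1 = 0 := Matrix.eq_zero_of_mulVec_eq_zero hz.det_pos.ne' h3
  rw [h4, Matrix.mulVec_zero, zero_add] at h1
  exact Prod.ext (star_eq_zero.1 h4) (star_eq_zero.1 h1)

/-- `p_z` as an isomorphism of real vector spaces. -/
def pzEquiv (z : Hn n) : E n ≃L[ℝ] E n :=
  (LinearEquiv.ofInjectiveEndo (pz (z : T n)).toLinearMap (pz_injective z)).toContinuousLinearEquiv

theorem pzEquiv_apply (z : Hn n) (x : E n) : pzEquiv z x = pz (z : T n) x := rfl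

/-- Type `(1, 0)` is used below only through this identity, which no longer involves the functional
`l`; this matters where the functional varies with the point and `l` is not chosen smoothly. -/
theorem IsType10.symm_I_smul {z : Hn n} {φ : E n →L[ℝ] ℂ} (h : IsType10 (z : T n) φ) (v : E n) :
    φ ((pzEquiv z).symm (Complex.I • v)) = Complex.I * φ ((pzEquiv z).symm v) := by
  obtain ⟨l, hl⟩ := h
  rw [hl, hl, ← pzEquiv_apply, ← pzEquiv_apply, ContinuousLinearEquiv.apply_symm_apply,
    ContinuousLinearEquiv.apply_symm_apply, map_smul, smul_eq_mul]

theorem IsType01.symm_I_smul {z : Hn n} {φ : E n →L[ℝ] ℂ} (h : IsType01 (z : T n) φ) (v : E n) :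
    φ ((pzEquiv z).symm (Complex.I • v)) = -Complex.I * φ ((pzEquiv z).symm v) := by
  obtain ⟨l, hl⟩ := h
  rw [hl, hl, ← pzEquiv_apply, ← pzEquiv_apply, ContinuousLinearEquiv.apply_symm_apply,
    ContinuousLinearEquiv.apply_symm_apply, map_smul, smul_eq_mul, map_mul, Complex.conj_I]

/-- Multiplication by `I` would act on the values both through `I` and through `-I`. -/
theorem eq_zero_of_isType10_of_isType01 {z : Hn n} {φ : E n →L[ℝ] ℂ} (h : IsType10 (z : T n) φ)
    (h' : IsType01 (z : T n) φ) : φ = 0 := by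
  refine ContinuousLinearMap.ext fun x => ?_
  have h1 := h.symm_I_smul (pzEquiv z x)
  rw [h'.symm_I_smul, ContinuousLinearEquiv.symm_apply_apply, neg_mul, neg_eq_self] at h1
  simpa using h1

/-- A real linear map that commutes with multiplication by `I` at the points of the derivative is
the derivative of a holomorphic map. -/
theorem differentiableAt_complex_of_fderiv_I {F : E n → ℂ} {x : E n} (hF : DifferentiableAt ℝ F x)
    (h : ∀ w, fderiv ℝ F x (Complex.I • w) = Complex.I * fderiv ℝ F x w) :
    DifferentiableAt ℂ F x := by
  refine (differentiableAt_iff_restrictScalars ℝ hF).2 ⟨⟨⟨⟨fderiv ℝ F x, map_add _⟩, ?_⟩,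
    (fderiv ℝ F x).continuous⟩, rfl⟩
  intro c w
  change fderiv ℝ F x (c • w) = c * fderiv ℝ F x w
  have hc : c • w = c.re • w + c.im • Complex.I • w := by
    conv_lhs => rw [← Complex.re_add_im c, add_smul, mul_smul]
    rw [Complex.coe_smul, Complex.coe_smul]
  rw [hc, map_add, map_smul, map_smul, h]
  conv_rhs => rw [← Complex.re_add_im c]
  rw [Complex.real_smul, Complex.real_smul]
  ring

/-- A closed periodic form of type `(1, 0)` is invariant under translations. -/
theorem IsType10.const_of_closed {ι : Type} [Fintype ι] (b : Basis ι ℝ (E n)) (hb : ∀ i, b i ∈ L)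
    {z : Hn n} {θ : E n → (E n →L[ℝ] ℂ)} (hd : Differentiable ℝ θ)
    (hp : ∀ l ∈ L, ∀ x, θ (x + l) = θ x)
    (hc : ∀ x v w, fderiv ℝ θ x v w = fderiv ℝ θ x w v) (ht : ∀ x, IsType10 (z : T n) (θ x))
    (x y : E n) : θ x = θ y := by
  set P := pzEquiv z
  -- The type condition holds at every point, so it passes to the derivative of `θ` in any direction
  -- `w`: the derivative is complex linear in the slot of the form.
  have key : ∀ x v w, fderiv ℝ θ x w (P.symm (Complex.I • v)) =
      Complex.I * fderiv ℝ θ x w (P.symm v) := by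
    intro x v w
    have e1 : ∀ u, HasFDerivAt (fun x => θ x u)
        ((ContinuousLinearMap.apply ℝ ℂ u).comp (fderiv ℝ θ x)) x := fun u =>
      (ContinuousLinearMap.apply ℝ ℂ u).hasFDerivAt.comp x (hd x).hasFDerivAt
    have e2 := (e1 (P.symm v)).const_smul Complex.I
    have e3 : (fun x => θ x (P.symm (Complex.I • v))) = Complex.I • fun x => θ x (P.symm v) := by
      funext x
      exact (ht x).symm_I_smul v
    have e4 := e1 (P.symm (Complex.I • v))
    rw [e3] at e4
    exact congrArg (fun B : E n →L[ℝ] ℂ => B w) (e4.unique e2)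
  have hF : ∀ u y, HasFDerivAt (fun y => θ (P.symm y) u)
      ((ContinuousLinearMap.apply ℝ ℂ u).comp
        ((fderiv ℝ θ (P.symm y)).comp (P.symm : E n →L[ℝ] E n))) y := fun u y =>
    (ContinuousLinearMap.apply ℝ ℂ u).hasFDerivAt.comp y
      ((hd (P.symm y)).hasFDerivAt.comp y (P.symm : E n →L[ℝ] E n).hasFDerivAt)
  refine ContinuousLinearMap.ext fun u => ?_
  obtain ⟨v, rfl⟩ := P.symm.surjective u
  -- Closedness exchanges the direction of differentiation with the slot of the form. Linearity over
  -- `ℂ` in the slot thus becomes the Cauchy–Riemann equations for the coefficients.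
  have hhol : Differentiable ℂ fun y => θ (P.symm y) (P.symm v) := fun y => by
    refine differentiableAt_complex_of_fderiv_I (hF _ y).differentiableAt fun w => ?_
    rw [(hF _ y).fderiv]
    change fderiv ℝ θ (P.symm y) (P.symm (Complex.I • w)) (P.symm v) =
      Complex.I * fderiv ℝ θ (P.symm y) (P.symm w) (P.symm v)
    rw [hc, key, hc]
  -- Periodic coefficients are bounded, so Liouville's theorem applies to these entire functions.
  have hbd : Bornology.IsBounded (Set.range fun y => θ (P.symm y) (P.symm v)) := by
    refine (isBounded_range_of_periodic b hb (F := fun x => θ x (P.symm v))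
      (hd.continuous.clm_apply continuous_const) fun l hl x => by rw [hp l hl]).subset ?_
    rintro _ ⟨y, rfl⟩
    exact ⟨P.symm y, rfl⟩
  have := hhol.apply_eq_apply_of_bounded hbd (P x) (P y)
  simpa using this

theorem IsType01.conj {z : T n} {φ : E n →L[ℝ] ℂ} (h : IsType01 z φ) :
    IsType10 z (conjL.comp φ) := by
  obtain ⟨l, hl⟩ := h
  refine ⟨l, fun x => ?_⟩
  simp [hl, conjL]

theorem IsType10.conj {z : T n} {φ : E n →L[ℝ] ℂ} (h : IsType10 z φ) :
    IsType01 z (conjL.comp φ) := by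
  obtain ⟨l, hl⟩ := h
  refine ⟨l, fun x => ?_⟩
  simp [hl, conjL]

/-- A closed periodic form of type `(0, 1)` is invariant under translations. -/
theorem IsType01.const_of_closed {ι : Type} [Fintype ι] (b : Basis ι ℝ (E n)) (hb : ∀ i, b i ∈ L)
    {z : Hn n} {θ : E n → (E n →L[ℝ] ℂ)} (hd : Differentiable ℝ θ)
    (hp : ∀ l ∈ L, ∀ x, θ (x + l) = θ x)
    (hc : ∀ x v w, fderiv ℝ θ x v w = fderiv ℝ θ x w v) (ht : ∀ x, IsType01 (z : T n) (θ x))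
    (x y : E n) : θ x = θ y := by
  -- Conjugation preserves closedness and periodicity and exchanges the types, so the `(1, 0)` case
  -- suffices.
  have hD : ∀ x, HasFDerivAt (fun x => conjL.comp (θ x))
      ((ContinuousLinearMap.compL ℝ (E n) ℂ ℂ conjL).comp (fderiv ℝ θ x)) x := fun x =>
    (ContinuousLinearMap.compL ℝ (E n) ℂ ℂ conjL).hasFDerivAt.comp x (hd x).hasFDerivAt
  have h := IsType10.const_of_closed b hb (θ := fun x => conjL.comp (θ x))
    (fun x => (hD x).differentiableAt) (fun l hl x => by rw [hp l hl])
    (fun x v w => by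
      rw [(hD x).fderiv]
      exact congrArg conjL (hc x v w)) (fun x => (ht x).conj) x y
  refine ContinuousLinearMap.ext fun v => ?_
  have h1 := congrArg (fun B : E n →L[ℝ] ℂ => B v) h
  exact (starRingEnd ℂ).injective h1

end Fibre

/-! ### Invariant representatives of de Rham classes -/

section DeRham

open Module

variable {n : ℕ} {L : AddSubgroup (E n)}

theorem IsSmooth.relSmooth {W : Type} [NormedAddCommGroup W] [NormedSpace ℝ W] {Φ : Hn n → W}
    (h : IsSmooth Φ) : RelSmooth (fun z (_ : E n) => Φ z) := by
  have h1 : ContDiffOn ℝ ∞ (fun p : T n × E n => ext Φ p.1) (halfSpace n ×ˢ Set.univ) :=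
    ContDiffOn.comp (g := ext Φ) (f := Prod.fst) h contDiff_fst.contDiffOn fun _ hp => hp.1
  refine h1.congr ?_
  rintro ⟨z, x⟩ ⟨hz, _⟩
  simp [ext, show z ∈ halfSpace n from hz]

/-- The translation-invariant form given by a smooth family of real linear functionals. -/
def invForm (L : AddSubgroup (E n)) (Φ : Hn n → (E n →L[ℝ] ℂ)) (h : IsSmooth Φ) :
    ↥(closedForms L) :=
  ⟨fun z _ => Φ z, h.relSmooth, fun _ _ _ _ => rfl, fun z x v w => by
    have : fderiv ℝ (fun _ : E n => Φ z) x = 0 := fderiv_const_apply _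
    exact (congrArg (fun B : E n →L[ℝ] (E n →L[ℝ] ℂ) => B v w) this).trans
      (congrArg (fun B : E n →L[ℝ] (E n →L[ℝ] ℂ) => B w v) this).symm⟩

theorem invForm_mem (Φ : Hn n → (E n →L[ℝ] ℂ)) (h : IsSmooth Φ) : invForm L Φ h ∈ invForms L :=
  fun _ _ _ => rfl

theorem cls_eq_iff {η θ : ↥(closedForms L)} :
    cls L η = cls L θ ↔ ∃ g : Hn n → E n → ℂ, RelSmooth g ∧ Periodic L g ∧
      (η.1 - θ.1 : Form n) = vert g :=
  Submodule.Quotient.eq ((exactForms L).submoduleOf (closedForms L))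

theorem apply_eq_of_hasFDerivAt_const {g : E n → ℂ} {A : E n →L[ℝ] ℂ}
    (h : ∀ x, HasFDerivAt g A x) (x : E n) : g x = A x + g 0 := by
  have hd : ∀ x, HasFDerivAt (fun x => g x - A x) (0 : E n →L[ℝ] ℂ) x := fun x => by
    have := (h x).sub A.hasFDerivAt
    rwa [sub_self] at this
  have h1 := is_const_of_fderiv_eq_zero (𝕜 := ℝ) (f := fun x => g x - A x)
    (fun x => (hd x).differentiableAt) (fun x => (hd x).fderiv) x 0
  simp only [map_zero, sub_zero] at h1
  rw [← h1]; ring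

/-- A primitive of an invariant form is affine on each fibre. If it is periodic, its linear part
vanishes on the `b i ∈ L`, which span `E n` over `ℝ`. -/
theorem invCls_injective {ι : Type} [Fintype ι] (b : Basis ι ℝ (E n)) (hb : ∀ i, b i ∈ L) :
    Function.Injective (invCls L) := by
  rw [injective_iff_map_eq_zero]
  intro η hη
  obtain ⟨g, hg, hp, h⟩ := cls_eq_iff.1 (hη.trans (map_zero (cls L)).symm :
    cls L η.1 = cls L 0)
  refine Subtype.ext (Subtype.ext (funext fun z => funext fun x => ?_))
  have hv : ∀ y, HasFDerivAt (g z) (η.1.1 z x) y := fun y => by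
    have h1 : vert g z y = η.1.1 z x := by
      rw [← h]
      exact (sub_zero _).trans (η.2 z y x)
    rw [← h1]
    exact ((hg.fibre z).differentiable (by simp) y).hasFDerivAt
  have h2 := apply_eq_of_hasFDerivAt_const hv
  have h3 : (η.1.1 z x : E n →ₗ[ℝ] ℂ) = 0 := by
    refine b.ext fun i => ?_
    have h4 := h2 (0 + b i)
    rw [hp _ (hb i), zero_add] at h4
    exact right_eq_add.1 h4
  exact ContinuousLinearMap.coe_injective h3

theorem isSmooth_sum {W ι : Type} [NormedAddCommGroup W] [NormedSpace ℝ W] (s : Finset ι)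
    {f : ι → Hn n → W} (hf : ∀ i ∈ s, IsSmooth (f i)) : IsSmooth (fun z => ∑ i ∈ s, f i z) := by
  classical
  induction s using Finset.induction_on with
  | empty => simpa using isSmooth_const (0 : W)
  | insert a s ha ih =>
    simp only [Finset.sum_insert ha]
    exact (hf a (Finset.mem_insert_self _ _)).add
      (ih fun i hi => hf i (Finset.mem_insert_of_mem hi))

/-- Every de Rham class is represented by an invariant form. -/
theorem exists_invForm {ι : Type} [Fintype ι] (b : Basis ι ℝ (E n)) (hb : ∀ i, b i ∈ L)
    (hbL : ∀ l ∈ L, ∃ N : ℕ, N ≠ 0 ∧ N • l ∈ AddSubgroup.closure (Set.range b))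
    (η : ↥(closedForms L)) :
    ∃ (Φ : Hn n → (E n →L[ℝ] ℂ)) (h : IsSmooth Φ), cls L η = cls L (invForm L Φ h) := by
  classical
  obtain ⟨hη, hper, hc⟩ := η.2
  have hg₀ := relSmooth_primitive hη
  let r : ι → (E n →L[ℝ] ℂ) := fun i =>
    Complex.ofRealCLM.comp (LinearMap.toContinuousLinearMap (b.coord i))
  -- The real linear functional on the fibre that has the same values as the primitive on the basis,
  -- that is, the same periods along the `b i`.
  let Φ : Hn n → (E n →L[ℝ] ℂ) := fun z => ∑ i, primitive η.1 z (b i) • r i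
  have hΦ : IsSmooth Φ :=
    isSmooth_sum _ fun i _ => (hg₀.base (b i)).smul (isSmooth_const (r i))
  have hΦb : ∀ z j, Φ z (b j) = primitive η.1 z (b j) := by
    intro z j
    simp [Φ, r, Finsupp.single_apply, apply_ite]
  let g : Hn n → E n → ℂ := fun z x => primitive η.1 z x - Φ z x
  have hgs : RelSmooth g := by
    have h1 : RelSmooth (fun z x => Φ z x) := by
      refine ((hΦ.relSmooth).clm_apply contDiff_snd.contDiffOn).congr ?_
      rintro ⟨z, x⟩ ⟨hz, _⟩
      simp [ext, show z ∈ halfSpace n from hz]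
    refine (ContDiffOn.sub hg₀ h1).congr ?_
    rintro ⟨z, x⟩ ⟨hz, _⟩
    simp [ext, show z ∈ halfSpace n from hz, g]
  have hgd : ∀ z x, HasFDerivAt (g z) (η.1 z x - Φ z) x := fun z x =>
    (hasFDerivAt_primitive hη hc z x).sub (Φ z).hasFDerivAt
  have hg0 : ∀ z, g z 0 = 0 := fun z => by simp [g, primitive]
  -- The increment `g z (x + l) - g z x` has derivative zero because the form is periodic and `Φ` is
  -- constant in `x`; its value is read off at `x = 0`, where `g` vanishes.
  have hadd : ∀ z, ∀ l ∈ L, ∀ x, g z (x + l) = g z x + g z l := by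
    intro z l hl x
    have hd : ∀ x, HasFDerivAt (fun x => g z (x + l) - g z x) (0 : E n →L[ℝ] ℂ) x := by
      intro x
      have h1 := ((hgd z (x + l)).comp x ((hasFDerivAt_id x).add_const l)).sub (hgd z x)
      rwa [hper l hl z x, ContinuousLinearMap.comp_id, sub_self] at h1
    have h2 := apply_eq_of_hasFDerivAt_const hd x
    simp only [zero_add, hg0, sub_zero, zero_apply] at h2
    rw [← h2]; ring
  have hgL : ∀ z, ∀ l ∈ L, g z l = 0 := by
    intro z l hl
    -- On `L` the function `g z` is additive, and it vanishes on the `b i` by the choice of `Φ`.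
    -- Some nonzero multiple of each element of `L` is an integral combination of them, so it
    -- vanishes on `L`, and `g` is periodic.
    let G : L →+ ℂ := AddMonoidHom.mk' (fun l => g z l) fun a c => hadd z c c.2 a
    have hG : G = 0 := addHom_eq_zero hb hbL G fun i => by
      change primitive η.1 z (b i) - Φ z (b i) = 0
      rw [hΦb, sub_self]
    exact congrArg (fun G : L →+ ℂ => G ⟨l, hl⟩) hG
  refine ⟨Φ, hΦ, cls_eq_iff.2 ⟨g, hgs, fun l hl z x => by rw [hadd z l hl, hgL z l hl, add_zero],
    ?_⟩⟩
  funext z x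
  exact (hgd z x).fderiv.symm

theorem invCls_bijective {ι : Type} [Fintype ι] (b : Basis ι ℝ (E n)) (hb : ∀ i, b i ∈ L)
    (hbL : ∀ l ∈ L, ∃ N : ℕ, N ≠ 0 ∧ N • l ∈ AddSubgroup.closure (Set.range b)) :
    Function.Bijective (invCls L) := by
  refine ⟨invCls_injective b hb, fun h => ?_⟩
  obtain ⟨η, rfl⟩ := cls_surjective L h
  obtain ⟨Φ, hΦ, e⟩ := exists_invForm b hb hbL η
  exact ⟨⟨invForm L Φ hΦ, invForm_mem Φ hΦ⟩, e.symm⟩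

end DeRham

/-! ### Horizontal maps and flat sections -/

section HorizontalMaps

variable {R : Type} [CommRing R] [Algebra ℂ R] {ι : Type} {del : ι → Derivation ℂ R R}
  {M N M' N' : Type} [AddCommGroup M] [Module R M] [AddCommGroup N] [Module R N]
  [AddCommGroup M'] [Module R M'] [AddCommGroup N'] [Module R N']

/-- A linear map is horizontal if it commutes with the connections. -/
def IsHorizontal (nM : Conn del M) (nN : Conn del N) (f : M →ₗ[R] N) : Prop :=
  ∀ k m, f (nM.toFun k m) = nN.toFun k (f m)

theorem Conn.tensor_tmul (nM : Conn del M) (nN : Conn del N) (k : ι) (m : M) (x : N) :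
    (nM.tensor nN).toFun k (m ⊗ₜ[R] x) = nM.toFun k m ⊗ₜ[R] x + m ⊗ₜ[R] nN.toFun k x := rfl

theorem Conn.pi_tprod (nM : Conn del M) {d : ℕ} (k : ι) (m : Fin d → M) :
    (nM.pi d).toFun k (PiTensorProduct.tprod R m) =
      ∑ i, PiTensorProduct.tprod R (Function.update m i (nM.toFun k (m i))) :=
  nM.piHom_tprod d k m

theorem Conn.schur_mk (nM : Conn del M) {d : ℕ} (J : Set (Equiv.Perm (Fin d) → ℂ)) (k : ι)
    (t : ⨂[R]^d M) : (nM.schur J).toFun k ((relations R M J).mkQ t) =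
      (relations R M J).mkQ ((nM.pi d).toFun k t) := rfl

theorem IsHorizontal.tensor {nM : Conn del M} {nN : Conn del N} {nM' : Conn del M'}
    {nN' : Conn del N'} {f : M →ₗ[R] N} {g : M' →ₗ[R] N'} (hf : IsHorizontal nM nN f)
    (hg : IsHorizontal nM' nN' g) :
    IsHorizontal (nM.tensor nM') (nN.tensor nN') (TensorProduct.map f g) := by
  intro k t
  induction t with
  | zero => simp
  | tmul m x =>
    simp only [Conn.tensor_tmul, map_add, TensorProduct.map_tmul, hf k, hg k]
  | add x y hx hy => simp only [map_add, hx, hy]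

theorem IsHorizontal.pi {nM : Conn del M} {nN : Conn del N} {f : M →ₗ[R] N}
    (hf : IsHorizontal nM nN f) (d : ℕ) :
    IsHorizontal (nM.pi d) (nN.pi d) (PiTensorProduct.map fun _ => f) := by
  intro k t
  induction t using PiTensorProduct.induction_on with
  | smul_tprod r m =>
    simp only [Conn.leibniz, map_add, map_smul, Conn.pi_tprod, map_sum,
      PiTensorProduct.map_tprod]
    congr 2
    refine Finset.sum_congr rfl fun i _ => ?_
    congr 1
    funext j
    by_cases h : j = i
    · subst h; simp [hf k]
    · simp [Function.update_of_ne h]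
  | add x y hx hy => simp only [map_add, hx, hy]

theorem IsHorizontal.schur {nM : Conn del M} {nN : Conn del N} {f : M →ₗ[R] N}
    (hf : IsHorizontal nM nN f) {d : ℕ} (J : Set (Equiv.Perm (Fin d) → ℂ)) :
    IsHorizontal (nM.schur J) (nN.schur J) (Schur.map J f) := by
  intro k x
  obtain ⟨t, rfl⟩ := Submodule.mkQ_surjective _ x
  exact congrArg (relations R N J).mkQ (hf.pi d k t)

theorem IsHorizontal.comp {P : Type} [AddCommGroup P] [Module R P] {nM : Conn del M}
    {nN : Conn del N} {nP : Conn del P} {f : M →ₗ[R] N} {g : N →ₗ[R] P}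
    (hg : IsHorizontal nN nP g) (hf : IsHorizontal nM nN f) : IsHorizontal nM nP (g ∘ₗ f) :=
  fun k m => (congrArg g (hf k m)).trans (hg k (f m))

theorem Conn.pi_tprod_of_flat (nM : Conn del M) {d : ℕ} {k : ι} {m : Fin d → M}
    (hm : ∀ i, nM.toFun k (m i) = 0) : (nM.pi d).toFun k (PiTensorProduct.tprod R m) = 0 := by
  rw [Conn.pi_tprod]
  refine Finset.sum_eq_zero fun i _ => ?_
  rw [hm]
  exact MultilinearMap.map_update_zero _ _ _

/-- Transport of a connection along an isomorphism. -/
def Conn.transport (nM : Conn del M) (e : M ≃ₗ[R] N) : Conn del N where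
  toFun k := (e.toLinearMap.toAddMonoidHom.comp (nM.toFun k)).comp e.symm.toLinearMap.toAddMonoidHom
  leibniz k r m := by
    change e (nM.toFun k (e.symm (r • m))) = del k r • m + r • e (nM.toFun k (e.symm m))
    rw [map_smul, nM.leibniz, map_add, map_smul, map_smul, LinearEquiv.apply_symm_apply]

theorem Conn.isHorizontal_transport (nM : Conn del M) (e : M ≃ₗ[R] N) :
    IsHorizontal nM (nM.transport e) e.toLinearMap := fun k m => by
  change e (nM.toFun k m) = e (nM.toFun k (e.symm (e m)))
  rw [LinearEquiv.symm_apply_apply]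

/-- The connection induced on a direct summand `P` by the projection `π`. -/
def Conn.compress (nM : Conn del M) (P : Submodule R M) (π : M →ₗ[R] P) (hπ : ∀ p : P, π p = p) :
    Conn del P where
  toFun k := (π.toAddMonoidHom.comp (nM.toFun k)).comp P.subtype.toAddMonoidHom
  leibniz k r m := by
    change π (nM.toFun k ((r • m : P) : M)) = del k r • m + r • π (nM.toFun k m)
    rw [Submodule.coe_smul, nM.leibniz, map_add, map_smul, map_smul, hπ]

/-- The compressed connection is that of the quotient by `ker π`: the element `m - π m` lies in the
kernel, and a horizontal kernel contains its derivative. -/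
theorem Conn.isHorizontal_compress (nM : Conn del M) (P : Submodule R M) (π : M →ₗ[R] P)
    (hπ : ∀ p : P, π p = p) (hker : ∀ k, ∀ m ∈ LinearMap.ker π, nM.toFun k m ∈ LinearMap.ker π) :
    IsHorizontal nM (nM.compress P π hπ) π := fun k m => by
  change π (nM.toFun k m) = π (nM.toFun k (π m))
  rw [← sub_eq_zero, ← map_sub, ← map_sub]
  exact hker k _ (by rw [LinearMap.mem_ker, map_sub, hπ, sub_self])

end HorizontalMaps

/-! ### Appending a tensor factor -/

section Append

variable {R A B A' B' : Type} [CommRing R] [AddCommGroup A] [Module R A] [AddCommGroup B]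
  [Module R B] [AddCommGroup A'] [Module R A'] [AddCommGroup B'] [Module R B'] {d : ℕ}

theorem snoc_tprod (m : Fin d → B) (b : B) :
    snoc R B d (PiTensorProduct.tprod R m ⊗ₜ[R] b) =
      PiTensorProduct.tprod R (Fin.snoc m b : Fin (d + 1) → B) := by
  rw [snoc, LinearMap.comp_apply, TensorProduct.map_tmul]
  have h : (PiTensorProduct.subsingletonEquiv (R := R) (s := fun _ : Fin 1 => B) 0).symm.toLinearMap
      b = PiTensorProduct.tprod R (fun _ : Fin 1 => b) :=
    (LinearEquiv.symm_apply_eq _).2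
      (PiTensorProduct.subsingletonEquiv_apply_tprod (R := R) (s := fun _ : Fin 1 => B) 0
        fun _ => b).symm
  rw [h]
  exact (TensorPower.tprod_mul_tprod R m (fun _ : Fin 1 => b)).trans
    (congrArg (PiTensorProduct.tprod R) (Fin.append_right_eq_snoc m _))

theorem appendR_tmul_tprod (a : A) (m : Fin d → B) (b : B) :
    appendR (a ⊗ₜ[R] PiTensorProduct.tprod R m) b =
      a ⊗ₜ[R] PiTensorProduct.tprod R (Fin.snoc m b : Fin (d + 1) → B) := by
  rw [appendR, TensorProduct.assoc_tmul, TensorProduct.map_tmul, snoc_tprod, LinearMap.id_apply]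

theorem appendR_add_left (x y : A ⊗[R] ⨂[R]^d B) (b : B) :
    appendR (x + y) b = appendR x b + appendR y b := by
  simp only [appendR, TensorProduct.add_tmul, map_add]

theorem appendR_smul_left (r : R) (x : A ⊗[R] ⨂[R]^d B) (b : B) :
    appendR (r • x) b = r • appendR x b := by
  simp only [appendR, ← TensorProduct.smul_tmul', map_smul]

theorem appendR_smul_right (r : R) (x : A ⊗[R] ⨂[R]^d B) (b : B) :
    appendR x (r • b) = r • appendR x b := by
  simp only [appendR, TensorProduct.tmul_smul, map_smul]

/-- `appendR` as a linear map in its first argument. -/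
def appendL (R A : Type) [CommRing R] [AddCommGroup A] [Module R A] {B : Type} [AddCommGroup B]
    [Module R B] (d : ℕ) (b : B) : A ⊗[R] (⨂[R]^d B) →ₗ[R] A ⊗[R] ⨂[R]^(d + 1) B where
  toFun x := appendR x b
  map_add' x y := appendR_add_left x y b
  map_smul' r x := appendR_smul_left r x b

theorem appendR_sum_right {ι : Type} (s : Finset ι) (x : A ⊗[R] ⨂[R]^d B) (b : ι → B) :
    appendR x (∑ i ∈ s, b i) = ∑ i ∈ s, appendR x (b i) := by
  simp only [appendR, TensorProduct.tmul_sum, map_sum]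

/-- This naturality lets the reduction modulo `Split` pass through the factor that each application
of `Drho` appends. -/
theorem map_appendR (f : A →ₗ[R] A') (g : B →ₗ[R] B') (x : A ⊗[R] ⨂[R]^d B) (b : B) :
    TensorProduct.map f (PiTensorProduct.map fun _ => g) (appendR x b) =
      appendR (TensorProduct.map f (PiTensorProduct.map fun _ => g) x) (g b) := by
  induction x with
  | zero => simp [appendR]
  | tmul a t =>
    induction t using PiTensorProduct.induction_on with
    | smul_tprod r m =>
      rw [TensorProduct.tmul_smul, appendR_smul_left, map_smul, map_smul, appendR_smul_left]
      simp only [appendR_tmul_tprod, TensorProduct.map_tmul, PiTensorProduct.map_tprod]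
      congr 3
      funext i
      refine Fin.lastCases ?_ (fun i => ?_) i
      · simp
      · simp
    | add x y hx hy => simp only [TensorProduct.tmul_add, appendR_add_left, map_add, hx, hy]
  | add x y hx hy => simp only [appendR_add_left, map_add, hx, hy]

end Append

/-! ### Sections represented by vector-valued functions -/

section Represents

variable {n : ℕ} {W W' M M' : Type} [AddCommGroup W] [Module ℂ W] [AddCommGroup W'] [Module ℂ W']
  [AddCommGroup M] [Module (Cinf n) M] [Module ℂ M]
  [AddCommGroup M'] [Module (Cinf n) M'] [Module ℂ M']

/-- `Represents Λ F m`: the section `m` is obtained from the smooth function `F` through the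
linear map `Λ` from the values of `F` to sections. -/
inductive Represents (Λ : W →ₗ[ℂ] M) : (Hn n → W) → M → Prop
  | const (w : W) : Represents Λ (fun _ => w) (Λ w)
  | add {F G : Hn n → W} {m m' : M} : Represents Λ F m → Represents Λ G m' →
      Represents Λ (fun z => F z + G z) (m + m')
  | smul (g : Cinf n) {F : Hn n → W} {m : M} : Represents Λ F m →
      Represents Λ (fun z => g.1 z • F z) (g • m)

namespace Represents

variable {Λ : W →ₗ[ℂ] M} {Λ' : W' →ₗ[ℂ] M'}

theorem zero : Represents Λ (fun _ : Hn n => (0 : W)) (0 : M) := by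
  simpa using Represents.const (n := n) (Λ := Λ) 0

theorem sum {ι : Type} (s : Finset ι) {F : ι → Hn n → W} {m : ι → M}
    (h : ∀ i ∈ s, Represents Λ (F i) (m i)) :
    Represents Λ (fun z => ∑ i ∈ s, F i z) (∑ i ∈ s, m i) := by
  classical
  induction s using Finset.induction_on with
  | empty => simpa using zero
  | insert a s ha ih =>
    simp only [Finset.sum_insert ha]
    exact (h a (Finset.mem_insert_self _ _)).add
      (ih fun i hi => h i (Finset.mem_insert_of_mem hi))

theorem isSmoothMap {F : Hn n → W} {m : M} (h : Represents Λ F m) : IsSmoothMap F := by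
  intro φ
  induction h with
  | const w => exact isSmooth_const _
  | add _ _ h1 h2 => simp only [map_add]; exact h1.add h2
  | smul g _ h1 => simp only [map_smul]; exact IsSmooth.smul g.2 h1

theorem map (A : W →ₗ[ℂ] W') (B : M →ₗ[Cinf n] M') (hAB : ∀ w, B (Λ w) = Λ' (A w))
    {F : Hn n → W} {m : M} (h : Represents Λ F m) : Represents Λ' (fun z => A (F z)) (B m) := by
  induction h with
  | const w => rw [hAB]; exact const _
  | add _ _ h1 h2 => simp only [map_add]; exact h1.add h2
  | smul g _ h1 => simp only [map_smul]; exact h1.smul g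

/-- Change of frame. -/
theorem trans {Λ' : W' →ₗ[ℂ] M} (a : Hn n → W →ₗ[ℂ] W')
    (ha : ∀ w, Represents Λ' (fun z => a z w) (Λ w))
    {F : Hn n → W} {m : M} (h : Represents Λ F m) : Represents Λ' (fun z => a z (F z)) m := by
  induction h with
  | const w => exact ha w
  | add _ _ h1 h2 => simp only [map_add]; exact h1.add h2
  | smul g _ h1 => simp only [map_smul]; exact h1.smul g

/-- `Represents` is generated for one function at a time, so the slots are released one after
another, starting from the case in which all of them are constant. -/
theorem multilinear {d : ℕ} (A : MultilinearMap ℂ (fun _ : Fin d => W) W')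
    (B : MultilinearMap (Cinf n) (fun _ : Fin d => M) M')
    (hAB : ∀ w : Fin d → W, B (fun i => Λ (w i)) = Λ' (A w)) (F : Fin d → Hn n → W) (m : Fin d → M)
    (h : ∀ i, Represents Λ (F i) (m i)) : Represents Λ' (fun z => A fun i => F i z) (B m) := by
  -- Here `s` is the set of slots that may vary; the remaining slots hold constant functions.
  have key : ∀ (s : Finset (Fin d)) (F : Fin d → Hn n → W) (m : Fin d → M),
      (∀ i ∈ s, Represents Λ (F i) (m i)) →
      (∀ i ∉ s, ∃ w : W, F i = (fun _ => w) ∧ m i = Λ w) →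
      Represents Λ' (fun z => A fun i => F i z) (B m) := by
    intro s
    induction s using Finset.induction_on with
    | empty =>
      intro F m _ h2
      choose w hw hm using fun i => h2 i (Finset.notMem_empty i)
      have e1 : m = fun i => Λ (w i) := funext hm
      simp only [hw, e1, hAB]
      exact const _
    | insert a s ha ih =>
      intro F m h1 h2
      -- The slot `a` is filled with an arbitrary represented section, by induction on its
      -- construction. Constants return to the case of `s`; sums and multiples come out by
      -- multilinearity.
      have h3 : ∀ (f : Hn n → W) (x : M), Represents Λ f x →
          Represents Λ' (fun z => A (Function.update (fun i => F i z) a (f z)))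
            (B (Function.update m a x)) := by
        intro f x hx
        induction hx with
        | const w =>
          have h4 := ih (Function.update F a fun _ => w) (Function.update m a (Λ w)) (fun i hi => by
            have hne : i ≠ a := fun e => ha (e ▸ hi)
            rw [Function.update_of_ne hne, Function.update_of_ne hne]
            exact h1 i (Finset.mem_insert_of_mem hi)) (fun i hi => by
            by_cases hia : i = a
            · subst hia; exact ⟨w, by simp, by simp⟩
            · rw [Function.update_of_ne hia, Function.update_of_ne hia]
              exact h2 i (by simp [hia, hi]))
          convert h4 using 3 with z
          funext i
          by_cases hia : i = a
          · subst hia; simp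
          · simp [Function.update_of_ne hia]
        | add _ _ h4 h5 => simp only [MultilinearMap.map_update_add]; exact h4.add h5
        | smul g _ h4 => simp only [MultilinearMap.map_update_smul]; exact h4.smul g
      have h5 := h3 (F a) (m a) (h1 a (Finset.mem_insert_self _ _))
      have e : ∀ z, Function.update (fun i => F i z) a (F a z) = fun i => F i z := fun z =>
        Function.update_eq_self a (fun i => F i z)
      simpa only [e, Function.update_eq_self] using h5
  exact key Finset.univ F m (fun i _ => h i) fun i hi => absurd (Finset.mem_univ i) hi

section Finite

variable [Module.Finite ℂ W]

theorem wirtV_add (k : Fin n × Fin n) {F G : Hn n → W} (hF : IsSmoothMap F) (hG : IsSmoothMap G) :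
    wirtV k (fun z => F z + G z) = fun z => wirtV k F z + wirtV k G z := by
  funext z
  simp only [wirtV, map_add, ← Finset.sum_add_distrib, ← add_smul]
  refine Finset.sum_congr rfl fun i _ => ?_
  congr 1
  exact congrFun (wirt_add (hF _) (hG _) k) z

theorem wirtV_smul (k : Fin n × Fin n) (g : Cinf n) {F : Hn n → W} (hF : IsSmoothMap F) :
    wirtV k (fun z => g.1 z • F z) =
      fun z => (del n k g).1 z • F z + g.1 z • wirtV k F z := by
  funext z
  have h : ∀ i, wirt k (fun z => (Module.finBasis ℂ W).coord i (g.1 z • F z)) z =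
      wirt k g.1 z * (Module.finBasis ℂ W).coord i (F z) +
        g.1 z * wirt k (fun z => (Module.finBasis ℂ W).coord i (F z)) z := fun i => by
    simp only [map_smul]
    exact wirt_smul g.2 (hF _) k z
  simp only [wirtV, h, add_smul, Finset.sum_add_distrib, mul_smul, ← Finset.smul_sum]
  congr 2
  exact (Module.finBasis ℂ W).sum_repr (F z)

theorem wirtV_const (k : Fin n × Fin n) (w : W) : wirtV k (fun _ : Hn n => w) = fun _ => 0 := by
  funext z
  simp [wirtV, wirt_const]

/-- A frame of horizontal sections identifies the connection with the componentwise
derivative. -/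
theorem deriv (nM : Conn (del n) M) (k : Fin n × Fin n) (hΛ : ∀ w, nM.toFun k (Λ w) = 0)
    {F : Hn n → W} {m : M} (h : Represents Λ F m) :
    Represents Λ (wirtV k F) (nM.toFun k m) := by
  induction h with
  | const w => rw [hΛ, wirtV_const]; exact zero
  | add h1 h2 h3 h4 =>
    rw [map_add, wirtV_add k h1.isSmoothMap h2.isSmoothMap]
    exact h3.add h4
  | smul g h1 h2 =>
    rw [nM.leibniz, wirtV_smul k g h1.isSmoothMap]
    exact (h1.smul _).add (h2.smul g)

theorem _root_.UnitaryDiffOp.represents_frame (Λ : W →ₗ[ℂ] M) (F : Hn n → W) (hF : IsSmoothMap F) :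
    Represents Λ F (frame Λ F hF) := by
  have h := sum (Λ := Λ) Finset.univ fun i _ => (const (Module.finBasis ℂ W i)).smul
    (⟨fun z => (Module.finBasis ℂ W).coord i (F z), hF _⟩ : Cinf n)
  have e : (fun z => ∑ i, (Module.finBasis ℂ W).coord i (F z) • Module.finBasis ℂ W i) = F :=
    funext fun z => (Module.finBasis ℂ W).sum_repr (F z)
  have h' : Represents Λ
      (fun z => ∑ i, (Module.finBasis ℂ W).coord i (F z) • Module.finBasis ℂ W i)
      (frame Λ F hF) := h
  rwa [e] at h'

variable [IsScalarTower ℂ (Cinf n) M]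

/-- The section is determined by the function: expansion in the chosen basis of `W` respects the
three constructors. On constants, the scalar tower identifies complex scalars with constant
functions. -/
theorem eq_frame {F : Hn n → W} {m : M} (h : Represents Λ F m) (hF : IsSmoothMap F) :
    m = frame Λ F hF := by
  induction h with
  | const w =>
    conv_lhs => rw [← (Module.finBasis ℂ W).sum_repr w, map_sum]
    refine Finset.sum_congr rfl fun i _ => ?_
    rw [map_smul, ← algebraMap_smul (Cinf n)]
    rfl
  | add h1 h2 h3 h4 =>
    rw [h3 h1.isSmoothMap, h4 h2.isSmoothMap]
    refine Finset.sum_add_distrib.symm.trans (Finset.sum_congr rfl fun i _ => ?_)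
    refine (add_smul _ _ _).symm.trans (congrArg (· • Λ (Module.finBasis ℂ W i)) ?_)
    exact Subtype.ext (funext fun z => (map_add ((Module.finBasis ℂ W).coord i) _ _).symm)
  | smul g h1 h2 =>
    rw [h2 h1.isSmoothMap]
    refine Finset.smul_sum.trans (Finset.sum_congr rfl fun i _ => ?_)
    refine (mul_smul _ _ _).symm.trans (congrArg (· • Λ (Module.finBasis ℂ W i)) ?_)
    exact Subtype.ext (funext fun z => (map_smul ((Module.finBasis ℂ W).coord i) _ _).symm)

end Finite

end Represents

end Represents

/-! ### Frames induced on tensor products and on `M^ρ` -/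

section BaseFrames

variable {n : ℕ} {W W' M M' : Type} [AddCommGroup W] [Module ℂ W] [AddCommGroup W'] [Module ℂ W']
  [AddCommGroup M] [Module (Cinf n) M] [Module ℂ M] [IsScalarTower ℂ (Cinf n) M]
  [AddCommGroup M'] [Module (Cinf n) M'] [Module ℂ M'] [IsScalarTower ℂ (Cinf n) M']

theorem Represents.const_smul {Λ : W →ₗ[ℂ] M} (c : ℂ) {F : Hn n → W} {m : M}
    (h : Represents Λ F m) : Represents Λ (fun z => c • F z) (c • m) := by
  have h1 := h.smul (algebraMap ℂ (Cinf n) c)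
  rw [algebraMap_smul] at h1
  exact h1

theorem Schur.base_mk_tprod (φ : W →ₗ[ℂ] M) {d : ℕ} (J : Set (Equiv.Perm (Fin d) → ℂ))
    (w : Fin d → W) :
    Schur.base (R := Cinf n) φ J ((relations ℂ W J).mkQ (PiTensorProduct.tprod ℂ w)) =
      (relations (Cinf n) M J).mkQ (PiTensorProduct.tprod (Cinf n) fun i => φ (w i)) := by
  simp [Schur.base, powBase]

theorem Schur.induction {d : ℕ} {J : Set (Equiv.Perm (Fin d) → ℂ)} {P : Schur ℂ W J → Prop}
    (hadd : ∀ x y, P x → P y → P (x + y))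
    (htprod : ∀ (c : ℂ) (w : Fin d → W),
      P (c • (relations ℂ W J).mkQ (PiTensorProduct.tprod ℂ w))) (x : Schur ℂ W J) : P x := by
  obtain ⟨t, rfl⟩ := Submodule.mkQ_surjective _ x
  induction t using PiTensorProduct.induction_on with
  | smul_tprod c w => rw [map_smul]; exact htprod c w
  | add x y hx hy => rw [map_add]; exact hadd _ _ hx hy

/-- If `a z` carries coordinates for `ψ` to coordinates for `φ`, the induced map `ρ(a z)` does so
for the induced frames. On the class of a decomposable tensor this is the multilinear case. -/
theorem Represents.schur {φ ψ : W →ₗ[ℂ] M} (a : Hn n → W →ₗ[ℂ] W)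
    (h : ∀ w, Represents φ (fun z => a z w) (ψ w)) {d : ℕ} (J : Set (Equiv.Perm (Fin d) → ℂ))
    (x : Schur ℂ W J) : Represents (Schur.base (R := Cinf n) φ J)
      (fun z => Schur.map J (a z) x) (Schur.base (R := Cinf n) ψ J x) := by
  induction x using Schur.induction with
  | hadd x y hx hy => simp only [map_add]; exact hx.add hy
  | htprod c w =>
    simp only [map_smul]
    refine Represents.const_smul c ?_
    rw [Schur.base_mk_tprod]
    have h1 := Represents.multilinear (Λ := φ) (Λ' := Schur.base (R := Cinf n) φ J)
      ((relations ℂ W J).mkQ.compMultilinearMap (PiTensorProduct.tprod ℂ))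
      ((relations (Cinf n) M J).mkQ.compMultilinearMap (PiTensorProduct.tprod (Cinf n)))
      (fun w => (Schur.base_mk_tprod φ J w).symm) (fun i z => a z (w i)) (fun i => ψ (w i))
      (fun i => h (w i))
    convert h1 using 1
    · funext z
      exact congrArg (relations ℂ W J).mkQ (PiTensorProduct.map_tprod (fun _ => a z) w)
    · rfl

theorem tensorBase_tmul (φ : W →ₗ[ℂ] M) (φ' : W' →ₗ[ℂ] M') (w : W) (w' : W') :
    tensorBase (R := Cinf n) φ φ' (w ⊗ₜ w') = φ w ⊗ₜ φ' w' := rfl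

theorem Represents.tmul {φ : W →ₗ[ℂ] M} {φ' : W' →ₗ[ℂ] M'} {F : Hn n → W} {m : M}
    {F' : Hn n → W'} {m' : M'} (h : Represents φ F m) (h' : Represents φ' F' m') :
    Represents (tensorBase (R := Cinf n) φ φ') (fun z => F z ⊗ₜ[ℂ] F' z) (m ⊗ₜ[Cinf n] m') := by
  induction h with
  | const w =>
    exact Represents.map (TensorProduct.mk ℂ W W' w) (TensorProduct.mk (Cinf n) M M' (φ w))
      (fun w' => (tensorBase_tmul φ φ' w w').symm) h'
  | add _ _ h1 h2 => simp only [TensorProduct.add_tmul]; exact h1.add h2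
  | smul g _ h1 => simp only [← TensorProduct.smul_tmul']; exact h1.smul g

theorem Represents.tensor {φ ψ : W →ₗ[ℂ] M} {φ' ψ' : W' →ₗ[ℂ] M'} (a : Hn n → W →ₗ[ℂ] W)
    (b : Hn n → W' →ₗ[ℂ] W') (h : ∀ w, Represents φ (fun z => a z w) (ψ w))
    (h' : ∀ w, Represents φ' (fun z => b z w) (ψ' w)) (x : W ⊗[ℂ] W') :
    Represents (tensorBase (R := Cinf n) φ φ') (fun z => TensorProduct.map (a z) (b z) x)
      (tensorBase (R := Cinf n) ψ ψ' x) := by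
  induction x with
  | zero => simp only [map_zero]; exact Represents.zero
  | tmul w w' => exact (h w).tmul (h' w')
  | add x y hx hy => simp only [map_add]; exact hx.add hy

/-- Complex scalars are constants for the connection, and on a decomposable tensor every term of the
product rule contains the derivative of a flat factor. -/
theorem Conn.schur_base_flat (nM : Conn (del n) M) {φ : W →ₗ[ℂ] M} {k : Fin n × Fin n}
    (hφ : ∀ w, nM.toFun k (φ w) = 0) {d : ℕ} (J : Set (Equiv.Perm (Fin d) → ℂ))
    (x : Schur ℂ W J) : (nM.schur J).toFun k (Schur.base (R := Cinf n) φ J x) = 0 := by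
  induction x using Schur.induction with
  | hadd x y hx hy => rw [map_add, map_add, hx, hy, add_zero]
  | htprod c w =>
    rw [map_smul, Schur.base_mk_tprod, ← algebraMap_smul (Cinf n), Conn.leibniz_const,
      Conn.schur_mk, Conn.pi_tprod_of_flat nM fun i => hφ (w i), map_zero, smul_zero]

theorem Conn.tensorBase_flat (nM : Conn (del n) M) (nM' : Conn (del n) M') {φ : W →ₗ[ℂ] M}
    {φ' : W' →ₗ[ℂ] M'} {k : Fin n × Fin n} (hφ : ∀ w, nM.toFun k (φ w) = 0)
    (hφ' : ∀ w, nM'.toFun k (φ' w) = 0) (x : W ⊗[ℂ] W') :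
    (nM.tensor nM').toFun k (tensorBase (R := Cinf n) φ φ' x) = 0 := by
  induction x with
  | zero => simp only [map_zero]
  | tmul w w' =>
    rw [tensorBase_tmul, Conn.tensor_tmul, hφ, hφ', TensorProduct.zero_tmul,
      TensorProduct.tmul_zero, add_zero]
  | add x y hx hy => rw [map_add, map_add, hx, hy, add_zero]

end BaseFrames

/-! ### Multilinear maps on `T n` as coordinates of `A ⊗ B^{⊗ d}` -/

section PolyFrame

variable {n : ℕ} {W A B : Type} [AddCommGroup W] [Module ℂ W]
  [AddCommGroup A] [Module (Cinf n) A] [Module ℂ A] [IsScalarTower ℂ (Cinf n) A]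
  [AddCommGroup B] [Module (Cinf n) B]

/-- The map `Ml_d(T, W) → A ⊗ B^{⊗ d}` induced by `Λ : W → A` and `u_ij ↦ σ_ij`. -/
def polyFrame (Λ : W →ₗ[ℂ] A) (σ : Fin n × Fin n → B) (d : ℕ) :
    Ml n d W →ₗ[ℂ] A ⊗[Cinf n] ⨂[Cinf n]^d B :=
  ∑ I : Fin d → Fin n × Fin n,
    (((TensorProduct.mk (Cinf n) A (⨂[Cinf n]^d B)).flip
        (PiTensorProduct.tprod (Cinf n) fun i => σ (I i))).restrictScalars ℂ ∘ₗ Λ) ∘ₗ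
    { toFun := fun g => g fun i => unitDir (I i) 1
      map_add' := fun _ _ => rfl
      map_smul' := fun _ _ => rfl }

theorem polyFrame_apply (Λ : W →ₗ[ℂ] A) (σ : Fin n × Fin n → B) (d : ℕ) (g : Ml n d W) :
    polyFrame Λ σ d g = ∑ I : Fin d → Fin n × Fin n, Λ (g fun i => unitDir (I i) 1) ⊗ₜ[Cinf n]
      PiTensorProduct.tprod (Cinf n) fun i => σ (I i) := by
  rw [polyFrame, LinearMap.sum_apply]
  rfl

theorem coordT_unitDir (k p : Fin n × Fin n) :
    coordT k (unitDir p 1) = if k = p then (1 : ℂ) else 0 := by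
  change (Pi.single p.1 (Pi.single p.2 (1 : ℂ)) : T n) k.1 k.2 = _
  by_cases h1 : k.1 = p.1
  · rw [h1, Pi.single_eq_same]
    by_cases h2 : k.2 = p.2
    · rw [h2, Pi.single_eq_same, if_pos (Prod.ext h1 h2)]
    · rw [Pi.single_eq_of_ne h2, if_neg fun e => h2 (congrArg Prod.snd e)]
  · rw [Pi.single_eq_of_ne h1, if_neg fun e => h1 (congrArg Prod.fst e)]
    rfl

theorem sum_coordT_smul_unitDir (u : T n) : ∑ k, coordT k u • unitDir k 1 = u := by
  funext i j
  rw [Finset.sum_apply, Finset.sum_apply, Finset.sum_eq_single (i, j)]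
  · simp [coordT, unitDir]
  · intro b _ hb
    have h := coordT_unitDir (i, j) b
    rw [if_neg hb.symm] at h
    change coordT b u * coordT (i, j) (unitDir b 1) = 0
    rw [h, mul_zero]
  · simp

theorem mlSnoc_apply {d : ℕ} (g : T n →ₗ[ℂ] ℂ) (h : Ml n d W) (u : Fin (d + 1) → T n) :
    mlSnoc g h u = g (u (Fin.last d)) • h (Fin.init u) := rfl

/-- The sum over multi-indices of length `d + 1` is split by the last index, which belongs to the
new variable; `coordT p` leaves only the index `p` there. -/
theorem polyFrame_mlSnoc (Λ : W →ₗ[ℂ] A) (σ : Fin n × Fin n → B) {d : ℕ} (p : Fin n × Fin n)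
    (g : Ml n d W) :
    polyFrame Λ σ (d + 1) (mlSnoc (coordT p) g) = appendR (polyFrame Λ σ d g) (σ p) := by
  rw [polyFrame_apply, polyFrame_apply,
    ← (Fin.snocEquiv fun _ : Fin (d + 1) => Fin n × Fin n).sum_comp, Fintype.sum_prod_type,
    Finset.sum_eq_single p]
  · refine Eq.trans ?_ (map_sum (appendL (Cinf n) A d (σ p)) _ _).symm
    refine Finset.sum_congr rfl fun I _ => ?_
    refine Eq.trans ?_ (appendR_tmul_tprod _ _ _).symm
    rw [mlSnoc_apply]
    congr 2
    · simp only [Fin.snocEquiv_apply, Fin.snoc_last, coordT_unitDir, if_true, one_smul]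
      congr 2
      funext i
      simp [Fin.init]
    · funext i
      refine Fin.lastCases ?_ (fun i => ?_) i
      · simp
      · simp
  · intro q _ hq
    refine Finset.sum_eq_zero fun I _ => ?_
    rw [mlSnoc_apply]
    simp only [Fin.snocEquiv_apply, Fin.snoc_last, coordT_unitDir, if_neg hq.symm, zero_smul,
      map_zero, TensorProduct.zero_tmul]
  · simp

/-- The multilinear map `u ↦ (∏ (u_i)_{I_i}) w`. -/
def mlSingle {d : ℕ} (I : Fin d → Fin n × Fin n) : W →ₗ[ℂ] Ml n d W where
  toFun w := ((MultilinearMap.mkPiAlgebra ℂ (Fin d) ℂ).compLinearMap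
    fun i => coordT (I i)).smulRight w
  map_add' v w := by refine MultilinearMap.ext fun u => ?_; simp
  map_smul' c w := by refine MultilinearMap.ext fun u => ?_; simp [smul_comm c]

theorem mlSingle_apply {d : ℕ} (I : Fin d → Fin n × Fin n) (w : W) (u : Fin d → T n) :
    mlSingle I w u = (∏ i, coordT (I i) (u i)) • w := by
  simp [mlSingle]

theorem sum_mlSingle {d : ℕ} (g : Ml n d W) :
    ∑ I : Fin d → Fin n × Fin n, mlSingle I (g fun i => unitDir (I i) 1) = g := by
  refine MultilinearMap.ext fun u => ?_
  rw [sum_apply]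
  conv_rhs => rw [← show (fun i => ∑ k, coordT k (u i) • unitDir k 1) = u from
    funext fun i => sum_coordT_smul_unitDir (u i)]
  rw [MultilinearMap.map_sum]
  refine Finset.sum_congr rfl fun I _ => ?_
  rw [mlSingle_apply, MultilinearMap.map_smul_univ]

theorem polyFrame_mlSingle (Λ : W →ₗ[ℂ] A) (σ : Fin n × Fin n → B) {d : ℕ}
    (I : Fin d → Fin n × Fin n) (w : W) :
    polyFrame Λ σ d (mlSingle I w) = Λ w ⊗ₜ PiTensorProduct.tprod (Cinf n) fun i => σ (I i) := by
  rw [polyFrame_apply, Finset.sum_eq_single I]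
  · rw [mlSingle_apply]
    simp [coordT_unitDir]
  · intro I' _ hI'
    obtain ⟨i, hi⟩ := Function.ne_iff.1 hI'
    rw [mlSingle_apply, Finset.prod_eq_zero (Finset.mem_univ i), zero_smul, map_zero,
      TensorProduct.zero_tmul]
    rw [coordT_unitDir, if_neg hi.symm]
  · simp

/-- Change of frame in `A ⊗ B^{⊗ d}`. -/
theorem represents_polyFrame {Λ Λ' : W →ₗ[ℂ] A} {σ σ' : Fin n × Fin n → B}
    (a : Hn n → W →ₗ[ℂ] W) (c : Hn n → T n →ₗ[ℂ] T n)
    (t : Fin n × Fin n → Fin n × Fin n → Cinf n)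
    (ha : ∀ w, Represents Λ' (fun z => a z w) (Λ w)) (hσ : ∀ p, σ p = ∑ k, t k p • σ' k)
    (hc : ∀ z k p, coordT p (c z (unitDir k 1)) = (t k p).1 z) {d : ℕ} (g : Ml n d W) :
    Represents (polyFrame Λ' σ' d)
      (fun z => (a z).compMultilinearMap (g.compLinearMap fun _ => c z)) (polyFrame Λ σ d g) := by
  -- Substituting `σ = ∑ t σ'` in each factor gives the coefficient `∏ t (I i) (P i)`, where `P`
  -- runs over the old frame and `I` over the new one. The sum over `I` is kept outside because it
  -- indexes the target.
  have h1 : Represents (polyFrame Λ' σ' d)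
      (fun z => ∑ I : Fin d → Fin n × Fin n, mlSingle I (∑ P : Fin d → Fin n × Fin n,
        (∏ i, t (I i) (P i)).1 z • a z (g fun i => unitDir (P i) 1)))
      (∑ I : Fin d → Fin n × Fin n, (∑ P : Fin d → Fin n × Fin n,
        (∏ i, t (I i) (P i)) • Λ (g fun i => unitDir (P i) 1)) ⊗ₜ[Cinf n]
          PiTensorProduct.tprod (Cinf n) fun i => σ' (I i)) := by
    refine Represents.sum _ fun I _ => ?_
    refine Represents.map (mlSingle I) ((TensorProduct.mk (Cinf n) A (⨂[Cinf n]^d B)).flip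
      (PiTensorProduct.tprod (Cinf n) fun i => σ' (I i)))
      (fun w => (polyFrame_mlSingle Λ' σ' I w).symm) ?_
    exact Represents.sum _ fun P _ => (ha _).smul _
  have hprod : ∀ (I P : Fin d → Fin n × Fin n) (z : Hn n),
      (∏ i, t (I i) (P i)).1 z = ∏ i, (t (I i) (P i)).1 z := by
    intro I P z
    exact map_prod ((Pi.evalRingHom (fun _ : Hn n => ℂ) z).comp (smoothAlg n).val.toRingHom)
      (fun i => t (I i) (P i)) Finset.univ
  convert h1 using 1
  · funext z
    conv_lhs => rw [← sum_mlSingle ((a z).compMultilinearMap (g.compLinearMap fun _ => c z))]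
    refine Finset.sum_congr rfl fun I _ => ?_
    congr 1
    rw [LinearMap.compMultilinearMap_apply, MultilinearMap.compLinearMap_apply]
    have h2 : (fun i => c z (unitDir (I i) 1)) =
        fun i => ∑ p, (t (I i) p).1 z • unitDir p 1 := by
      funext i
      rw [← sum_coordT_smul_unitDir (c z (unitDir (I i) 1))]
      simp only [hc]
    rw [h2, MultilinearMap.map_sum, map_sum]
    refine Finset.sum_congr rfl fun P _ => ?_
    rw [MultilinearMap.map_smul_univ, map_smul, hprod]
  · rw [polyFrame_apply]
    simp only [hσ, MultilinearMap.map_sum, MultilinearMap.map_smul_univ, TensorProduct.tmul_sum,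
      TensorProduct.sum_tmul, TensorProduct.tmul_smul, ← TensorProduct.smul_tmul']
    exact Finset.sum_comm

/-- The coordinates of `b` in the frame `σ` are the values on matrix units of the functional
attached to the new variable. With `b = dz k` and `c = τ(Ξ)` this produces a summand of `Cop`. -/
theorem Represents.mlSnoc {Λ : W →ₗ[ℂ] A} {σ : Fin n × Fin n → B} (c : Hn n → T n →ₗ[ℂ] T n)
    (s : Fin n × Fin n → Cinf n) (k : Fin n × Fin n)
    (hc : ∀ z p, coordT k (c z (unitDir p 1)) = (s p).1 z) {b : B} (hb : b = ∑ p, s p • σ p)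
    {d : ℕ} {F : Hn n → Ml n d W} {m : A ⊗[Cinf n] ⨂[Cinf n]^d B}
    (h : Represents (polyFrame Λ σ d) F m) :
    Represents (polyFrame Λ σ (d + 1))
      (fun z => UnitaryDiffOp.mlSnoc ((coordT k).comp (c z)) (F z)) (appendR m b) := by
  have h1 : Represents (polyFrame Λ σ (d + 1))
      (fun z => ∑ p, (s p).1 z • UnitaryDiffOp.mlSnoc (coordT p) (F z))
      (∑ p, s p • appendR m (σ p)) := by
    refine Represents.sum _ fun p _ => Represents.smul _ ?_
    exact Represents.map
      { toFun := fun g : Ml n d W => UnitaryDiffOp.mlSnoc (coordT p) g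
        map_add' := fun x y => by refine MultilinearMap.ext fun u => ?_; simp [mlSnoc_apply]
        map_smul' := fun r x => by refine MultilinearMap.ext fun u => ?_; simp [mlSnoc_apply, smul_comm r] }
      (appendL (Cinf n) A d (σ p)) (fun g => (polyFrame_mlSnoc Λ σ p g).symm) h
  convert h1 using 1
  · funext z
    refine MultilinearMap.ext fun u => ?_
    rw [sum_apply]
    simp only [mlSnoc_apply, smul_apply, smul_smul, ← Finset.sum_smul]
    congr 1
    rw [LinearMap.comp_apply]
    conv_lhs => rw [← sum_coordT_smul_unitDir (u (Fin.last d))]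
    rw [map_sum, map_sum]
    refine Finset.sum_congr rfl fun p _ => ?_
    rw [map_smul, map_smul, hc, smul_eq_mul, mul_comm]
  · rw [hb, appendR_sum_right]
    simp only [appendR_smul_right]

theorem Conn.polyFrame_flat (nA : Conn (del n) A) (nB : Conn (del n) B) {Λ : W →ₗ[ℂ] A}
    {σ : Fin n × Fin n → B} {k : Fin n × Fin n} (hΛ : ∀ w, nA.toFun k (Λ w) = 0)
    (hσ : ∀ p, nB.toFun k (σ p) = 0) {d : ℕ} (g : Ml n d W) :
    (nA.tensor (nB.pi d)).toFun k (polyFrame Λ σ d g) = 0 := by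
  rw [polyFrame_apply, map_sum]
  refine Finset.sum_eq_zero fun I _ => ?_
  rw [Conn.tensor_tmul, hΛ, Conn.pi_tprod_of_flat nB fun i => hσ (I i), TensorProduct.zero_tmul,
    TensorProduct.tmul_zero, add_zero]

end PolyFrame

/-! ### The coordinate functions `z`, `z^*` and `η` -/

section Coordinates

variable {n : ℕ}

/-- Evaluation of smooth functions at a point. -/
def evalAt (z : Hn n) : Cinf n →+* ℂ :=
  (Pi.evalRingHom (fun _ : Hn n => ℂ) z).comp (smoothAlg n).val.toRingHom

theorem evalAt_apply (z : Hn n) (f : Cinf n) : evalAt z f = f.1 z := rfl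

theorem Cinf.ext {f g : Cinf n} (h : ∀ z, f.1 z = g.1 z) : f = g :=
  Subtype.ext (funext h)

theorem isSmooth_clm (A : T n →L[ℝ] ℂ) : IsSmooth (fun z : Hn n => A z) :=
  A.contDiff.contDiffOn.congr fun z hz => by simp [ext, hz]

/-- The restriction of a real linear functional to `𝓗_n`. -/
def clmC (A : T n →L[ℝ] ℂ) : Cinf n := ⟨fun z => A z, isSmooth_clm A⟩

theorem del_clmC (k : Fin n × Fin n) (A : T n →L[ℝ] ℂ) : del n k (clmC A) =
    algebraMap ℂ (Cinf n)
      (2⁻¹ * (A (unitDir k 1) - Complex.I * A (unitDir k Complex.I))) := by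
  refine Cinf.ext fun z => ?_
  have h : ∀ v, realDel v (fun z : Hn n => A z) z = A v := fun v => by
    have := ext_eventuallyEq (fun z : Hn n => A z) A (fun _ => rfl) z
    simp [realDel, this.fderiv_eq]
  change wirt k (fun z : Hn n => A z) z = 2⁻¹ * (A (unitDir k 1) - Complex.I * A (unitDir k Complex.I))
  simp [wirt, h]

/-- The coordinate `z ↦ z_ij` as a real linear functional. -/
def entryL (i j : Fin n) : T n →L[ℝ] ℂ :=
  (ContinuousLinearMap.proj (R := ℝ) (φ := fun _ : Fin n => ℂ) j).comp
    (ContinuousLinearMap.proj (R := ℝ) (φ := fun _ : Fin n => Fin n → ℂ) i)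

theorem entryL_unitDir (i j : Fin n) (k : Fin n × Fin n) (c : ℂ) :
    entryL i j (unitDir k c) = if k = (i, j) then c else 0 := by
  change (Pi.single k.1 (Pi.single k.2 c) : T n) i j = _
  by_cases h1 : i = k.1
  · rw [h1, Pi.single_eq_same]
    by_cases h2 : j = k.2
    · rw [h2, Pi.single_eq_same, if_pos rfl]
    · rw [Pi.single_eq_of_ne h2, if_neg fun e => h2 (congrArg Prod.snd e).symm]
  · rw [Pi.single_eq_of_ne h1, if_neg fun e => h1 (congrArg Prod.fst e).symm]
    rfl

/-- The matrix `z` of coordinate functions. -/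
def zC (n : ℕ) : Matrix (Fin n) (Fin n) (Cinf n) := Matrix.of fun i j => clmC (entryL i j)

/-- The matrix `z^*` of conjugate coordinate functions. -/
def zS (n : ℕ) : Matrix (Fin n) (Fin n) (Cinf n) :=
  Matrix.of fun i j => clmC (conjL.comp (entryL j i))

theorem del_zC (k : Fin n × Fin n) (i j : Fin n) :
    del n k (zC n i j) = if k = (i, j) then 1 else 0 := by
  change del n k (clmC (entryL i j)) = _
  rw [del_clmC, entryL_unitDir, entryL_unitDir]
  by_cases h : k = (i, j)
  · simp only [if_pos h, Complex.I_mul_I]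
    norm_num
  · simp [if_neg h]

/-- The entries are antiholomorphic: conjugation sends the directions `1`, `I` to `1`, `-I`, and `1
- I * (-I) = 0`. The horizontality of `Split` comes from here. -/
theorem del_zS (k : Fin n × Fin n) (i j : Fin n) : del n k (zS n i j) = 0 := by
  change del n k (clmC (conjL.comp (entryL j i))) = _
  rw [del_clmC]
  simp only [ContinuousLinearMap.comp_apply, entryL_unitDir]
  by_cases h : k = (j, i)
  · simp [if_pos h, conjL]
  · simp [if_neg h]

/-- The matrix `η = i (z^* - z)`. -/
def etaC (n : ℕ) : Matrix (Fin n) (Fin n) (Cinf n) :=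
  algebraMap ℂ (Cinf n) Complex.I • (zS n - zC n)

theorem etaC_map (z : Hn n) : (etaC n).map (evalAt z) = (Xi (z : T n)).2 := by
  ext i j
  change evalAt z (algebraMap ℂ (Cinf n) Complex.I * (zS n i j - zC n i j)) = _
  rw [map_mul, map_sub]
  rfl

/-- Since `ξ` is the transpose of `η`, the single matrix `etaC` governs the frames of both `ω^-` and
`ω^+`. -/
theorem Xi_fst (z : T n) : (Xi z).1 = (Xi z).2ᵀ := by
  ext i j
  simp [Xi]

theorem Cinf.isUnit {f : Cinf n} (hf : ∀ z, f.1 z ≠ 0) : IsUnit f := by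
  have h : IsSmooth fun z => (f.1 z)⁻¹ := by
    refine (ContDiffOn.inv f.2 fun z hz => ?_).congr fun z hz => ?_
    · simpa [UnitaryDiffOp.ext, hz] using hf ⟨z, hz⟩
    · simp [UnitaryDiffOp.ext, hz]
  exact IsUnit.of_mul_eq_one (⟨fun z => (f.1 z)⁻¹, h⟩ : Cinf n)
    (Cinf.ext fun z => mul_inv_cancel₀ (hf z))

theorem Xi_snd_posDef (z : Hn n) : (Xi (z : T n)).2.PosDef := z.2

theorem isUnit_det_Xi_snd (z : Hn n) : IsUnit (Xi (z : T n)).2.det :=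
  (Xi_snd_posDef z).det_pos.ne'.isUnit

theorem isUnit_det_Xi_fst (z : Hn n) : IsUnit (Xi (z : T n)).1.det := by
  rw [Xi_fst, Matrix.det_transpose]
  exact isUnit_det_Xi_snd z

/-- The determinant is positive at every point because `η` is positive definite, and the inverse of
a nowhere vanishing smooth function is smooth. -/
theorem isUnit_det_etaC (n : ℕ) : IsUnit (etaC n).det := by
  refine Cinf.isUnit fun z => ?_
  rw [← evalAt_apply, RingHom.map_det]
  have h : (evalAt z).mapMatrix (etaC n) = (Xi (z : T n)).2 := etaC_map z
  rw [h]
  exact (isUnit_det_Xi_snd z).ne_zero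

theorem etaC_inv_map (z : Hn n) : (etaC n)⁻¹.map (evalAt z) = (Xi (z : T n)).2⁻¹ := by
  symm
  refine Matrix.inv_eq_right_inv ?_
  rw [← etaC_map, ← Matrix.map_mul, Matrix.mul_nonsing_inv _ (isUnit_det_etaC n)]
  exact Matrix.map_one _ (map_zero _) (map_one _)

end Coordinates

/-! ### Flat classes and generators of `H^χ` -/

section Flat

variable {n : ℕ} {L : AddSubgroup (E n)}

/-- The class of a constant form. -/
def flat (L : AddSubgroup (E n)) : (E n →L[ℝ] ℂ) →ₗ[ℂ] H L where
  toFun A := cls L (invForm L (fun _ => A) (isSmooth_const A))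
  map_add' _ _ := rfl
  map_smul' _ _ := rfl

/-- A combination of flat classes with smooth coefficients is thereby the class of one explicit
invariant form. -/
theorem Represents.flat_eq {Φ : Hn n → (E n →L[ℝ] ℂ)} {m : H L} (h : Represents (flat L) Φ m) :
    ∃ hΦ : IsSmooth Φ, m = cls L (invForm L Φ hΦ) := by
  induction h with
  | const A => exact ⟨isSmooth_const A, rfl⟩
  | add _ _ h1 h2 =>
    obtain ⟨s1, e1⟩ := h1
    obtain ⟨s2, e2⟩ := h2
    refine ⟨s1.add s2, ?_⟩
    rw [e1, e2]
    exact (map_add (cls L) _ _).symm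
  | smul g _ h1 =>
    obtain ⟨s1, e1⟩ := h1
    refine ⟨IsSmooth.smul g.2 s1, ?_⟩
    rw [e1]
    exact (map_smul (cls L) g _).symm

/-- The representing form does not depend on `z`, and the connection differentiates with `x` fixed.
-/
theorem gaussManin_flat (k : Fin n × Fin n) (A : E n →L[ℝ] ℂ) :
    (gaussManin L).toFun k (flat L A) = 0 := by
  have h : ∀ v, gmReal L v (flat L A) = 0 := fun v => by
    refine (congrArg (cls L) (Subtype.ext ?_ : closedDel L v (invForm L (fun _ => A)
      (isSmooth_const A)) = 0)).trans (map_zero (cls L))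
    funext z x
    exact congrFun (realDel_const v A) z
  simp only [gaussManin, AddMonoidHom.mk'_apply, h, smul_zero, sub_zero]

theorem flat_mem_Hchi {K : Subfield ℂ} {χ : ℂ →+* ℂ} {A : E n →L[ℝ] ℂ}
    (hA : ∀ (c : ℂ) x, A (c • x) = χ c * A x) : flat L A ∈ Hchi K L χ := by
  intro a _ ha
  refine congrArg (cls L) (Subtype.ext ?_ : pullClosed L a ha (invForm L (fun _ => A)
    (isSmooth_const A)) = χ a • invForm L (fun _ => A) (isSmooth_const A))
  funext z x
  exact ContinuousLinearMap.ext fun y => hA a y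

/-- `χ` of the coordinate `(x₁)_j`. -/
def chi1 (χL : ℂ →L[ℝ] ℂ) (j : Fin n) : E n →L[ℝ] ℂ := χL.comp (x1 j)

/-- `χ` of the coordinate `(x₂)_j`. -/
def chi2 (χL : ℂ →L[ℝ] ℂ) (j : Fin n) : E n →L[ℝ] ℂ := χL.comp (x2 j)

/-- For a nonreal `w ∈ K` and each of finitely many generators `s` of `L`, some multiple of `w s`
lies in `L`; the product `N` of these integers gives `a = N w`. A nonreal multiplier is what detects
`χ`. -/
theorem exists_multiplier {K : Subfield ℂ} (hK : IsImagQuadratic K) (hL : IsLattice K L) :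
    ∃ a ∈ K, a.im ≠ 0 ∧ ∀ l ∈ L, a • l ∈ L := by
  classical
  obtain ⟨w, hwK, hw⟩ := hK.not_real
  obtain ⟨S, hS⟩ := hL.fg
  have hSL : ∀ s ∈ S, s ∈ L := fun s hs => hS ▸ AddSubgroup.subset_closure hs
  have h1 : ∀ s : S, ∃ m : ℕ, m ≠ 0 ∧ m • (w • (s : E n)) ∈ L := fun s =>
    hL.full _ (fun i => K.mul_mem hwK ((hL.coord_mem s (hSL s s.2)).1 i))
      (fun i => K.mul_mem hwK ((hL.coord_mem s (hSL s s.2)).2 i))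
  choose m hm hmL using h1
  let N : ℕ := ∏ s : S, m s
  have hN : N ≠ 0 := Finset.prod_ne_zero_iff.2 fun s _ => hm s
  refine ⟨N * w, K.mul_mem (natCast_mem K N) hwK, ?_, fun l hl => ?_⟩
  · simpa [hN] using hw
  · rw [← hS] at hl
    induction hl using AddSubgroup.closure_induction with
    | mem s hs =>
      obtain ⟨c, hc⟩ := Finset.dvd_prod_of_mem m (Finset.mem_univ ⟨s, hs⟩)
      have h2 : ((N : ℂ) * w) • s = c • (m ⟨s, hs⟩ • (w • s)) := by
        rw [mul_smul, Nat.cast_smul_eq_nsmul, smul_smul c, mul_comm c, ← hc]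
      rw [h2]
      exact nsmul_mem (hmL ⟨s, hs⟩) c
    | zero => rw [smul_zero]; exact zero_mem L
    | add x y _ _ hx hy => rw [smul_add]; exact add_mem hx hy
    | neg x _ hx => rw [smul_neg]; exact neg_mem hx

theorem eq_sum_chi {χ : ℂ →+* ℂ} {χL : ℂ →L[ℝ] ℂ} (hχ : ∀ c, χL c = χ c) {A : E n →L[ℝ] ℂ}
    (hA : ∀ (c : ℂ) x, A (c • x) = χ c * A x) :
    A = ∑ j, A (e1 j 1) • chi1 χL j + ∑ j, A (e2 j 1) • chi2 χL j := by
  refine ContinuousLinearMap.ext fun x => ?_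
  have hx : x = ∑ j, x.1 j • e1 j 1 + ∑ j, x.2 j • e2 j 1 := by
    refine Prod.ext ?_ ?_
    · funext i
      simp [e1, e2, Prod.fst_sum, Pi.single_apply]
    · funext i
      simp [e1, e2, Prod.snd_sum, Pi.single_apply]
  conv_lhs => rw [hx]
  simp only [map_add, map_sum, hA, add_apply, sum_apply,
    smul_apply, smul_eq_mul]
  congr 1 <;> refine Finset.sum_congr rfl fun j _ => ?_
  · rw [mul_comm, ← hχ]; rfl
  · rw [mul_comm, ← hχ]; rfl

/-- `H^χ` is generated by the classes of the coordinates that transform through `χ`. -/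
theorem exists_eq_sum_flat {K : Subfield ℂ} (hdR : Function.Bijective (invCls L)) {a : ℂ}
    (haK : a ∈ K) (ha : a.im ≠ 0) (haL : ∀ l ∈ L, a • l ∈ L) {χ : ℂ →+* ℂ} {χL : ℂ →L[ℝ] ℂ}
    (hχ : ∀ c, χL c = χ c) {h : H L} (hh : h ∈ Hchi K L χ) :
    ∃ α β : Fin n → Cinf n,
      h = ∑ j, α j • flat L (chi1 χL j) + ∑ j, β j • flat L (chi2 χL j) := by
  obtain ⟨η, rfl⟩ := hdR.2 h
  let Φ : Hn n → (E n →L[ℝ] ℂ) := fun z => η.1.1 z 0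
  have hχr : ∀ r : ℝ, χ r = r := fun r => by
    have h1 : χL r = (r : ℂ) * χL 1 := by
      rw [← Complex.real_smul, ← map_smul, Complex.real_smul, mul_one]
    rw [← hχ, h1, hχ, map_one, mul_one]
  -- The pull-back of an invariant form is invariant, so the equality of classes is an equality of
  -- forms by uniqueness of the invariant representative.
  have hpull : ∀ z x, Φ z (a • x) = χ a * Φ z x := by
    have h1 := hh a haK haL
    have h2 : pullClosed L a haL η.1 ∈ invForms L := fun z x y =>
      congrArg (fun B : E n →L[ℝ] ℂ => B.comp (mulE a)) (η.2 z _ _)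
    have h3 : (⟨pullClosed L a haL η.1, h2⟩ : ↥(invForms L)) = χ a • η := hdR.1 (by
      refine Eq.trans h1 ?_
      rw [← algebraMap_smul (Cinf n), ← algebraMap_smul (Cinf n) (χ a) η, map_smul])
    intro z x
    have h4 := congrArg (fun θ : ↥(invForms L) => (θ.1.1 z 0 : E n →L[ℝ] ℂ) x) h3
    have h5 : η.1.1 z (mulE a 0) = η.1.1 z 0 := η.2 z _ _
    refine Eq.trans ?_ h4
    exact (congrArg (fun B : E n →L[ℝ] ℂ => B (a • x)) h5).symm
  -- Real linearity settles the real part of `a`; since `a.im ≠ 0`, the rule for `a` yields the rule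
  -- for `I`, and with it the rule for all of `ℂ`.
  have hI : ∀ z x, Φ z (Complex.I • x) = χ Complex.I * Φ z x := by
    intro z x
    have h1 := hpull z x
    have h2 : a • x = a.re • x + a.im • Complex.I • x := by
      conv_lhs => rw [← Complex.re_add_im a, add_smul, mul_smul]
      rw [Complex.coe_smul, Complex.coe_smul]
    have h3 : χ a = a.re + a.im * χ Complex.I := by
      conv_lhs => rw [← Complex.re_add_im a, map_add, map_mul, hχr, hχr]
    rw [h2, map_add, map_smul, map_smul, h3, Complex.real_smul, Complex.real_smul, add_mul,
      add_right_inj, mul_assoc] at h1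
    exact mul_left_cancel₀ (by exact_mod_cast ha) h1
  have hall : ∀ z (c : ℂ) x, Φ z (c • x) = χ c * Φ z x := by
    intro z c x
    have h2 : c • x = c.re • x + c.im • Complex.I • x := by
      conv_lhs => rw [← Complex.re_add_im c, add_smul, mul_smul]
      rw [Complex.coe_smul, Complex.coe_smul]
    have h3 : χ c = c.re + c.im * χ Complex.I := by
      conv_lhs => rw [← Complex.re_add_im c, map_add, map_mul, hχr, hχr]
    rw [h2, map_add, map_smul, map_smul, h3, Complex.real_smul, Complex.real_smul, hI]
    ring
  refine ⟨fun j => coef L (e1 j 1) η.1, fun j => coef L (e2 j 1) η.1, ?_⟩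
  have hr : Represents (flat L)
      (fun z => ∑ j, (coef L (e1 j 1) η.1).1 z • chi1 χL j +
        ∑ j, (coef L (e2 j 1) η.1).1 z • chi2 χL j)
      (∑ j, coef L (e1 j 1) η.1 • flat L (chi1 χL j) +
        ∑ j, coef L (e2 j 1) η.1 • flat L (chi2 χL j)) :=
    (Represents.sum _ fun j _ => (Represents.const _).smul _).add
      (Represents.sum _ fun j _ => (Represents.const _).smul _)
  obtain ⟨hs, e⟩ := hr.flat_eq
  rw [e]
  refine congrArg (cls L) (Subtype.ext ?_)
  funext z x
  exact (η.2 z x 0).trans (eq_sum_chi hχ (hall z))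

/-- A common class has a representative of each type. Both are invariant by Liouville's theorem,
hence equal, and a functional of both types is zero. -/
theorem disjoint_omega_split {K : Subfield ℂ} {χ : ℂ →+* ℂ} {ι : Type} [Fintype ι]
    (b : Module.Basis ι ℝ (E n)) (hb : ∀ i, b i ∈ L) :
    Disjoint (omega K L χ) (split K L χ) := by
  rw [Submodule.disjoint_def]
  rintro h ⟨η, hη, hη'⟩ ⟨θ, hθ, hθ'⟩
  have h1 : η ∈ invForms L := fun z x y => IsType10.const_of_closed b hb
    ((η.2.1.fibre z).differentiable (by simp)) (fun l hl x => η.2.2.1 l hl z x) (η.2.2.2 z)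
    (hη' z) x y
  have h2 : θ ∈ invForms L := fun z x y => IsType01.const_of_closed b hb
    ((θ.2.1.fibre z).differentiable (by simp)) (fun l hl x => θ.2.2.1 l hl z x) (θ.2.2.2 z)
    (hθ' z) x y
  have h3 : (⟨η, h1⟩ : ↥(invForms L)) = ⟨θ, h2⟩ :=
    invCls_injective b hb (hη.trans hθ.symm)
  have h4 : η = θ := congrArg Subtype.val h3
  have h5 : η = 0 := Subtype.ext (funext fun z => funext fun x =>
    eq_zero_of_isType10_of_isType01 (hη' z x) (h4 ▸ hθ' z x))
  refine Subtype.ext (hη.symm.trans ?_)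
  rw [h5, map_zero]
  rfl

end Flat

/-! ### The Hodge decompositions -/

section Hodge

/-- Inverting `e` recovers `X₁` from `Y - Z`, and then `Y` gives `X₂`, so `Y` and `Z` span
everything. In the application `X₁`, `X₂` are the flat classes, `Y` and `Z` the holomorphic and
antiholomorphic ones, and `e` is `z - z^*` or its transpose. -/
theorem isCompl_of_frames {R P ι : Type} [CommRing R] [AddCommGroup P] [Module R P] [Fintype ι]
    [DecidableEq ι] {w s : Submodule R P} {X₁ X₂ Y Z : ι → P} {e c : Matrix ι ι R}
    (he : IsUnit e.det)
    (hspan : ∀ p, ∃ α β : ι → R, p = ∑ j, α j • X₁ j + ∑ j, β j • X₂ j)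
    (hY : ∀ i, Y i ∈ w) (hZ : ∀ i, Z i ∈ s) (hYZ : ∀ i, Y i - Z i = ∑ j, e i j • X₁ j)
    (hYX : ∀ i, Y i = ∑ j, c i j • X₁ j + X₂ i) (hdisj : Disjoint w s) :
    IsCompl w s ∧ w = Submodule.span R (Set.range Y) ∧ s = Submodule.span R (Set.range Z) := by
  have hYw : Submodule.span R (Set.range Y) ≤ w := Submodule.span_le.2 (by
    rintro _ ⟨i, rfl⟩; exact hY i)
  have hZs : Submodule.span R (Set.range Z) ≤ s := Submodule.span_le.2 (by
    rintro _ ⟨i, rfl⟩; exact hZ i)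
  have hX₁ : ∀ j, X₁ j ∈ Submodule.span R (Set.range Y) ⊔ Submodule.span R (Set.range Z) := by
    intro j
    have h1 : X₁ j = ∑ i, e⁻¹ j i • (Y i - Z i) := by
      simp only [hYZ, Finset.smul_sum, smul_smul]
      rw [Finset.sum_comm]
      simp only [← Finset.sum_smul, ← Matrix.mul_apply, Matrix.nonsing_inv_mul e he]
      simp [Matrix.one_apply]
    rw [h1]
    exact sum_mem fun i _ => Submodule.smul_mem _ _ (sub_mem
      (Submodule.mem_sup_left (Submodule.subset_span ⟨i, rfl⟩))
      (Submodule.mem_sup_right (Submodule.subset_span ⟨i, rfl⟩)))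
  have hX₂ : ∀ j, X₂ j ∈ Submodule.span R (Set.range Y) ⊔ Submodule.span R (Set.range Z) := by
    intro j
    rw [← add_sub_cancel_left (∑ i, c j i • X₁ i) (X₂ j), ← hYX]
    exact sub_mem (Submodule.mem_sup_left (Submodule.subset_span ⟨j, rfl⟩))
      (sum_mem fun i _ => Submodule.smul_mem _ _ (hX₁ i))
  have htop : ∀ p, p ∈ Submodule.span R (Set.range Y) ⊔ Submodule.span R (Set.range Z) := by
    intro p
    obtain ⟨α, β, rfl⟩ := hspan p
    exact add_mem (sum_mem fun i _ => Submodule.smul_mem _ _ (hX₁ i))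
      (sum_mem fun i _ => Submodule.smul_mem _ _ (hX₂ i))
  refine ⟨⟨hdisj, codisjoint_iff.2 (eq_top_iff.2 fun p _ => sup_le_sup hYw hZs (htop p))⟩,
    le_antisymm (fun p hp => ?_) hYw, le_antisymm (fun p hp => ?_) hZs⟩
  -- In the decomposition of an element of `w` the part in the span of `Z` lies in both `w` and `s`,
  -- hence vanishes; so `w` is no larger than the span of `Y`.
  · obtain ⟨y, hy, t, ht, rfl⟩ := Submodule.mem_sup.1 (htop p)
    have : t ∈ w := (add_mem_cancel_left (hYw hy)).1 hp
    rwa [Submodule.disjoint_def.1 hdisj t this (hZs ht), add_zero]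
  · obtain ⟨y, hy, t, ht, rfl⟩ := Submodule.mem_sup.1 (htop p)
    have : y ∈ s := (add_mem_cancel_right (hZs ht)).1 hp
    rwa [Submodule.disjoint_def.1 hdisj y (hYw hy) this, zero_add]

variable {n : ℕ} (K : Subfield ℂ) (L : AddSubgroup (E n)) {χ : ℂ →+* ℂ} {χL : ℂ →L[ℝ] ℂ}
  (hχ : ∀ c, χL c = χ c)

/-- The class of `χ((x₁)_j)` in `H^χ`. -/
def hx1 (j : Fin n) : ↥(Hchi K L χ) :=
  ⟨flat L (chi1 χL j), flat_mem_Hchi fun c x => by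
    rw [← hχ]
    change χL (c * x.1 j) = χL c * χL (x.1 j)
    rw [hχ, hχ, hχ, map_mul]⟩

/-- The class of `χ((x₂)_j)` in `H^χ`. -/
def hx2 (j : Fin n) : ↥(Hchi K L χ) :=
  ⟨flat L (chi2 χL j), flat_mem_Hchi fun c x => by
    rw [← hχ]
    change χL (c * x.2 j) = χL c * χL (x.2 j)
    rw [hχ, hχ, hχ, map_mul]⟩

theorem gm_hx1 (k : Fin n × Fin n) (j : Fin n) : (gm K L χ).toFun k (hx1 K L hχ j) = 0 :=
  Subtype.ext (gaussManin_flat k _)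

theorem gm_hx2 (k : Fin n × Fin n) (j : Fin n) : (gm K L χ).toFun k (hx2 K L hχ j) = 0 :=
  Subtype.ext (gaussManin_flat k _)

/-- The class of the `i`-th coordinate of `m χ(x₁) + χ(x₂)`. -/
def hcomb (m : Matrix (Fin n) (Fin n) (Cinf n)) (i : Fin n) : ↥(Hchi K L χ) :=
  ∑ j, m i j • hx1 K L hχ j + hx2 K L hχ i

theorem hcomb_sub (m m' : Matrix (Fin n) (Fin n) (Cinf n)) (i : Fin n) :
    hcomb K L hχ m i - hcomb K L hχ m' i = ∑ j, (m - m') i j • hx1 K L hχ j := by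
  simp only [hcomb, add_sub_add_right_eq_sub, ← Finset.sum_sub_distrib, ← sub_smul,
    Matrix.sub_apply]

theorem gm_hcomb (k : Fin n × Fin n) (m : Matrix (Fin n) (Fin n) (Cinf n)) (i : Fin n) :
    (gm K L χ).toFun k (hcomb K L hχ m i) = ∑ j, del n k (m i j) • hx1 K L hχ j := by
  simp only [hcomb, map_add, map_sum, Conn.leibniz, gm_hx1, gm_hx2, smul_zero, add_zero]

theorem hcomb_eq_cls (m : Matrix (Fin n) (Fin n) (Cinf n)) (i : Fin n)
    (Φ : Hn n → (E n →L[ℝ] ℂ))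
    (hΦ : ∀ z, Φ z = ∑ j, (m i j).1 z • chi1 χL j + chi2 χL i) :
    ∃ hs : IsSmooth Φ, (hcomb K L hχ m i : H L) = cls L (invForm L Φ hs) := by
  have h1 : Represents (flat L) Φ (∑ j, m i j • flat L (chi1 χL j) + flat L (chi2 χL i)) := by
    rw [funext hΦ]
    exact (Represents.sum _ fun j _ => (Represents.const _).smul _).add (Represents.const _)
  obtain ⟨hs, e⟩ := h1.flat_eq
  refine ⟨hs, e ▸ ?_⟩
  simp [hcomb, hx1, hx2]

theorem hcomb_mem_split (m : Matrix (Fin n) (Fin n) (Cinf n)) (i : Fin n)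
    (Φ : Hn n → (E n →L[ℝ] ℂ))
    (hΦ : ∀ z, Φ z = ∑ j, (m i j).1 z • chi1 χL j + chi2 χL i)
    (ht : ∀ z : Hn n, IsType01 (z : T n) (Φ z)) : hcomb K L hχ m i ∈ split K L χ := by
  obtain ⟨hs, e⟩ := hcomb_eq_cls K L hχ m i Φ hΦ
  exact ⟨_, e.symm, fun z _ => ht z⟩

theorem isType10_uMinus (z : T n) (i : Fin n) : IsType10 z (uMinus z i) :=
  ⟨(LinearMap.proj i).comp (LinearMap.fst ℂ (Fin n → ℂ) (Fin n → ℂ)), fun _ => rfl⟩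

theorem isType10_uPlus (z : T n) (i : Fin n) : IsType10 z (uPlus z i) :=
  ⟨(LinearMap.proj i).comp (LinearMap.snd ℂ (Fin n → ℂ) (Fin n → ℂ)), fun _ => rfl⟩

theorem conjL_apply (c : ℂ) : conjL c = chiMinus c := rfl

theorem idL_apply (c : ℂ) : ContinuousLinearMap.id ℝ ℂ c = chiPlus c := rfl

theorem coe_duMinus (i : Fin n) :
    (duMinus K L i : ↥(Hchi K L chiMinus)) = hcomb K L conjL_apply (zC n) i := by
  obtain ⟨hs, e⟩ := hcomb_eq_cls K L conjL_apply (zC n) i (fun z => uMinus (z : T n) i)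
    fun z => rfl
  exact Subtype.ext e.symm

theorem coe_duPlus (i : Fin n) :
    (duPlus K L i : ↥(Hchi K L chiPlus)) = hcomb K L idL_apply (zC n)ᵀ i := by
  obtain ⟨hs, e⟩ := hcomb_eq_cls K L idL_apply (zC n)ᵀ i (fun z => uPlus (z : T n) i)
    fun z => rfl
  exact Subtype.ext e.symm

/-- Conjugation exchanges `H^+` and `H^-` as well as the types: the conjugate of `u_i^+` is `∑
conj(z_ji) x̄₁_j + x̄₂_i`, with coefficient matrix `z^*`. -/
theorem conj_uPlus_mem_split (i : Fin n) :
    hcomb K L conjL_apply (zS n) i ∈ split K L chiMinus := by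
  refine hcomb_mem_split K L conjL_apply (zS n) i (fun z => conjL.comp (uPlus (z : T n) i))
    (fun z => ?_) fun z => (isType10_uPlus _ i).conj
  refine ContinuousLinearMap.ext fun x => ?_
  simp [uPlus, chi1, chi2, zS, clmC, conjL, entryL]
  rfl

theorem conj_uMinus_mem_split (i : Fin n) :
    hcomb K L idL_apply (zS n)ᵀ i ∈ split K L chiPlus := by
  refine hcomb_mem_split K L idL_apply (zS n)ᵀ i (fun z => conjL.comp (uMinus (z : T n) i))
    (fun z => ?_) fun z => (isType10_uMinus _ i).conj
  refine ContinuousLinearMap.ext fun x => ?_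
  simp [uMinus, chi1, chi2, zS, clmC, conjL, entryL]
  rfl

theorem zC_sub_zS (n : ℕ) : zC n - zS n = algebraMap ℂ (Cinf n) Complex.I • etaC n := by
  rw [etaC, smul_smul, ← map_mul, Complex.I_mul_I, map_neg, map_one, neg_smul, one_smul, neg_sub]

theorem isUnit_det_zC_sub_zS (n : ℕ) : IsUnit (zC n - zS n).det := by
  rw [zC_sub_zS, Matrix.det_smul]
  exact (((Complex.I_ne_zero.isUnit).map (algebraMap ℂ (Cinf n))).pow _).mul (isUnit_det_etaC n)

variable {K L}

/-- The Hodge decompositions, with generators of the summands. -/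
theorem hodge_decomposition (hK : IsImagQuadratic K) (hL : IsLattice K L) :
    Function.Bijective (invCls L) ∧
    (IsCompl (omega K L chiMinus) (split K L chiMinus) ∧
      omega K L chiMinus = Submodule.span (Cinf n) (Set.range (hcomb K L conjL_apply (zC n))) ∧
      split K L chiMinus = Submodule.span (Cinf n) (Set.range (hcomb K L conjL_apply (zS n)))) ∧
    (IsCompl (omega K L chiPlus) (split K L chiPlus) ∧
      omega K L chiPlus = Submodule.span (Cinf n) (Set.range (hcomb K L idL_apply (zC n)ᵀ)) ∧
      split K L chiPlus = Submodule.span (Cinf n) (Set.range (hcomb K L idL_apply (zS n)ᵀ))) := by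
  obtain ⟨ι, _, b, hb, hbL⟩ := hL.exists_basis hK
  obtain ⟨a, haK, ha, haL⟩ := exists_multiplier hK hL
  have hdR := invCls_bijective b hb hbL
  have hspan : ∀ {χ : ℂ →+* ℂ} {χL : ℂ →L[ℝ] ℂ} (hχ : ∀ c, χL c = χ c) (p : ↥(Hchi K L χ)),
      ∃ α β : Fin n → Cinf n,
        p = ∑ j, α j • hx1 K L hχ j + ∑ j, β j • hx2 K L hχ j := by
    intro χ χL hχ p
    obtain ⟨α, β, e⟩ := exists_eq_sum_flat hdR haK ha haL hχ p.2
    refine ⟨α, β, Subtype.ext (e.trans ?_)⟩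
    simp [hx1, hx2]
  refine ⟨hdR, isCompl_of_frames (isUnit_det_zC_sub_zS n) (hspan conjL_apply) (fun i => ?_)
    (conj_uPlus_mem_split K L) (hcomb_sub K L conjL_apply _ _) (fun i => rfl)
    (disjoint_omega_split b hb),
    isCompl_of_frames (e := (zC n)ᵀ - (zS n)ᵀ) ?_ (hspan idL_apply) (fun i => ?_)
    (conj_uMinus_mem_split K L) (hcomb_sub K L idL_apply _ _) (fun i => rfl)
    (disjoint_omega_split b hb)⟩
  · rw [← coe_duMinus]; exact (duMinus K L i).2
  · rw [← Matrix.transpose_sub, Matrix.det_transpose]; exact isUnit_det_zC_sub_zS n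
  · rw [← coe_duPlus]; exact (duPlus K L i).2

theorem hodgeDeRham (hK : IsImagQuadratic K) (hL : IsLattice K L) : HodgeDeRham K L :=
  have h := hodge_decomposition hK hL
  ⟨h.1, h.2.1.1, h.2.2.1⟩

end Hodge

/-! ### The polarization pairing and the Kodaira–Spencer isomorphism -/

section KodairaSpencer

variable {n : ℕ} {K : Subfield ℂ} {L : AddSubgroup (E n)} (h : HodgeDeRham K L)

theorem Q_apply (η θ : ↥(closedForms L)) (z : Hn n) :
    (Q L η θ).1 z = 2⁻¹ * ∑ j, ((η.1 z 0 (e1 j 1) * θ.1 z 0 (e2 j 1) -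
      η.1 z 0 (e2 j 1) * θ.1 z 0 (e1 j 1)) + (η.1 z 0 (e1 j Complex.I) * θ.1 z 0 (e2 j Complex.I) -
      η.1 z 0 (e2 j Complex.I) * θ.1 z 0 (e1 j Complex.I))) := by
  simp only [Q, LinearMap.smul_apply, LinearMap.sum_apply]
  change (2⁻¹ : ℂ) * evalAt z _ = _
  rw [map_sum]
  rfl

/-- The pairing that the Riemann form induces on real linear functionals. -/
def constPairing (A B : E n →L[ℝ] ℂ) : ℂ :=
  2⁻¹ * ∑ j, ((A (e1 j 1) * B (e2 j 1) - A (e2 j 1) * B (e1 j 1)) +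
    (A (e1 j Complex.I) * B (e2 j Complex.I) - A (e2 j Complex.I) * B (e1 j Complex.I)))

theorem HodgeDeRham.rep_flat (A : E n →L[ℝ] ℂ) :
    h.rep (flat L A) = invForm L (fun _ => A) (isSmooth_const A) := by
  have h1 : (LinearEquiv.ofBijective (invCls L) h.deRham).symm (flat L A) =
      ⟨invForm L (fun _ => A) (isSmooth_const A), invForm_mem _ _⟩ :=
    (LinearEquiv.symm_apply_eq _).2 rfl
  exact congrArg Subtype.val h1

theorem HodgeDeRham.pairing_flat (A B : E n →L[ℝ] ℂ) :
    h.pairing (flat L A) (flat L B) = algebraMap ℂ (Cinf n) (constPairing A B) := by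
  change Q L (h.rep (flat L A)) (h.rep (flat L B)) = _
  rw [h.rep_flat, h.rep_flat]
  exact Cinf.ext fun z => Q_apply _ _ z

theorem e1_fst (j : Fin n) (c : ℂ) : (e1 j c).1 = Pi.single j c := rfl
theorem e1_snd (j : Fin n) (c : ℂ) : (e1 j c).2 = 0 := rfl
theorem e2_fst (j : Fin n) (c : ℂ) : (e2 j c).1 = 0 := rfl
theorem e2_snd (j : Fin n) (c : ℂ) : (e2 j c).2 = Pi.single j c := rfl

theorem chi1_apply (χL : ℂ →L[ℝ] ℂ) (a : Fin n) (x : E n) : chi1 χL a x = χL (x.1 a) := rfl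
theorem chi2_apply (χL : ℂ →L[ℝ] ℂ) (a : Fin n) (x : E n) : chi2 χL a x = χL (x.2 a) := rfl

theorem constPairing_11 (a b : Fin n) :
    constPairing (chi1 conjL a) (chi1 (ContinuousLinearMap.id ℝ ℂ) b) = 0 := by
  simp [constPairing, chi1_apply, e2_fst]

theorem constPairing_22 (a b : Fin n) :
    constPairing (chi2 conjL a) (chi2 (ContinuousLinearMap.id ℝ ℂ) b) = 0 := by
  simp [constPairing, chi2_apply, e1_snd]

/-- For `a = b` the directions `1` and `I` contribute `1` and `conj I * I = 1`; the factor `2⁻¹`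
makes the total `1`. -/
theorem constPairing_12 (a b : Fin n) :
    constPairing (chi1 conjL a) (chi2 (ContinuousLinearMap.id ℝ ℂ) b) = if a = b then 1 else 0 := by
  simp only [constPairing, chi1_apply, chi2_apply, e1_fst, e1_snd, e2_fst, e2_snd,
    ContinuousLinearMap.id_apply, Pi.zero_apply, map_zero, zero_mul, sub_zero, Pi.single_apply]
  rw [Finset.sum_eq_single a]
  · by_cases hab : a = b
    · subst hab; simp [conjL]; norm_num
    · simp [hab, Ne.symm hab]
  · intro j _ hj; simp [hj.symm]
  · simp

theorem constPairing_21 (a b : Fin n) :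
    constPairing (chi2 conjL a) (chi1 (ContinuousLinearMap.id ℝ ℂ) b) =
      if a = b then -1 else 0 := by
  simp only [constPairing, chi1_apply, chi2_apply, e1_fst, e1_snd, e2_fst, e2_snd,
    ContinuousLinearMap.id_apply, Pi.zero_apply, map_zero, zero_mul, zero_sub, Pi.single_apply]
  rw [Finset.sum_eq_single a]
  · by_cases hab : a = b
    · subst hab; simp [conjL]; norm_num
    · simp [hab, Ne.symm hab]
  · intro j _ hj; simp [hj.symm]
  · simp

/-- The pairing between `H^-` and `H^+`. -/
def HodgeDeRham.pairingMP : ↥(Hchi K L chiMinus) →ₗ[Cinf n] ↥(Hchi K L chiPlus) →ₗ[Cinf n] Cinf n :=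
  h.pairing.compl₁₂ (Hchi K L chiMinus).subtype (Hchi K L chiPlus).subtype

theorem HodgeDeRham.pairingMP_hx1_hcomb (a : Fin n) (m : Matrix (Fin n) (Fin n) (Cinf n))
    (j : Fin n) : h.pairingMP (hx1 K L conjL_apply a) (hcomb K L idL_apply m j) =
      if a = j then 1 else 0 := by
  have h1 : ∀ b, h.pairingMP (hx1 K L conjL_apply a) (hx1 K L idL_apply b) = 0 := fun b => by
    refine (h.pairing_flat _ _).trans ?_
    rw [constPairing_11, map_zero]
  have h2 : h.pairingMP (hx1 K L conjL_apply a) (hx2 K L idL_apply j) = if a = j then 1 else 0 := by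
    refine (h.pairing_flat _ _).trans ?_
    rw [constPairing_12]
    split_ifs <;> simp
  simp only [hcomb, map_add, map_sum, map_smul, h1, h2, smul_zero, Finset.sum_const_zero, zero_add]

theorem HodgeDeRham.pairingMP_hx2_hcomb (a : Fin n) (m : Matrix (Fin n) (Fin n) (Cinf n))
    (j : Fin n) : h.pairingMP (hx2 K L conjL_apply a) (hcomb K L idL_apply m j) = -m j a := by
  have h1 : ∀ b, h.pairingMP (hx2 K L conjL_apply a) (hx1 K L idL_apply b) =
      if a = b then -1 else 0 := fun b => by
    refine (h.pairing_flat _ _).trans ?_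
    rw [constPairing_21]
    split_ifs <;> simp
  have h2 : h.pairingMP (hx2 K L conjL_apply a) (hx2 K L idL_apply j) = 0 := by
    refine (h.pairing_flat _ _).trans ?_
    rw [constPairing_22, map_zero]
  simp [hcomb, map_add, map_sum, map_smul, h1, h2]

theorem HodgeDeRham.pairingMP_hcomb (m m' : Matrix (Fin n) (Fin n) (Cinf n)) (i j : Fin n) :
    h.pairingMP (hcomb K L conjL_apply m i) (hcomb K L idL_apply m' j) = m i j - m' j i := by
  conv_lhs => rw [hcomb]
  simp [h.pairingMP_hx1_hcomb, h.pairingMP_hx2_hcomb, sub_eq_add_neg]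

/-- On generators the pairing is `z_ij - z_ij = 0`. This orthogonality of `ω^-` and `ω^+` makes the
projection to `Split` in `KS` irrelevant. -/
theorem HodgeDeRham.pairingMP_omega
    (hm : omega K L chiMinus = Submodule.span (Cinf n) (Set.range (hcomb K L conjL_apply (zC n))))
    {w : ↥(Hchi K L chiMinus)} (hw : w ∈ omega K L chiMinus) (j : Fin n) :
    h.pairingMP w (hcomb K L idL_apply (zC n)ᵀ j) = 0 := by
  rw [hm] at hw
  induction hw using Submodule.span_induction with
  | mem x hx =>
    obtain ⟨i, rfl⟩ := hx
    rw [h.pairingMP_hcomb, Matrix.transpose_apply, sub_self]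
  | zero => simp
  | add x y _ _ hx hy => rw [map_add, LinearMap.add_apply, hx, hy, add_zero]
  | smul r x _ hx => rw [map_smul, LinearMap.smul_apply, hx, smul_zero]

theorem gm_hcomb_zC (k : Fin n × Fin n) (i : Fin n) :
    (gm K L chiMinus).toFun k (hcomb K L conjL_apply (zC n) i) =
      if k.1 = i then hx1 K L conjL_apply k.2 else 0 := by
  rw [gm_hcomb]
  simp only [del_zC, ite_smul, one_smul, zero_smul]
  rw [Finset.sum_eq_single k.2]
  · by_cases hk : k.1 = i
    · rw [if_pos hk, if_pos (Prod.ext hk rfl : k = (i, k.2))]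
    · rw [if_neg hk, if_neg fun e => hk (congrArg Prod.fst e)]
  · intro j _ hj
    rw [if_neg fun e => hj (congrArg Prod.snd e).symm]
  · simp

/-- `KS(du_i^- ⊗ du_j^+) = dz_ij` -/
theorem HodgeDeRham.KS_duMinus_duPlus
    (hm : omega K L chiMinus = Submodule.span (Cinf n) (Set.range (hcomb K L conjL_apply (zC n))))
    (i j : Fin n) : h.KS (duMinus K L i ⊗ₜ duPlus K L j) = dz (i, j) := by
  funext k
  set x := (gm K L chiMinus).toFun k (duMinus K L i) with hx
  have h1 : h.KS (duMinus K L i ⊗ₜ duPlus K L j) k =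
      h.pairingMP (h.ksAux k (duMinus K L i)) (hcomb K L idL_apply (zC n)ᵀ j) := by
    rw [← coe_duPlus]
    rfl
  -- The derivative of `du_i^-` differs from its `Split` component by an element of `ω^-`, which
  -- pairs to zero with `du_j^+`. The unprojected derivative is a flat class `x̄₁` or zero, so its
  -- pairing is explicit.
  have h2 : x - h.ksAux k (duMinus K L i) ∈ omega K L chiMinus := by
    rw [← Submodule.projectionOnto_apply_eq_zero_iff h.minus.symm, map_sub,
      Submodule.projectionOnto_apply_left]
    exact sub_self _
  have h3 := h.pairingMP_omega hm h2 j
  rw [map_sub, LinearMap.sub_apply, sub_eq_zero] at h3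
  rw [h1, ← h3, hx, coe_duMinus, gm_hcomb_zC]
  by_cases hk1 : k.1 = i
  · rw [if_pos hk1, h.pairingMP_hx1_hcomb, dz, Pi.single_apply]
    by_cases hk2 : k.2 = j
    · rw [if_pos hk2, if_pos (Prod.ext hk1 hk2)]
    · rw [if_neg hk2, if_neg fun e => hk2 (congrArg Prod.snd e)]
  · rw [if_neg hk1, map_zero, LinearMap.zero_apply, dz, Pi.single_apply,
      if_neg fun e => hk1 (congrArg Prod.fst e)]

theorem mem_span_of_coe {R P : Type} [CommRing R] [AddCommGroup P] [Module R P] {S : Submodule R P}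
    {ι : Type} [Fintype ι] {Y : ι → S} (hS : S = Submodule.span R (Set.range fun i => (Y i : P)))
    (w : S) : ∃ c : ι → R, ∑ i, c i • Y i = w := by
  have hw : (w : P) ∈ Submodule.span R (Set.range fun i => (Y i : P)) := hS ▸ w.2
  obtain ⟨c, hc⟩ := Submodule.mem_span_range_iff_exists_fun R |>.1 hw
  exact ⟨c, Subtype.ext (by simpa using hc)⟩

/-- The tensors `du_i^- ⊗ du_j^+` generate the source and go to the basis `dz_ij`, so `KS` reads off
the coefficients of any combination of them. -/
theorem HodgeDeRham.KS_bijective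
    (hm : omega K L chiMinus = Submodule.span (Cinf n) (Set.range (hcomb K L conjL_apply (zC n))))
    (hp : omega K L chiPlus = Submodule.span (Cinf n) (Set.range (hcomb K L idL_apply (zC n)ᵀ))) :
    Function.Bijective h.KS := by
  have hm' : omega K L chiMinus = Submodule.span (Cinf n)
      (Set.range fun i => (duMinus K L i : ↥(Hchi K L chiMinus))) := by
    simpa only [coe_duMinus] using hm
  have hp' : omega K L chiPlus = Submodule.span (Cinf n)
      (Set.range fun i => (duPlus K L i : ↥(Hchi K L chiPlus))) := by
    simpa only [coe_duPlus] using hp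
  have hall : ∀ t : ↥(omega K L chiMinus) ⊗[Cinf n] ↥(omega K L chiPlus),
      ∃ c : Om n, t = ∑ k, c k • (duMinus K L k.1 ⊗ₜ duPlus K L k.2) := by
    intro t
    induction t with
    | zero => exact ⟨0, by simp⟩
    | tmul x y =>
      obtain ⟨a, rfl⟩ := mem_span_of_coe hm' x
      obtain ⟨b, rfl⟩ := mem_span_of_coe hp' y
      refine ⟨fun k => a k.1 * b k.2, ?_⟩
      simp only [TensorProduct.sum_tmul, TensorProduct.tmul_sum, Fintype.sum_prod_type,
        ← TensorProduct.smul_tmul', TensorProduct.tmul_smul, mul_smul, Finset.smul_sum]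
      rw [Finset.sum_comm]
      exact Finset.sum_congr rfl fun i _ => Finset.sum_congr rfl fun j _ => smul_comm _ _ _
    | add x y hx hy =>
      obtain ⟨a, ha⟩ := hx
      obtain ⟨b, hb⟩ := hy
      exact ⟨a + b, by rw [ha, hb]; simp [add_smul, Finset.sum_add_distrib]⟩
  have hKS : ∀ c : Om n, h.KS (∑ k, c k • (duMinus K L k.1 ⊗ₜ duPlus K L k.2)) = c := by
    intro c
    simp only [map_sum, map_smul, h.KS_duMinus_duPlus hm]
    funext k
    simp [dz, Finset.sum_apply, Pi.single_apply]
  refine ⟨(injective_iff_map_eq_zero _).2 fun t ht => ?_, fun c => ⟨_, hKS c⟩⟩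
  obtain ⟨c, rfl⟩ := hall t
  rw [hKS] at ht
  simp [ht]

end KodairaSpencer

/-! ### Flat frames modulo `Split` -/

section FlatFrames

variable {n : ℕ}

/-- When frames are related by the matrix `c`, coordinate vectors are related by its transpose. -/
theorem represents_toLin' {M : Type} [AddCommGroup M] [Module (Cinf n) M] [Module ℂ M]
    [IsScalarTower ℂ (Cinf n) M] {φ ψ : (Fin n → ℂ) →ₗ[ℂ] M} {c : Matrix (Fin n) (Fin n) (Cinf n)}
    (h : ∀ i, ψ (Pi.single i 1) = ∑ j, c i j • φ (Pi.single j 1))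
    {C : Hn n → Matrix (Fin n) (Fin n) ℂ} (hC : ∀ z, C z = (c.map (evalAt z))ᵀ) (v : Fin n → ℂ) :
    Represents φ (fun z => Matrix.toLin' (C z) v) (ψ v) := by
  have h1 : Represents φ (fun z => ∑ i, v i • ∑ j, (c i j).1 z • (Pi.single j 1 : Fin n → ℂ))
      (∑ i, v i • ∑ j, c i j • φ (Pi.single j 1)) :=
    Represents.sum _ fun i _ => Represents.const_smul _
      (Represents.sum _ fun j _ => (Represents.const _).smul _)
  convert h1 using 1
  · funext z j
    rw [hC, Matrix.toLin'_apply, Matrix.mulVec, dotProduct, Finset.sum_apply]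
    refine Finset.sum_congr rfl fun i _ => ?_
    simp [Finset.sum_apply, Pi.single_apply, evalAt_apply, mul_comm]
  · conv_lhs => rw [pi_eq_sum_univ' v, map_sum]
    refine Finset.sum_congr rfl fun i _ => ?_
    rw [map_smul, ← h]
theorem inverse_frame {R M ι : Type} [CommRing R] [AddCommGroup M] [Module R M] [Fintype ι]
    [DecidableEq ι] {c : Matrix ι ι R} (hc : IsUnit c.det) {x y : ι → M}
    (h : ∀ i, x i = ∑ j, c i j • y j) (i : ι) : y i = ∑ j, c⁻¹ i j • x j := by
  simp only [h, Finset.smul_sum, smul_smul]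
  rw [Finset.sum_comm]
  simp only [← Finset.sum_smul, ← Matrix.mul_apply, Matrix.nonsing_inv_mul c hc]
  simp [Matrix.one_apply]

theorem map_tmul_frames {R M M' N ι : Type} [CommRing R] [AddCommGroup M] [Module R M]
    [AddCommGroup M'] [Module R M'] [AddCommGroup N] [Module R N] [Fintype ι]
    (B : M ⊗[R] M' →ₗ[R] N) {a b : Matrix ι ι R} {x y : ι → M} {x' y' : ι → M'}
    (h : ∀ i, x i = ∑ j, a i j • y j) (h' : ∀ i, x' i = ∑ j, b i j • y' j) (i j : ι) :
    B (x i ⊗ₜ x' j) = ∑ p : ι × ι, (a i p.1 * b j p.2) • B (y p.1 ⊗ₜ y' p.2) := by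
  rw [h, h', TensorProduct.sum_tmul, map_sum, Fintype.sum_prod_type]
  refine Finset.sum_congr rfl fun k _ => ?_
  rw [TensorProduct.tmul_sum, map_sum]
  refine Finset.sum_congr rfl fun l _ => ?_
  rw [TensorProduct.tmul_smul, ← TensorProduct.smul_tmul', map_smul, map_smul, smul_smul, mul_comm]

/-- These products of matrix entries are the coefficients that appear when frames of two tensor
factors are changed, as in `map_tmul_frames`. -/
theorem coordT_tau (a b : Matrix (Fin n) (Fin n) ℂ) (k p : Fin n × Fin n) :
    coordT k (tau a b (unitDir p 1)) = a p.1 k.1 * b p.2 k.2 := by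
  change (aᵀ * Matrix.of (unitDir p 1) * b) k.1 k.2 = _
  have h : Matrix.of (unitDir p (1 : ℂ)) = Matrix.single p.1 p.2 1 := by
    ext i j
    have := coordT_unitDir (i, j) p
    change unitDir p 1 i j = _ at this
    rw [Matrix.of_apply, this, Matrix.single_apply]
    simp [Prod.ext_iff, eq_comm]
  rw [h, Matrix.mul_assoc, Matrix.mul_apply, Finset.sum_eq_single p.1]
  · simp [Matrix.single_mul_apply_same]
  · intro j _ hj
    rw [Matrix.single_mul_apply_of_ne _ _ _ _ _ hj, mul_zero]
  · simp

variable {K : Subfield ℂ} {L : AddSubgroup (E n)} {χ : ℂ →+* ℂ} {χL : ℂ →L[ℝ] ℂ}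
  (hχ : ∀ c, χL c = χ c)

/-- If `Split` is generated by antiholomorphic combinations, it is horizontal. -/
theorem gm_mem_split {s : Submodule (Cinf n) ↥(Hchi K L χ)} {m : Matrix (Fin n) (Fin n) (Cinf n)}
    (hs : s = Submodule.span (Cinf n) (Set.range (hcomb K L hχ m)))
    (hm : ∀ k i j, del n k (m i j) = 0) (k : Fin n × Fin n) {x : ↥(Hchi K L χ)} (hx : x ∈ s) :
    (gm K L χ).toFun k x ∈ s := by
  have hx' := hx
  rw [hs] at hx'
  induction hx' using Submodule.span_induction with
  | mem y hy =>
    obtain ⟨i, rfl⟩ := hy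
    rw [gm_hcomb]
    simp only [hm, zero_smul, Finset.sum_const_zero]
    exact zero_mem _
  | zero => rw [map_zero]; exact zero_mem _
  | add y y' hy hy' ih ih' =>
    rw [← hs] at hy hy'
    rw [map_add]
    exact add_mem (ih hy) (ih' hy')
  | smul r y hy ih =>
    rw [← hs] at hy
    rw [Conn.leibniz]
    exact add_mem (Submodule.smul_mem _ _ hy) (Submodule.smul_mem _ _ (ih hy))

/-- The projection modulo a horizontal complement, applied to the flat sections
`i χ((x₁)_j)`. -/
def flatFrame (w : Submodule (Cinf n) ↥(Hchi K L χ)) (π : ↥(Hchi K L χ) →ₗ[Cinf n] w) :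
    (Fin n → ℂ) →ₗ[ℂ] w :=
  Fintype.linearCombination ℂ fun j =>
    π (algebraMap ℂ (Cinf n) Complex.I • hx1 K L hχ j)

theorem flatFrame_single (w : Submodule (Cinf n) ↥(Hchi K L χ)) (π : ↥(Hchi K L χ) →ₗ[Cinf n] w)
    (j : Fin n) : flatFrame hχ w π (Pi.single j 1) =
      π (algebraMap ℂ (Cinf n) Complex.I • hx1 K L hχ j) := by
  rw [flatFrame, Fintype.linearCombination_apply_single, one_smul]

theorem flatFrame_flat {w : Submodule (Cinf n) ↥(Hchi K L χ)} {π : ↥(Hchi K L χ) →ₗ[Cinf n] w}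
    {nw : Conn (del n) w} (hπ : IsHorizontal (gm K L χ) nw π) (k : Fin n × Fin n)
    (v : Fin n → ℂ) : nw.toFun k (flatFrame hχ w π v) = 0 := by
  rw [flatFrame, Fintype.linearCombination_apply, map_sum]
  refine Finset.sum_eq_zero fun j _ => ?_
  rw [← algebraMap_smul (Cinf n), Conn.leibniz_const, ← hπ, Conn.leibniz_const, gm_hx1,
    smul_zero, map_zero, smul_zero]

/-- The two combinations share the term `χ(x₂)`, so modulo the one with matrix `m'` only `(m - m')
χ(x₁)` remains. The factor `i` of `m - m'` is absorbed by the one in `flatFrame`. -/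
theorem eq_sum_flatFrame {w : Submodule (Cinf n) ↥(Hchi K L χ)} {π : ↥(Hchi K L χ) →ₗ[Cinf n] w}
    {m m' e : Matrix (Fin n) (Fin n) (Cinf n)} (hm' : ∀ i, π (hcomb K L hχ m' i) = 0)
    (he : m - m' = algebraMap ℂ (Cinf n) Complex.I • e) (i : Fin n) :
    π (hcomb K L hχ m i) = ∑ j, e i j • flatFrame hχ w π (Pi.single j 1) := by
  have h1 := congrArg π (hcomb_sub K L hχ m m' i)
  rw [map_sub, hm', sub_zero] at h1
  rw [h1, map_sum]
  refine Finset.sum_congr rfl fun j _ => ?_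
  rw [he, flatFrame_single, Matrix.smul_apply, smul_eq_mul, mul_comm, mul_smul, map_smul]

end FlatFrames

/-! ### Comparison of the geometric operator with Shimura's -/

section Operators

variable {n : ℕ} {K : Subfield ℂ} {L : AddSubgroup (E n)} (h : HodgeDeRham K L)
  (hKS : Function.Bijective h.KS) {dm dp : ℕ} (Jm : Set (Equiv.Perm (Fin dm) → ℂ))
  (Jp : Set (Equiv.Perm (Fin dp) → ℂ))

/-- The connection on `ω^-` given by `ω^- ≅ H^- / Split`. -/
def HodgeDeRham.connMinus : Conn (del n) ↥(omega K L chiMinus) :=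
  (gm K L chiMinus).compress _ h.modMinus (Submodule.projectionOnto_apply_left h.minus)

/-- The connection on `ω^+` given by `ω^+ ≅ H^+ / Split`. -/
def HodgeDeRham.connPlus : Conn (del n) ↥(omega K L chiPlus) :=
  (gm K L chiPlus).compress _ h.modPlus (Submodule.projectionOnto_apply_left h.plus)

theorem HodgeDeRham.isHorizontal_modMinus
    (hs : split K L chiMinus = Submodule.span (Cinf n) (Set.range (hcomb K L conjL_apply (zS n)))) :
    IsHorizontal (gm K L chiMinus) h.connMinus h.modMinus :=
  Conn.isHorizontal_compress _ _ _ _ fun k m hm => by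
    rw [HodgeDeRham.modMinus, Submodule.ker_projectionOnto] at hm ⊢
    exact gm_mem_split conjL_apply hs del_zS k hm

theorem HodgeDeRham.isHorizontal_modPlus
    (hs : split K L chiPlus = Submodule.span (Cinf n) (Set.range (hcomb K L idL_apply (zS n)ᵀ))) :
    IsHorizontal (gm K L chiPlus) h.connPlus h.modPlus :=
  Conn.isHorizontal_compress _ _ _ _ fun k m hm => by
    rw [HodgeDeRham.modPlus, Submodule.ker_projectionOnto] at hm ⊢
    exact gm_mem_split idL_apply hs (fun k i j => del_zS k j i) k hm

/-- The flat frame `ν^-` of `ω^-`. -/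
def HodgeDeRham.nuMinus : (Fin n → ℂ) →ₗ[ℂ] ↥(omega K L chiMinus) :=
  flatFrame conjL_apply _ h.modMinus

/-- The flat frame `ν^+` of `ω^+`. -/
def HodgeDeRham.nuPlus : (Fin n → ℂ) →ₗ[ℂ] ↥(omega K L chiPlus) :=
  flatFrame idL_apply _ h.modPlus

theorem HodgeDeRham.lamMinus_single (i : Fin n) : lamMinus K L (Pi.single i 1) =
    ∑ j, etaC n i j • h.nuMinus (Pi.single j 1) := by
  rw [lamMinus, Fintype.linearCombination_apply_single, one_smul,
    ← Submodule.projectionOnto_apply_left h.minus (duMinus K L i), coe_duMinus]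
  exact eq_sum_flatFrame conjL_apply
    (fun i => (Submodule.projectionOnto_apply_eq_zero_iff h.minus).2 (conj_uPlus_mem_split K L i))
    (zC_sub_zS n) i

theorem HodgeDeRham.lamPlus_single (i : Fin n) : lamPlus K L (Pi.single i 1) =
    ∑ j, (etaC n)ᵀ i j • h.nuPlus (Pi.single j 1) := by
  rw [lamPlus, Fintype.linearCombination_apply_single, one_smul,
    ← Submodule.projectionOnto_apply_left h.plus (duPlus K L i), coe_duPlus]
  exact eq_sum_flatFrame idL_apply
    (fun i => (Submodule.projectionOnto_apply_eq_zero_iff h.plus).2 (conj_uMinus_mem_split K L i))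
    (by rw [← Matrix.transpose_sub, zC_sub_zS, Matrix.transpose_smul]) i

theorem HodgeDeRham.nuMinus_single (i : Fin n) : h.nuMinus (Pi.single i 1) =
    ∑ j, (etaC n)⁻¹ i j • lamMinus K L (Pi.single j 1) :=
  inverse_frame (isUnit_det_etaC n) h.lamMinus_single i

theorem HodgeDeRham.nuPlus_single (i : Fin n) : h.nuPlus (Pi.single i 1) =
    ∑ j, ((etaC n)⁻¹)ᵀ i j • lamPlus K L (Pi.single j 1) := by
  rw [Matrix.transpose_nonsing_inv]
  exact inverse_frame (by rw [Matrix.det_transpose]; exact isUnit_det_etaC n) h.lamPlus_single i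

theorem Xi_fst_inv (z : T n) : (Xi z).1⁻¹ = ((Xi z).2⁻¹)ᵀ := by
  rw [Xi_fst, Matrix.transpose_nonsing_inv]

/-- The flat frame of `(ω^-)^{ρ_-} ⊗ (ω^+)^{ρ_+}`. -/
def HodgeDeRham.nu : V n Jm Jp →ₗ[ℂ] OmegaRho K L Jm Jp :=
  tensorBase (Schur.base h.nuMinus Jm) (Schur.base h.nuPlus Jp)

/-- The transition matrices of the frames are `η` and `ᵗη`; coordinates change by their transposes
`ξ` and `η`, which is the source of `ρ(Ξ)` in Shimura's definition. -/
theorem HodgeDeRham.represents_lam (v : V n Jm Jp) : Represents (h.nu Jm Jp)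
    (fun z : Hn n => rho Jm Jp (Xi (z : T n)).1 (Xi (z : T n)).2 v) (lam Jm Jp K L v) :=
  Represents.tensor _ _
    (fun w => Represents.schur _ (fun v => represents_toLin' h.lamMinus_single
      (fun z => by rw [etaC_map, Xi_fst]) v) Jm w)
    (fun w => Represents.schur _ (fun v => represents_toLin' h.lamPlus_single
      (fun z => by rw [← Matrix.transpose_map, Matrix.transpose_transpose, etaC_map]) v) Jp w) v

theorem HodgeDeRham.represents_nu (v : V n Jm Jp) : Represents (lam Jm Jp K L)
    (fun z : Hn n => rho Jm Jp (Xi (z : T n)).1⁻¹ (Xi (z : T n)).2⁻¹ v) (h.nu Jm Jp v) :=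
  Represents.tensor _ _
    (fun w => Represents.schur _ (fun v => represents_toLin' h.nuMinus_single
      (fun z => by rw [etaC_inv_map, Xi_fst_inv]) v) Jm w)
    (fun w => Represents.schur _ (fun v => represents_toLin' h.nuPlus_single
      (fun z => by rw [← Matrix.transpose_map, Matrix.transpose_transpose, etaC_inv_map]) v) Jp w) v

/-- The flat frame of `Ω`. -/
def HodgeDeRham.sigma (p : Fin n × Fin n) : Om n :=
  h.KS (h.nuMinus (Pi.single p.1 1) ⊗ₜ h.nuPlus (Pi.single p.2 1))

/-- The connection on `Ω ≅ ω^- ⊗ ω^+`. -/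
def connOm : Conn (del n) (Om n) :=
  (h.connMinus.tensor h.connPlus).transport (LinearEquiv.ofBijective h.KS hKS)

/-- The connection on `(ω^-)^{ρ_-} ⊗ (ω^+)^{ρ_+}`. -/
def HodgeDeRham.connRho : Conn (del n) (OmegaRho K L Jm Jp) :=
  (h.connMinus.schur Jm).tensor (h.connPlus.schur Jp)

/-- The connection on `(ω^-)^{ρ_-} ⊗ (ω^+)^{ρ_+} ⊗ Ω^{⊗ d}`. -/
def connRhoD (d : ℕ) : Conn (del n) (OmegaRhoD K L Jm Jp d) :=
  (h.connRho Jm Jp).tensor ((connOm h hKS).pi d)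

theorem isHorizontal_KS :
    IsHorizontal (h.connMinus.tensor h.connPlus) (connOm h hKS) h.KS := fun k m =>
  Conn.isHorizontal_transport (h.connMinus.tensor h.connPlus) (LinearEquiv.ofBijective h.KS hKS) k m

theorem isHorizontal_modSplit (hm : IsHorizontal (gm K L chiMinus) h.connMinus h.modMinus)
    (hp : IsHorizontal (gm K L chiPlus) h.connPlus h.modPlus) (d : ℕ) :
    IsHorizontal (nablaRho K L Jm Jp d) (connRhoD h hKS Jm Jp d) (modSplit h Jm Jp d) :=
  have h1 : IsHorizontal _ (connOm h hKS) (h.KS.comp (TensorProduct.map h.modMinus h.modPlus)) :=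
    (isHorizontal_KS h hKS).comp (hm.tensor hp)
  have h2 : IsHorizontal _ (h.connRho Jm Jp)
      (TensorProduct.map (Schur.map Jm h.modMinus) (Schur.map Jp h.modPlus)) :=
    (hm.schur Jm).tensor (hp.schur Jp)
  h2.tensor (h1.pi d)

theorem connRhoD_polyFrame (hm : IsHorizontal (gm K L chiMinus) h.connMinus h.modMinus)
    (hp : IsHorizontal (gm K L chiPlus) h.connPlus h.modPlus) (d : ℕ) (k : Fin n × Fin n)
    (g : Ml n d (V n Jm Jp)) :
    (connRhoD h hKS Jm Jp d).toFun k (polyFrame (h.nu Jm Jp) h.sigma d g) = 0 := by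
  have h1 : ∀ v, h.connMinus.toFun k (h.nuMinus v) = 0 := flatFrame_flat conjL_apply hm k
  have h2 : ∀ v, h.connPlus.toFun k (h.nuPlus v) = 0 := flatFrame_flat idL_apply hp k
  refine Conn.polyFrame_flat (h.connRho Jm Jp) (connOm h hKS) (fun v => ?_) (fun p => ?_) g
  · exact Conn.tensorBase_flat _ _ (Conn.schur_base_flat _ h1 Jm) (Conn.schur_base_flat _ h2 Jp) v
  · refine (isHorizontal_KS h hKS k _).symm.trans ?_
    rw [Conn.tensor_tmul, h1, h2, TensorProduct.zero_tmul, TensorProduct.tmul_zero, add_zero,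
      map_zero]

theorem mod_ksInv (t : Om n) :
    (h.KS.comp (TensorProduct.map h.modMinus h.modPlus)) (ksInv h hKS t) = t := by
  have h1 : ∀ s : ↥(omega K L chiMinus) ⊗[Cinf n] ↥(omega K L chiPlus),
      TensorProduct.map h.modMinus h.modPlus (TensorProduct.map (omega K L chiMinus).subtype
        (omega K L chiPlus).subtype s) = s := by
    intro s
    induction s with
    | zero => simp
    | tmul x y =>
      rw [TensorProduct.map_tmul, TensorProduct.map_tmul]
      exact congrArg₂ (· ⊗ₜ[Cinf n] ·) (Submodule.projectionOnto_apply_left h.minus x)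
        (Submodule.projectionOnto_apply_left h.plus y)
    | add x y hx hy => simp only [map_add, hx, hy]
  refine (congrArg h.KS (h1 _)).trans ?_
  exact (LinearEquiv.ofBijective h.KS hKS).apply_symm_apply t

/-- Reduction modulo `Split` commutes with the connections and carries `ksInv (dz k)` back to `dz
k`. Hence discarding `Split` only after all `d` steps gives the same result as discarding it at each
step. -/
theorem modSplit_Drho (hm : IsHorizontal (gm K L chiMinus) h.connMinus h.modMinus)
    (hp : IsHorizontal (gm K L chiPlus) h.connPlus h.modPlus) (d : ℕ) (x : HRhoD K L Jm Jp d) :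
    modSplit h Jm Jp (d + 1) (Drho h hKS Jm Jp d x) =
      ∑ k, appendR ((connRhoD h hKS Jm Jp d).toFun k (modSplit h Jm Jp d x)) (dz k) := by
  rw [Drho, map_sum]
  refine Finset.sum_congr rfl fun k _ => ?_
  refine (map_appendR _ _ _ _).trans ?_
  refine congrArg₂ appendR ?_ (mod_ksInv h hKS (dz k))
  exact isHorizontal_modSplit h hKS Jm Jp hm hp d k x

theorem Schur.map_map_of_leftInverse {R M N : Type} [CommRing R] [Algebra ℂ R] [AddCommGroup M]
    [Module R M] [AddCommGroup N] [Module R N] {d : ℕ} (J : Set (Equiv.Perm (Fin d) → ℂ))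
    {f : M →ₗ[R] N} {g : N →ₗ[R] M} (hgf : ∀ m, g (f m) = m) (x : Schur R M J) :
    Schur.map J g (Schur.map J f x) = x := by
  obtain ⟨t, rfl⟩ := Submodule.mkQ_surjective _ x
  refine congrArg (relations R M J).mkQ
    (?_ : PiTensorProduct.map (fun _ => g) (PiTensorProduct.map (fun _ => f) t) = t)
  induction t using PiTensorProduct.induction_on with
  | smul_tprod r m => simp only [map_smul, PiTensorProduct.map_tprod, hgf]
  | add x y hx hy => simp only [map_add, hx, hy]

theorem modSplit_inclRho (x : OmegaRho K L Jm Jp) : modSplit h Jm Jp 0 (inclRho K L Jm Jp x) =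
    x ⊗ₜ PiTensorProduct.tprod (Cinf n) fun i => i.elim0 := by
  have h1 : ∀ x : Schur (Cinf n) ↥(omega K L chiMinus) Jm ⊗[Cinf n]
      Schur (Cinf n) ↥(omega K L chiPlus) Jp,
      TensorProduct.map (Schur.map Jm h.modMinus) (Schur.map Jp h.modPlus)
        (TensorProduct.map (Schur.map Jm (omega K L chiMinus).subtype)
          (Schur.map Jp (omega K L chiPlus).subtype) x) = x := by
    intro x
    induction x with
    | zero => simp
    | tmul a b =>
      rw [TensorProduct.map_tmul, TensorProduct.map_tmul]
      exact congrArg₂ (· ⊗ₜ[Cinf n] ·)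
        (Schur.map_map_of_leftInverse Jm (Submodule.projectionOnto_apply_left h.minus) a)
        (Schur.map_map_of_leftInverse Jp (Submodule.projectionOnto_apply_left h.plus) b)
    | add x y hx hy => simp only [map_add, hx, hy]
  refine congrArg₂ (fun (a : OmegaRho K L Jm Jp) b => a ⊗ₜ[Cinf n] b) (h1 x) ?_
  refine (PiTensorProduct.map_tprod _ _).trans (congrArg _ (funext fun i => i.elim0))

/-- In the flat frame the connection acts by `∂/∂z_k` on the coordinates, and appending `dz k`
inserts the functional `u ↦ (ᵗξ u η)_k` of the new variable. Summed over `k`, this is one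
application of `C`. -/
theorem represents_modSplit_DrhoIter (hm : IsHorizontal (gm K L chiMinus) h.connMinus h.modMinus)
    (hp : IsHorizontal (gm K L chiPlus) h.connPlus h.modPlus)
    (hdz : ∀ i j, h.KS (duMinus K L i ⊗ₜ duPlus K L j) = dz (i, j))
    {f : Hn n → V n Jm Jp} {x : OmegaRho K L Jm Jp} (hx : Represents (lam Jm Jp K L) f x) (d : ℕ) :
    Represents (polyFrame (h.nu Jm Jp) h.sigma d) (CopIter (rhoXi Jm Jp f) d)
      (modSplit h Jm Jp d (DrhoIter h hKS Jm Jp d (inclRho K L Jm Jp x))) := by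
  induction d with
  | zero =>
    -- The initial value `ρ(Ξ) f` consists of the coordinates of the section in the flat frame.
    have h1 : Represents (h.nu Jm Jp) (rhoXi Jm Jp f) x :=
      hx.trans _ (h.represents_lam Jm Jp)
    refine (modSplit_inclRho h Jm Jp x).symm ▸ ?_
    exact h1.map (Λ' := polyFrame (h.nu Jm Jp) h.sigma 0)
      { toFun := fun w : V n Jm Jp => (MultilinearMap.constOfIsEmpty ℂ (fun _ : Fin 0 => T n) w)
        map_add' := fun _ _ => rfl
        map_smul' := fun _ _ => rfl }
      ((TensorProduct.mk (Cinf n) (OmegaRho K L Jm Jp) (⨂[Cinf n]^0 (Om n))).flip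
        (PiTensorProduct.tprod (Cinf n) fun i => i.elim0))
      fun w => by
        rw [polyFrame_apply, Fintype.sum_unique]
        refine congrArg (fun t => h.nu Jm Jp w ⊗ₜ[Cinf n] PiTensorProduct.tprod (Cinf n) t) ?_
        exact funext fun i => i.elim0
  | succ d ih =>
    refine (modSplit_Drho h hKS Jm Jp hm hp d _).symm ▸ ?_
    refine Represents.sum _ fun k _ => ?_
    -- These are the coefficients of `dz k = KS(du^- ⊗ du^+)` in the frame `σ`; by `ξ = ᵗη` they
    -- agree with those of `τ(Ξ)`.
    refine Represents.mlSnoc _ (fun p => etaC n k.1 p.1 * (etaC n)ᵀ k.2 p.2) k (fun z p => ?_) ?_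
      (ih.deriv (connRhoD h hKS Jm Jp d) k (connRhoD_polyFrame h hKS Jm Jp hm hp d k))
    · rw [coordT_tau, Xi_fst, ← etaC_map]
      rfl
    · have h1 := map_tmul_frames h.KS h.lamMinus_single h.lamPlus_single k.1 k.2
      rwa [lamMinus, lamPlus, Fintype.linearCombination_apply_single,
        Fintype.linearCombination_apply_single, one_smul, one_smul, hdz] at h1

/-- `ρ ⊗ τ^d` as a linear map. -/
def rhoTauL (d : ℕ) (a b : Matrix (Fin n) (Fin n) ℂ) :
    Ml n d (V n Jm Jp) →ₗ[ℂ] Ml n d (V n Jm Jp) where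
  toFun := rhoTau Jm Jp a b
  map_add' _ _ := MultilinearMap.ext fun _ => map_add (rho Jm Jp a b) _ _
  map_smul' _ _ := MultilinearMap.ext fun _ => map_smul (rho Jm Jp a b) _ _

theorem HodgeDeRham.represents_polyFrame_nu (d : ℕ) (g : Ml n d (V n Jm Jp)) :
    Represents (lamD Jm Jp h d)
      (fun z : Hn n => rhoTauL Jm Jp d (Xi (z : T n)).1⁻¹ (Xi (z : T n)).2⁻¹ g)
      (polyFrame (h.nu Jm Jp) h.sigma d g) := by
  refine represents_polyFrame (Λ' := lam Jm Jp K L)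
    (σ' := fun p => h.KS (lamMinus K L (Pi.single p.1 1) ⊗ₜ lamPlus K L (Pi.single p.2 1)))
    (fun z => rho Jm Jp (Xi (z : T n)).1⁻¹ (Xi (z : T n)).2⁻¹)
    (fun z => tau (Xi (z : T n)).1⁻¹ (Xi (z : T n)).2⁻¹)
    (fun k p => (etaC n)⁻¹ p.1 k.1 * ((etaC n)⁻¹)ᵀ p.2 k.2) (h.represents_nu Jm Jp)
    (fun p => map_tmul_frames h.KS h.nuMinus_single h.nuPlus_single p.1 p.2) (fun z k p => ?_) g
  rw [coordT_tau, Xi_fst_inv, ← etaC_inv_map]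
  rfl

/-- The coordinates `C^d[ρ(Ξ) f]` in the flat frame are carried back to the frame `λ`, which
multiplies them by `(ρ ⊗ τ^d)(Ξ)⁻¹`. -/
theorem represents_geomDiff (hm : IsHorizontal (gm K L chiMinus) h.connMinus h.modMinus)
    (hp : IsHorizontal (gm K L chiPlus) h.connPlus h.modPlus)
    (hdz : ∀ i j, h.KS (duMinus K L i ⊗ₜ duPlus K L j) = dz (i, j))
    {f : Hn n → V n Jm Jp} {x : OmegaRho K L Jm Jp} (hx : Represents (lam Jm Jp K L) f x) (d : ℕ) :
    Represents (lamD Jm Jp h d) (shimuraIter Jm Jp d f) (geomDiff h hKS Jm Jp d x) := by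
  have h1 := represents_modSplit_DrhoIter h hKS Jm Jp hm hp hdz hx d
  have h2 := Represents.trans (Λ' := lamD Jm Jp h d)
    (fun z : Hn n => rhoTauL Jm Jp d (Xi (z : T n)).1⁻¹ (Xi (z : T n)).2⁻¹)
    (h.represents_polyFrame_nu Jm Jp d) h1
  exact h2

theorem tau_tau (a b a' b' : Matrix (Fin n) (Fin n) ℂ) (u : T n) :
    tau a b (tau a' b' u) = tau (a' * a) (b' * b) u := by
  change aᵀ * (a'ᵀ * Matrix.of u * b') * b = (a' * a)ᵀ * Matrix.of u * (b' * b)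
  simp only [Matrix.transpose_mul, Matrix.mul_assoc]

theorem tau_one (u : T n) : tau 1 1 u = u := by
  change Matrix.of.symm ((1 : Matrix (Fin n) (Fin n) ℂ)ᵀ * Matrix.of u * 1) = u
  rw [Matrix.transpose_one, Matrix.one_mul, Matrix.mul_one, Equiv.symm_apply_apply]

/-- For `d = 1` the factor `τ(Ξ)⁻¹` cancels the substitution `u ↦ ᵗξ u η` contained in `C`. -/
theorem shimura_eq_shimuraIter (f : Hn n → V n Jm Jp) :
    shimura Jm Jp f = shimuraIter Jm Jp 1 f := by
  funext z
  refine MultilinearMap.ext fun u => congrArg (rho Jm Jp (Xi (z : T n)).1⁻¹ (Xi (z : T n)).2⁻¹) ?_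
  have h1 : ∀ v, tau (Xi (z : T n)).1 (Xi (z : T n)).2
      (tau (Xi (z : T n)).1⁻¹ (Xi (z : T n)).2⁻¹ v) = v := fun v => by
    rw [tau_tau, Matrix.nonsing_inv_mul _ (isUnit_det_Xi_fst z),
      Matrix.nonsing_inv_mul _ (isUnit_det_Xi_snd z), tau_one]
  change (∑ k, UnitaryDiffOp.mlSnoc (coordT k) _ : Ml n 1 (V n Jm Jp)) u =
    (∑ k, UnitaryDiffOp.mlSnoc ((coordT k).comp _) _ : Ml n 1 (V n Jm Jp)) _
  rw [sum_apply, sum_apply]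
  refine Finset.sum_congr rfl fun k _ => ?_
  rw [mlSnoc_apply, mlSnoc_apply, LinearMap.comp_apply, h1]
  exact congrArg (fun v : Fin 0 → T n => coordT k (u (Fin.last 0)) •
    wirtV k (CopIter (rhoXi Jm Jp f) 0) z v) (funext fun i => i.elim0)

end Operators

end UnitaryDiffOp

end

theorem mainTheorem6 (n : ℕ) (hn : 0 < n) (K : Subfield ℂ) (hK : IsImagQuadratic K)
    (L : AddSubgroup (E n)) (hL : IsLattice K L) :
    ∃ (h : HodgeDeRham K L) (hKS : Function.Bijective h.KS),
      ∀ (dm dp : ℕ) (Jm : Set (Equiv.Perm (Fin dm) → ℂ)) (Jp : Set (Equiv.Perm (Fin dp) → ℂ))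
        (f : Hn n → V n Jm Jp) (hf : IsSmoothMap f),
        (∃ hD : IsSmoothMap (shimura Jm Jp f),
          geomDiff h hKS Jm Jp 1 (frame (lam Jm Jp K L) f hf) =
            frame (lamD Jm Jp h 1) (shimura Jm Jp f) hD) ∧
        (∀ d : ℕ, ∃ hD : IsSmoothMap (shimuraIter Jm Jp d f),
          geomDiff h hKS Jm Jp d (frame (lam Jm Jp K L) f hf) =
            frame (lamD Jm Jp h d) (shimuraIter Jm Jp d f) hD) ∧
        ∀ (d : ℕ) (N : Submodule ℂ (Ml n d (V n Jm Jp))), IsStable Jm Jp N →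
          ∃ hD : IsSmoothMap (shimuraZ Jm Jp N f),
            geomDiffZ Jm Jp h hKS N (frame (lam Jm Jp K L) f hf) =
              frame (lamZ Jm Jp h N) (shimuraZ Jm Jp N f) hD := by
  obtain ⟨-, ⟨-, hom, hsm⟩, -, hop, hsp⟩ := hodge_decomposition hK hL
  have h := hodgeDeRham hK hL
  have hKS := h.KS_bijective hom hop
  refine ⟨h, hKS, fun dm dp Jm Jp f hf => ?_⟩
  -- The single relation from which all three assertions follow: it contains both the smoothness of
  -- Shimura's function and the formula for the section.
  have key := represents_geomDiff h hKS Jm Jp (h.isHorizontal_modMinus hsm)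
    (h.isHorizontal_modPlus hsp) (h.KS_duMinus_duPlus hom) (represents_frame (lam Jm Jp K L) f hf)
  have h2 : ∀ d : ℕ, ∃ hD : IsSmoothMap (shimuraIter Jm Jp d f),
      geomDiff h hKS Jm Jp d (frame (lam Jm Jp K L) f hf) =
        frame (lamD Jm Jp h d) (shimuraIter Jm Jp d f) hD :=
    fun d => ⟨(key d).isSmoothMap, (key d).eq_frame _⟩
  refine ⟨?_, h2, fun d N _ => ?_⟩
  · rw [shimura_eq_shimuraIter]
    exact h2 1
  -- The two projections `φ_Z` are linear and compatible with the frame maps, so they preserve the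
  -- relation.
  · have h3 : Represents (lamZ Jm Jp h N) (shimuraZ Jm Jp N f)
        (geomDiffZ Jm Jp h hKS N (frame (lam Jm Jp K L) f hf)) :=
      (key d).map N.mkQ (geomN Jm Jp h N).mkQ fun g => rfl
    exact ⟨h3.isSmoothMap, h3.eq_frame _⟩
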